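/- Let $M$ be a connected smooth compact manifold of dimension $n\ge 2$ with smooth (possibly empty) boundary. A \emph{rough metric} $g$ on $M$ is a symmetric, measurable field of bilinear forms on the tangent spaces such that every point of $M$ lies in the domain of a chart $(U,\psi)$ for which there is a constant $C\ge 1$ with $C^{-1}|v|_{\psi^*\delta(y)}\le |v|_{g(y)}\le C|v|_{\psi^*\delta(y)}$ for almost every $y\in U$ and all $v\in T_yM$, where $\delta$ is the Euclidean metric. Let $\mu_g$ be the measure on $M$ given by $\sqrt{\det g}\,d\psi^*\mathcal L$ in each chart, with $\mathcal L$ the Lebesgue measure. Let $H^1(M)\subset L^2(M,d\mu_g)$ be the domain of the closure $\nabla$ of the exterior derivative $d\colon C^\infty(M)\to L^2(T^*M,d\mu_g)$ acting on complex-valued functions, with the inner product $(u,v)_{L^2}+(\nabla u,\nabla v)_{L^2}$, and let $H^1_0(M)$ be the closure in $H^1(M)$ of the smooth functions with compact support in the interior of $M$. Let $\rho\in L^\beta(M,d\mu_g)$ be real-valued with $\frac n2<\beta\le\infty$ and $\int_M\rho\,d\mu_g\neq 0$. (1) For every $u\in H^1(M)$ the function $\rho u$ is $\mu_g$-integrable,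 and there is a constant $C>0$ such that for all $u\in H^1(M)$ $$\Big\|u-\frac{1}{\int_M\rho\,d\mu_g}\int_M\rho u\,d\mu_g\Big\|_{L^2}\le C\,\|\nabla u\|_{L^2}.$$ Let further $\mathcal W$ be an admissible boundary condition, that is, a closed linear subspace of $H^1(M)$ with $H^1_0(M)\subset\mathcal W$, and put $\mathcal E[u,v]=(\nabla u,\nabla v)_{L^2}$ for $u,v\in\mathcal W$. Let $Z(\rho)=\mathcal W$ if $u\mapsto\sqrt{\mathcal E[u,u]}$ is a norm on $\mathcal W$ that is equivalent to the $H^1$ norm, and $Z(\rho)=\{u\in\mathcal W:\int_M\rho u\,d\mu_g=0\}$ otherwise. (2) $Z(\rho)$ is a linear subspace of $\mathcal W$, it is closed in the $H^1$ norm, and it has codimension at most $1$ in $\mathcal W$; the orthogonal complement of $Z(\rho)$ in $\mathcal W$ with respect to the $H^1$ inner product is a linear subspace of dimension at most $1$. (3) $u\mapsto\sqrt{\mathcal E[u,u]}$ is a norm on $Z(\rho)$, and it is equivalent to the $H^1$ norm. -/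

import Mathlib

open MeasureTheory Filter Topology
open scoped Manifold ContDiff ENNReal ComplexConjugate

noncomputable section

namespace RoughRiemannian

section Charts

variable {n : ℕ} [NeZero n] {M : Type*} [TopologicalSpace M]
  [ChartedSpace (EuclideanHalfSpace n) M]

/-- The charts of the smooth structure of `M` (a manifold with boundary, modelled on the
half-space). -/
def charts (n : ℕ) [NeZero n] (M : Type*) [TopologicalSpace M]
    [ChartedSpace (EuclideanHalfSpace n) M] :
    Set (OpenPartialHomeomorph M (EuclideanHalfSpace n)) :=
  IsManifold.maximalAtlas (𝓡∂ n) ∞ M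

/-- The image `ψ(U) ⊆ ℝⁿ` of a chart `(U, ψ)`. -/
def chartImage (e : OpenPartialHomeomorph M (EuclideanHalfSpace n)) :
    Set (EuclideanSpace ℝ (Fin n)) :=
  (e.extend (𝓡∂ n)).target

/-- The inverse `ψ⁻¹ : ψ(U) → U` of a chart `(U, ψ)`. -/
def chartInv (e : OpenPartialHomeomorph M (EuclideanHalfSpace n)) :
    EuclideanSpace ℝ (Fin n) → M :=
  (e.extend (𝓡∂ n)).symm

/-- The differential of `ψ⁻¹` at `y ∈ ψ(U)`, which identifies `ℝⁿ` with the tangent space of `M`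
at `ψ⁻¹(y)`. -/
def chartDiff (e : OpenPartialHomeomorph M (EuclideanHalfSpace n))
    (y : EuclideanSpace ℝ (Fin n)) :
    EuclideanSpace ℝ (Fin n) →L[ℝ] TangentSpace (𝓡∂ n) (chartInv e y) :=
  mfderivWithin 𝓘(ℝ, EuclideanSpace ℝ (Fin n)) (𝓡∂ n) (chartInv e) (Set.range (𝓡∂ n)) y

/-- The coordinate frame `∂/∂x₁, …, ∂/∂xₙ` of a chart `(U, ψ)` at the point `ψ⁻¹(y)`. -/
def chartFrame (e : OpenPartialHomeomorph M (EuclideanHalfSpace n))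
    (y : EuclideanSpace ℝ (Fin n)) (i : Fin n) : TangentSpace (𝓡∂ n) (chartInv e y) :=
  chartDiff e y (EuclideanSpace.single i 1)

/-- The basis of the tangent space at `x` that comes with its construction (as the coordinate
tangent space of a preferred chart at `x`). -/
def stdFrame (x : M) (i : Fin n) : TangentSpace (𝓡∂ n) x :=
  (EuclideanSpace.single i 1 : EuclideanSpace ℝ (Fin n))

/-- The Gram matrix of a bilinear form on a tangent space with respect to a frame. -/
def gram {x : M} (b : LinearMap.BilinForm ℝ (TangentSpace (𝓡∂ n) x))
    (v : Fin n → TangentSpace (𝓡∂ n) x) : Matrix (Fin n) (Fin n) ℝ :=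
  Matrix.of fun i j => b (v i) (v j)

end Charts

/-- A rough metric: a symmetric, measurable field of bilinear forms on the tangent spaces which
near each point, in a suitable chart `(U, ψ)`, is almost everywhere comparable to the pullback
of the Euclidean metric. Measurability and "almost everywhere" refer to Lebesgue measure in
charts, so that `AEMeasurable` means Lebesgue measurable. -/
structure RoughMetric (n : ℕ) [NeZero n] (M : Type*) [TopologicalSpace M]
    [ChartedSpace (EuclideanHalfSpace n) M] where
  form : ∀ x : M, LinearMap.BilinForm ℝ (TangentSpace (𝓡∂ n) x)
  symm' : ∀ (x : M) (v w : TangentSpace (𝓡∂ n) x), form x v w = form x w v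
  measurable' : ∀ e ∈ charts n M, ∀ i j : Fin n,
    AEMeasurable (fun y => gram (form (chartInv e y)) (chartFrame e y) i j)
      (volume.restrict (chartImage e))
  comparable' : ∀ x : M, ∃ e ∈ charts n M, x ∈ e.source ∧ ∃ C : ℝ, 1 ≤ C ∧
    ∀ᵐ y ∂(volume.restrict (chartImage e)), ∀ u : EuclideanSpace ℝ (Fin n),
      C⁻¹ * ‖u‖ ≤ √(form (chartInv e y) (chartDiff e y u) (chartDiff e y u)) ∧
      √(form (chartInv e y) (chartDiff e y u) (chartDiff e y u)) ≤ C * ‖u‖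

namespace RoughMetric

variable {n : ℕ} [NeZero n] {M : Type*} [TopologicalSpace M]
  [ChartedSpace (EuclideanHalfSpace n) M] [MeasurableSpace M]

/-- The measure `√(det g) d(ψ^* 𝓛)` on the domain of a chart `(U, ψ)`, extended by zero to `M`. -/
def chartVolume (g : RoughMetric n M) (e : OpenPartialHomeomorph M (EuclideanHalfSpace n)) :
    Measure M :=
  ((volume.restrict (chartImage e)).withDensity
    (fun y => ENNReal.ofReal
      √(gram (g.form (chartInv e y)) (chartFrame e y)).det)).map (chartInv e)

/-- The measure `μ_g`. The measures `√(det g) d(ψ^* 𝓛)` of two charts agree where both charts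
are defined, and `μ_g` is the measure that restricts to each of them: it is their least upper
bound among all measures on `M`. -/
def vol (g : RoughMetric n M) : Measure M :=
  ⨆ e ∈ charts n M, g.chartVolume e

/-- The Hermitian inner product `⟨α, η⟩_g = ∑ g^{ij} αᵢ conj(ηⱼ)` of complex covectors at `x`,
where `(g^{ij})` is the inverse of the Gram matrix. (It does not depend on the frame.) -/
def coInner (g : RoughMetric n M) (x : M) (α η : TangentSpace (𝓡∂ n) x →L[ℝ] ℂ) : ℂ :=
  ∑ i, ∑ j, (((gram (g.form x) (stdFrame x))⁻¹ i j : ℝ) : ℂ) *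
    (α (stdFrame x i) * conj (η (stdFrame x j)))

end RoughMetric

section Sobolev

variable {n : ℕ} [NeZero n] {M : Type*} [TopologicalSpace M]
  [ChartedSpace (EuclideanHalfSpace n) M] [MeasurableSpace M]

/-- A (not necessarily continuous) field of complex covectors on `M`. -/
abbrev CovectorField (n : ℕ) [NeZero n] (M : Type*) [TopologicalSpace M]
    [ChartedSpace (EuclideanHalfSpace n) M] :=
  ∀ x : M, TangentSpace (𝓡∂ n) x →L[ℝ] ℂ

/-- A covector field is measurable if its components in each chart are Lebesgue measurable. -/
def CovectorField.IsMeasurable (α : CovectorField n M) : Prop :=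
  ∀ e ∈ charts n M, ∀ i : Fin n,
    AEMeasurable (fun y => α (chartInv e y) (chartFrame e y i)) (volume.restrict (chartImage e))

/-- The differential `dφ` of a complex-valued function on `M`. -/
def differential (φ : M → ℂ) : CovectorField n M :=
  fun x => mfderiv (𝓡∂ n) 𝓘(ℝ, ℂ) φ x

/-- The space `C^∞(M)` of complex-valued functions, smooth up to the boundary. -/
def smoothFunctions (n : ℕ) [NeZero n] (M : Type*) [TopologicalSpace M]
    [ChartedSpace (EuclideanHalfSpace n) M] : Set (M → ℂ) :=
  {φ | ContMDiff (𝓡∂ n) 𝓘(ℝ, ℂ) ∞ φ}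

/-- The space `C_c^∞` of smooth functions with compact support in the interior of `M`. -/
def testFunctions (n : ℕ) [NeZero n] (M : Type*) [TopologicalSpace M]
    [ChartedSpace (EuclideanHalfSpace n) M] : Set (M → ℂ) :=
  {φ | ContMDiff (𝓡∂ n) 𝓘(ℝ, ℂ) ∞ φ ∧ HasCompactSupport φ ∧
    tsupport φ ⊆ (𝓡∂ n).interior M}

/-- The complex Hilbert space `L²(M, dμ_g)`. -/
abbrev L2 (g : RoughMetric n M) : Type _ := Lp ℂ 2 g.vol

/-- `(u, α)` lies in the closure, in `L²(M, dμ_g) × L²(T^*M, dμ_g)`, of the graph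
`{(φ, dφ) | φ ∈ S}` of the differential on the set `S` of smooth functions. -/
def InGraphClosure (g : RoughMetric n M) (S : Set (M → ℂ)) (u : L2 g)
    (α : CovectorField n M) : Prop :=
  α.IsMeasurable ∧ ∃ φ : ℕ → M → ℂ, (∀ k, φ k ∈ S) ∧
    Tendsto (fun k => eLpNorm (fun x => φ k x - u x) 2 g.vol) atTop (𝓝 0) ∧
    Tendsto (fun k => ∫⁻ x, ENNReal.ofReal
      (g.coInner x (differential (φ k) x - α x) (differential (φ k) x - α x)).re ∂g.vol)
      atTop (𝓝 0)

/-- The Sobolev space `H¹(M)`: the domain of the closure of `d : C^∞(M) → C^∞(M, T^*M)`. -/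
def H1 (g : RoughMetric n M) : Set (L2 g) :=
  {u | ∃ α, InGraphClosure g (smoothFunctions n M) u α}

/-- The Sobolev space `H¹₀(M)`: the closure of `C_c^∞` in `H¹(M)`. -/
def H10 (g : RoughMetric n M) : Set (L2 g) :=
  {u | ∃ α, InGraphClosure g (testFunctions n M) u α}

open Classical in
/-- The gradient `∇u` of `u ∈ H¹(M)`, that is, the value at `u` of the closure of `d`. As `d` is
closable, it is determined almost everywhere. -/
def grad (g : RoughMetric n M) (u : L2 g) : CovectorField n M :=
  if h : ∃ α, InGraphClosure g (smoothFunctions n M) u α then h.choose else 0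

/-- The Dirichlet form `𝓔[u, v] = (∇u, ∇v)_{L²}`. -/
def dirichletForm (g : RoughMetric n M) (u v : L2 g) : ℂ :=
  ∫ x, g.coInner x (grad g u x) (grad g v x) ∂g.vol

/-- `‖∇u‖_{L²} = √𝓔[u, u]`. -/
def energyNorm (g : RoughMetric n M) (u : L2 g) : ℝ :=
  √(dirichletForm g u u).re

/-- The inner product `(u, v)_{L²} + (∇u, ∇v)_{L²}` of `H¹(M)`, linear in `u`. -/
def h1Inner (g : RoughMetric n M) (u v : L2 g) : ℂ :=
  (∫ x, u x * conj (v x) ∂g.vol) + dirichletForm g u v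

/-- The standard norm of `H¹(M)`. -/
def h1Norm (g : RoughMetric n M) (u : L2 g) : ℝ :=
  √(h1Inner g u u).re

/-- A set of `H¹(M)` functions that contains all its limits in the `H¹(M)` norm. -/
def IsH1Closed (g : RoughMetric n M) (S : Set (L2 g)) : Prop :=
  ∀ (u : ℕ → L2 g) (v : L2 g), (∀ k, u k ∈ S) → v ∈ H1 g →
    Tendsto (fun k => h1Norm g (u k - v)) atTop (𝓝 0) → v ∈ S

/-- An admissible boundary condition: a closed linear subspace `W` of `H¹(M)` that contains
`H¹₀(M)`. -/
structure IsAdmissible (g : RoughMetric n M) (W : Submodule ℂ (L2 g)) : Prop where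
  le_H1 : (W : Set (L2 g)) ⊆ H1 g
  H10_le : H10 g ⊆ (W : Set (L2 g))
  closed : IsH1Closed g (W : Set (L2 g))

/-- On the linear space `V ⊆ H¹(M)`, the Dirichlet form generates a norm `√𝓔[u, u]`, and this norm
is equivalent to the standard norm of `H¹(M)`. -/
structure GeneratesH1Norm (g : RoughMetric n M) (V : Submodule ℂ (L2 g)) : Prop where
  form_nonneg : ∀ u ∈ V, 0 ≤ (dirichletForm g u u).re ∧ (dirichletForm g u u).im = 0
  add_le : ∀ u ∈ V, ∀ v ∈ V, energyNorm g (u + v) ≤ energyNorm g u + energyNorm g v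
  smul_eq : ∀ (c : ℂ), ∀ u ∈ V, energyNorm g (c • u) = ‖c‖ * energyNorm g u
  eq_zero : ∀ u ∈ V, energyNorm g u = 0 → u = 0
  equivalent : ∃ a b : ℝ, 0 < a ∧ 0 < b ∧
    ∀ u ∈ V, a * h1Norm g u ≤ energyNorm g u ∧ energyNorm g u ≤ b * h1Norm g u

open Classical in
/-- The set `Z(ρ)` for the boundary condition `W`. -/
def Z (g : RoughMetric n M) (W : Submodule ℂ (L2 g)) (ρ : M → ℝ) : Set (L2 g) :=
  if GeneratesH1Norm g W then (W : Set (L2 g))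
  else {u | u ∈ W ∧ ∫ x, (ρ x : ℂ) * u x ∂g.vol = 0}

/-- The orthogonal complement of `S` in `W` with respect to the inner product of `H¹(M)`. -/
def orthIn (g : RoughMetric n M) (W : Submodule ℂ (L2 g)) (S : Set (L2 g)) : Set (L2 g) :=
  {w | w ∈ W ∧ ∀ z ∈ S, h1Inner g w z = 0}

end Sobolev

end RoughRiemannian

end

noncomputable section

set_option linter.unusedSectionVars false

namespace RoughRiemannian

/-! ### A Poincaré-Sobolev inequality on convex sets of a finite-dimensional space. -/

section Euclidean

variable {E : Type*} [NormedAddCommGroup E] [NormedSpace ℝ E] [FiniteDimensional ℝ E]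
  [MeasurableSpace E] [BorelSpace E] (μ : Measure E) [μ.IsAddHaarMeasure]

/-! Everything rests on a Sobolev-type Poincaré inequality in dual form (`RoughMetric.HasPoincare`):
each smooth `φ` has a constant `m`, chosen before the weight, such that `∫ ρ |φ - m| ≤ C ‖ρ‖_b
‖dφ‖₂` for all weights `ρ ≥ 0`. Here `1 < b ≤ 2` and `n (1/b - 1/2) < 1`, which says that the
conjugate exponent of `b` is subcritical for the Sobolev embedding. Since `β > n/2` and `n ≥ 2`,
such a `b` can be taken to be `2` or `β` (`exists_subcritical_exponent`). Keeping the weight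
arbitrary lets one inequality serve twice: the weight `|φ - m|` gives the `L²` Poincaré inequality,
and the weight `|ρ|` controls the weighted mean.

On a bounded convex open set the inequality comes from integrating the derivative along segments and
applying a three-factor Hölder inequality on `Q × Q` (`lintegral_segment_holder`). The manifold is
covered by cells, coordinate neighbourhoods that look like a ball cut by the open half-space. There
a rough metric is almost everywhere comparable to the Euclidean one, so the inequality transfers
although `g` is only measurable (`hasPoincare_cell`). Two overlapping open sets with the property
have a union with it (`HasPoincare.union`), and connectedness and compactness then give it on `M`
(`hasPoincare_univ`).

The map sending `u` to its deviation from the weighted mean kills constants because `∫ ρ ≠ 0`. Hence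
`φ` may be replaced by `φ - m`, and both terms of the deviation are bounded by `‖dφ‖₂`
(`exists_deviation_smooth_le`). The passage to `H¹` uses Fatou's lemma for the integrability of `ρ
u` and the resulting `H¹` bound on `u ↦ ∫ ρ u`. As the gradient in `H¹` is a chosen limit, its
linearity needs closability of `d`, proved by integration by parts in cells
(`RoughMetric.GraphLimit.unique`).

The rest is linear algebra. Unless the energy norm is already good on `W`, `Z(ρ)` is the kernel of
an `H¹`-bounded functional, hence closed and of codimension at most one. On it the weighted mean
vanishes, so Poincaré reads `‖u‖ ≤ C ‖∇u‖`. The orthogonal complement injects into `W / Z(ρ)`. -/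

theorem lintegral_comp_add_smul {G : E → ℝ≥0∞} (hG : Measurable G) {r : ℝ} (hr : r ≠ 0) (c : E) :
    ∫⁻ y, G (c + r • y) ∂μ
      = ENNReal.ofReal |(r ^ Module.finrank ℝ E)⁻¹| * ∫⁻ y, G y ∂μ := by
  have h1 : ∫⁻ y, G (c + r • y) ∂μ = ∫⁻ z, G (c + z) ∂(μ.map (fun y => r • y)) := by
    rw [lintegral_map (by fun_prop) (by fun_prop)]
  rw [h1, Measure.map_addHaar_smul μ hr, lintegral_smul_measure, lintegral_add_left_eq_self,
    smul_eq_mul]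

/-- Write `ρ F` as `(ρ^b F²)^d (ρ^b)^(1/2) (F²)^(1 - 1/b)` with `d = 1/b - 1/2`; the three exponents
sum to `1`, so Hölder applies on `Q × Q`. Substituting along the segment in the first factor costs
`t^(-n)`, raised to the power `d`. This is the only singularity in `t`, and it is integrable on `(0,
1)` when `n d < 1`. -/
theorem lintegral_segment_holder (Q : Set E) {b : ℝ} (hb1 : 1 < b)
    (hb2 : b ≤ 2) {ρ F : E → ℝ≥0∞} (hρ : Measurable ρ) (hF : Measurable F) {t : ℝ}
    (ht : t ∈ Set.Ioo (0 : ℝ) 1) :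
    ∫⁻ x in Q, ∫⁻ y in Q, ρ x * F ((1 - t) • x + t • y) ∂μ ∂μ ≤
      ENNReal.ofReal (t ^ (-(Module.finrank ℝ E * (1 / b - 1 / 2)))) *
        ((μ Q) ^ (1 / 2 : ℝ) *
          (ENNReal.ofReal (2 ^ Module.finrank ℝ E) * μ Q) ^ (1 - 1 / b)) *
        ((∫⁻ x in Q, ρ x ^ b ∂μ) ^ (1 / b) * (∫⁻ x, F x ^ (2 : ℝ) ∂μ) ^ (1 / 2 : ℝ)) := by
  obtain ⟨ht0, ht1⟩ := ht
  have hb0 : 0 < b := by linarith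
  set d : ℝ := 1 / b - 1 / 2 with hd
  have hd0 : 0 ≤ d := by
    have : (1 : ℝ) / 2 ≤ 1 / b := one_div_le_one_div_of_le hb0 hb2
    linarith
  have he0 : 0 ≤ 1 - 1 / b := by
    have : 1 / b ≤ 1 := by rw [div_le_one hb0]; exact hb1.le
    linarith
  have h1t : 0 < 1 - t := by linarith
  set n := Module.finrank ℝ E with hn
  set ν := μ.restrict Q with hν
  set A := ∫⁻ x in Q, ρ x ^ b ∂μ with hA
  set B := ∫⁻ x, F x ^ (2 : ℝ) ∂μ with hB
  have hFm : Measurable fun p : E × E => F ((1 - t) • p.1 + t • p.2) := hF.comp (by fun_prop)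
  have hρm : Measurable fun p : E × E => ρ p.1 := hρ.comp measurable_fst
  let f : Fin 3 → E × E → ℝ≥0∞ := ![fun p => ρ p.1 ^ b * F ((1 - t) • p.1 + t • p.2) ^ (2 : ℝ),
    fun p => ρ p.1 ^ b, fun p => F ((1 - t) • p.1 + t • p.2) ^ (2 : ℝ)]
  let p : Fin 3 → ℝ := ![d, 1 / 2, 1 - 1 / b]
  have key := ENNReal.lintegral_prod_norm_pow_le (μ := ν.prod ν) Finset.univ (f := f) (p := p)
    (by
      intro i _
      fin_cases i
      · exact ((hρm.pow_const b).mul (hFm.pow_const 2)).aemeasurable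
      · exact (hρm.pow_const b).aemeasurable
      · exact (hFm.pow_const 2).aemeasurable)
    (by simp [p, Fin.sum_univ_three, hd])
    (by intro i _; fin_cases i <;> simp [p]; exacts [hd0, by simpa using he0])
  simp only [Fin.prod_univ_three] at key
  simp only [f, p, Matrix.cons_val_zero, Matrix.cons_val_one, Matrix.cons_val_two,
    Matrix.head_cons, Matrix.tail_cons] at key
  have hpt : ∀ r s : ℝ≥0∞, (r ^ b * s ^ (2 : ℝ)) ^ d * (r ^ b) ^ (1 / 2 : ℝ) *
      (s ^ (2 : ℝ)) ^ (1 - 1 / b) = r * s := by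
    intro r s
    rw [ENNReal.mul_rpow_of_nonneg _ _ hd0]
    simp only [← ENNReal.rpow_mul]
    have e1 : r ^ (b * d) * s ^ (2 * d) * r ^ (b * (1 / 2)) * s ^ (2 * (1 - 1 / b))
        = (r ^ (b * d) * r ^ (b * (1 / 2))) * (s ^ (2 * d) * s ^ (2 * (1 - 1 / b))) := by ring
    rw [e1, ← ENNReal.rpow_add_of_nonneg _ _ (by positivity) (by positivity),
      ← ENNReal.rpow_add_of_nonneg _ _ (by positivity) (by positivity)]
    have e2 : b * d + b * (1 / 2) = 1 := by rw [hd]; field_simp; ring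
    have e3 : 2 * d + 2 * (1 - 1 / b) = 1 := by rw [hd]; ring
    rw [e2, e3, ENNReal.rpow_one, ENNReal.rpow_one]
  simp only [hpt] at key
  rw [lintegral_prod (fun p : E × E => ρ p.1 * F ((1 - t) • p.1 + t • p.2))
    ((hρm.mul hFm).aemeasurable)] at key
  refine key.trans ?_
  -- the inner integrals
  have hy : ∀ x, ∫⁻ y, F ((1 - t) • x + t • y) ^ (2 : ℝ) ∂ν
      ≤ ENNReal.ofReal (t ^ (-(n : ℝ))) * B := by
    intro x
    calc _ ≤ ∫⁻ y, F ((1 - t) • x + t • y) ^ (2 : ℝ) ∂μ := lintegral_mono' Measure.restrict_le_self le_rfl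
      _ = _ := by
        rw [lintegral_comp_add_smul μ (hF.pow_const 2) ht0.ne', Real.rpow_neg ht0.le,
          Real.rpow_natCast, abs_of_pos (by positivity)]
  have hx : ∀ y, ∫⁻ x, F ((1 - t) • x + t • y) ^ (2 : ℝ) ∂ν
      ≤ ENNReal.ofReal ((1 - t) ^ (-(n : ℝ))) * B := by
    intro y
    calc _ ≤ ∫⁻ x, F ((1 - t) • x + t • y) ^ (2 : ℝ) ∂μ := lintegral_mono' Measure.restrict_le_self le_rfl
      _ = _ := by
        simp_rw [add_comm ((1 - t) • _)]
        rw [lintegral_comp_add_smul μ (hF.pow_const 2) h1t.ne', Real.rpow_neg h1t.le,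
          Real.rpow_natCast, abs_of_pos (by positivity)]
  have i0 : ∫⁻ p : E × E, ρ p.1 ^ b * F ((1 - t) • p.1 + t • p.2) ^ (2 : ℝ) ∂(ν.prod ν)
      ≤ ENNReal.ofReal (t ^ (-(n : ℝ))) * (A * B) := by
    rw [lintegral_prod (fun p : E × E => ρ p.1 ^ b * F ((1 - t) • p.1 + t • p.2) ^ (2 : ℝ))
      (((hρm.pow_const b).mul (hFm.pow_const 2)).aemeasurable)]
    calc _ ≤ ∫⁻ x, ρ x ^ b * (ENNReal.ofReal (t ^ (-(n : ℝ))) * B) ∂ν := by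
          refine lintegral_mono fun x => ?_
          dsimp only
          rw [lintegral_const_mul (f := fun y => F ((1 - t) • x + t • y) ^ (2 : ℝ)) _
            ((hF.comp (by fun_prop)).pow_const 2)]
          gcongr
          exact hy x
      _ = A * (ENNReal.ofReal (t ^ (-(n : ℝ))) * B) := by
          rw [lintegral_mul_const _ (hρ.pow_const b)]
      _ = _ := by ring
  have i1 : ∫⁻ p : E × E, ρ p.1 ^ b ∂(ν.prod ν) = μ Q * A := by
    rw [lintegral_prod _ (hρm.pow_const b).aemeasurable]
    simp only [lintegral_const]
    rw [lintegral_mul_const _ (hρ.pow_const b)]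
    simp [hν, hA, mul_comm]
  have half : ∀ s : ℝ, 1 / 2 ≤ s → ENNReal.ofReal (s ^ (-(n : ℝ))) ≤ ENNReal.ofReal (2 ^ n) := by
    intro s hs
    apply ENNReal.ofReal_le_ofReal
    rw [Real.rpow_neg (by linarith), Real.rpow_natCast, ← inv_pow]
    gcongr
    rw [inv_le_comm₀ (by linarith) (by norm_num)]
    linarith
  -- The variable substituted is the one whose coefficient, `t` or `1 - t`, is at least `1/2`, so
  -- the Jacobian is at most `2^n` uniformly in `t`. In `i0` there is no such choice, since the
  -- factor `ρ x ^ b` forces the substitution in `y`.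
  have i2 : ∫⁻ p : E × E, F ((1 - t) • p.1 + t • p.2) ^ (2 : ℝ) ∂(ν.prod ν)
      ≤ (ENNReal.ofReal (2 ^ n) * μ Q) * B := by
    rcases le_total (1 / 2) t with h | h
    · rw [lintegral_prod _ (hFm.pow_const 2).aemeasurable]
      calc _ ≤ ∫⁻ _, ENNReal.ofReal (2 ^ n) * B ∂ν := by
            refine lintegral_mono fun x => (hy x).trans ?_
            gcongr ?_ * _
            exact half t h
        _ = _ := by simp [hν]; ring
    · rw [lintegral_prod_symm _ (hFm.pow_const 2).aemeasurable]
      calc _ ≤ ∫⁻ _, ENNReal.ofReal (2 ^ n) * B ∂ν := by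
            refine lintegral_mono fun x => (hx x).trans ?_
            gcongr ?_ * _
            have h' : 1 / 2 ≤ 1 - t := by linarith
            exact half (1 - t) h'
        _ = _ := by simp [hν]; ring
  calc _ ≤ (ENNReal.ofReal (t ^ (-(n : ℝ))) * (A * B)) ^ d * (μ Q * A) ^ (1 / 2 : ℝ) *
        ((ENNReal.ofReal (2 ^ n) * μ Q) * B) ^ (1 - 1 / b) := by
        rw [i1]; gcongr
    _ = _ := by
        rw [ENNReal.mul_rpow_of_nonneg _ _ hd0, ENNReal.mul_rpow_of_nonneg _ _ hd0,
          ENNReal.mul_rpow_of_nonneg (μ Q) _ (by norm_num),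
          ENNReal.mul_rpow_of_nonneg _ B he0,
          ENNReal.ofReal_rpow_of_nonneg (by positivity) hd0, ← Real.rpow_mul ht0.le]
        have eA : A ^ (1 / b) = A ^ d * A ^ (1 / 2 : ℝ) := by
          rw [← ENNReal.rpow_add_of_nonneg _ _ hd0 (by norm_num)]; congr 1; rw [hd]; ring
        have eB : B ^ (1 / 2 : ℝ) = B ^ d * B ^ (1 - 1 / b) := by
          rw [← ENNReal.rpow_add_of_nonneg _ _ hd0 he0]; congr 1; rw [hd]; ring
        rw [eA, eB, neg_mul]
        ring

omit [FiniteDimensional ℝ E] [MeasurableSpace E] [BorelSpace E] in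
-- The fundamental theorem of calculus along the segment, which stays in `Q` by convexity. The
-- indicator changes nothing on the segment; it makes the integrand a function on all of `E`, so
-- that later substitutions may enlarge the domain of integration.
theorem enorm_sub_le_lintegral_segment {Q : Set E} (hQo : IsOpen Q) (hQc : Convex ℝ Q)
    {f : E → ℂ} (hf : ContDiffOn ℝ 1 f Q) {x y : E} (hx : x ∈ Q) (hy : y ∈ Q) :
    ‖f x - f y‖ₑ ≤ ∫⁻ t in Set.Ioo (0 : ℝ) 1,
      Q.indicator (fun z => ‖fderiv ℝ f z‖ₑ) ((1 - t) • x + t • y) * ‖y - x‖ₑ := by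
  have hmem : ∀ t ∈ Set.Icc (0 : ℝ) 1, (1 - t) • x + t • y ∈ Q := fun t ht =>
    hQc hx hy (by linarith [ht.2]) ht.1 (by ring)
  have hder : ∀ t ∈ Set.uIcc (0 : ℝ) 1, HasDerivAt (fun t : ℝ => f ((1 - t) • x + t • y))
      (fderiv ℝ f ((1 - t) • x + t • y) (y - x)) t := by
    intro t ht
    rw [Set.uIcc_of_le zero_le_one] at ht
    have h1 : HasFDerivAt f (fderiv ℝ f ((1 - t) • x + t • y)) ((1 - t) • x + t • y) :=
      ((hf.differentiableOn one_ne_zero).differentiableAt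
        (hQo.mem_nhds (hmem t ht))).hasFDerivAt
    have h2 : HasDerivAt (fun t : ℝ => (1 - t) • x + t • y) (y - x) t := by
      have := (((hasDerivAt_id t).const_sub 1).smul_const x).add ((hasDerivAt_id t).smul_const y)
      have e : (-1 : ℝ) • x + (1 : ℝ) • y = y - x := by
        rw [neg_one_smul, one_smul, neg_add_eq_sub]
      rw [e] at this
      exact this
    exact h1.comp_hasDerivAt t h2
  have hcont : ContinuousOn (fun t : ℝ => fderiv ℝ f ((1 - t) • x + t • y) (y - x))
      (Set.Icc 0 1) := by
    have h1 : ContinuousOn (fderiv ℝ f) Q := hf.continuousOn_fderiv_of_isOpen hQo le_rfl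
    have h2 : ContinuousOn (fun t : ℝ => (1 - t) • x + t • y) (Set.Icc 0 1) := by fun_prop
    exact (h1.comp h2 hmem).clm_apply continuousOn_const
  have hint : IntervalIntegrable (fun t : ℝ => fderiv ℝ f ((1 - t) • x + t • y) (y - x))
      volume 0 1 := by
    apply ContinuousOn.intervalIntegrable
    rwa [Set.uIcc_of_le zero_le_one]
  have ftc := intervalIntegral.integral_eq_sub_of_hasDerivAt hder hint
  have e : ‖f x - f y‖ₑ = ‖f y - f x‖ₑ := by
    rw [← enorm_neg, neg_sub]
  have ftc' : f y - f x = ∫ t in Set.Ioo (0:ℝ) 1, fderiv ℝ f ((1 - t) • x + t • y) (y - x) := by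
    rw [← integral_Ioc_eq_integral_Ioo, ← intervalIntegral.integral_of_le zero_le_one, ftc]
    simp
  rw [e, ftc']
  refine (enorm_integral_le_lintegral_enorm _).trans ?_
  refine setLIntegral_mono' measurableSet_Ioo fun t ht => ?_
  rw [Set.indicator_of_mem (hmem t (Set.Ioo_subset_Icc_self ht))]
  exact ContinuousLinearMap.le_opENorm _ _

/-- A Poincaré-Sobolev inequality on a bounded convex open set, in weak form. -/
theorem exists_lintegral_sub_le_of_convex {Q : Set E} (hQo : IsOpen Q) (hQc : Convex ℝ Q)
    (hQb : Bornology.IsBounded Q) {b : ℝ} (hb1 : 1 < b) (hb2 : b ≤ 2)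
    (hb : Module.finrank ℝ E * (1 / b - 1 / 2) < 1) :
    ∃ C : ℝ≥0∞, C ≠ ⊤ ∧ ∀ f : E → ℂ, ContDiffOn ℝ 1 f Q → ∀ ρ : E → ℝ≥0∞, Measurable ρ →
      ∫⁻ x in Q, ∫⁻ y in Q, ρ x * ‖f x - f y‖ₑ ∂μ ∂μ ≤
        C * ((∫⁻ x in Q, ρ x ^ b ∂μ) ^ (1 / b) *
          (∫⁻ x in Q, ‖fderiv ℝ f x‖ₑ ^ (2 : ℝ) ∂μ) ^ (1 / 2 : ℝ)) := by
  have hb0 : 0 < b := by linarith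
  have he0 : 0 ≤ 1 - 1 / b := by
    have : 1 / b ≤ 1 := by rw [div_le_one hb0]; exact hb1.le
    linarith
  have hμQ : μ Q ≠ ⊤ := hQb.measure_lt_top.ne
  set D : ℝ≥0∞ := Metric.ediam Q with hD
  have hDt : D ≠ ⊤ := hQb.ediam_ne_top
  set r : ℝ := -(Module.finrank ℝ E * (1 / b - 1 / 2)) with hr
  -- This integral collects the singularity in `t`; its finiteness is `r > -1`, the one place where
  -- subcriticality of `b` enters.
  set T : ℝ≥0∞ := ∫⁻ t in Set.Ioo (0 : ℝ) 1, ENNReal.ofReal (t ^ r) with hT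
  have hTt : T ≠ ⊤ := by
    have h1 : IntegrableOn (fun t : ℝ => t ^ r) (Set.Ioo 0 1) volume :=
      ((intervalIntegrable_iff_integrableOn_Ioo_of_le zero_le_one).1
        (intervalIntegral.intervalIntegrable_rpow' (by rw [hr]; linarith)))
    exact h1.lintegral_lt_top.ne
  set K : ℝ≥0∞ := (μ Q) ^ (1 / 2 : ℝ) *
    (ENNReal.ofReal (2 ^ Module.finrank ℝ E) * μ Q) ^ (1 - 1 / b) with hK
  have hKt : K ≠ ⊤ := ENNReal.mul_ne_top (ENNReal.rpow_ne_top_of_nonneg (by norm_num) hμQ)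
    (ENNReal.rpow_ne_top_of_nonneg he0 (ENNReal.mul_ne_top ENNReal.ofReal_ne_top hμQ))
  refine ⟨D * T * K, ENNReal.mul_ne_top (ENNReal.mul_ne_top hDt hTt) hKt, ?_⟩
  intro f hf ρ hρ
  set F : E → ℝ≥0∞ := Q.indicator (fun z => ‖fderiv ℝ f z‖ₑ) with hF
  have hFm : Measurable F := (measurable_fderiv ℝ f).enorm.indicator hQo.measurableSet
  have hFint : ∫⁻ x, F x ^ (2 : ℝ) ∂μ = ∫⁻ x in Q, ‖fderiv ℝ f x‖ₑ ^ (2 : ℝ) ∂μ := by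
    rw [← lintegral_indicator hQo.measurableSet]
    congr 1 with x
    by_cases hx : x ∈ Q <;> simp [hF, hx]
  rw [← hFint]
  have hg : Measurable fun p : (E × E) × ℝ =>
      ρ p.1.1 * F ((1 - p.2) • p.1.1 + p.2 • p.1.2) :=
    (hρ.comp (by fun_prop)).mul (hFm.comp (by fun_prop))
  calc ∫⁻ x in Q, ∫⁻ y in Q, ρ x * ‖f x - f y‖ₑ ∂μ ∂μ
      ≤ ∫⁻ x in Q, ∫⁻ y in Q, ∫⁻ t in Set.Ioo (0 : ℝ) 1,
          D * (ρ x * F ((1 - t) • x + t • y)) ∂volume ∂μ ∂μ := by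
        refine setLIntegral_mono' hQo.measurableSet fun x hx =>
          setLIntegral_mono' hQo.measurableSet fun y hy => ?_
        rw [lintegral_const_mul' _ _ hDt,
          lintegral_const_mul (f := fun t : ℝ => F ((1 - t) • x + t • y)) _
            (hFm.comp (by fun_prop))]
        have h1 := enorm_sub_le_lintegral_segment hQo hQc hf hx hy
        rw [lintegral_mul_const (f := fun t : ℝ => F ((1 - t) • x + t • y)) _
          (hFm.comp (by fun_prop))] at h1
        have h2 : ‖y - x‖ₑ ≤ D := by
          rw [← edist_eq_enorm_sub]; exact Metric.edist_le_ediam_of_mem hy hx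
        calc _ ≤ ρ x * ((∫⁻ t in Set.Ioo (0 : ℝ) 1, F ((1 - t) • x + t • y)) * D) := by
              gcongr; exact h1.trans (by gcongr)
          _ = _ := by ring
    _ = D * ∫⁻ x in Q, ∫⁻ y in Q, ∫⁻ t in Set.Ioo (0 : ℝ) 1,
          ρ x * F ((1 - t) • x + t • y) ∂volume ∂μ ∂μ := by
        simp_rw [lintegral_const_mul' _ _ hDt]
    -- Tonelli twice moves `t` outermost, so that the Hölder estimate can be applied for each fixed
    -- `t`.
    _ = D * ∫⁻ t in Set.Ioo (0 : ℝ) 1, ∫⁻ x in Q, ∫⁻ y in Q,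
          ρ x * F ((1 - t) • x + t • y) ∂μ ∂μ := by
        congr 1
        trans ∫⁻ x in Q, ∫⁻ t in Set.Ioo (0 : ℝ) 1, ∫⁻ y in Q,
          ρ x * F ((1 - t) • x + t • y) ∂μ ∂volume ∂μ
        · refine lintegral_congr fun x => lintegral_lintegral_swap ?_
          exact (hg.comp (g := fun p : (E × E) × ℝ =>
            ρ p.1.1 * F ((1 - p.2) • p.1.1 + p.2 • p.1.2))
            (f := fun q : E × ℝ => ((x, q.1), q.2)) (by fun_prop)).aemeasurable
        · refine lintegral_lintegral_swap ?_
          exact (Measurable.lintegral_prod_right'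
            (f := fun q : (E × ℝ) × E => ρ q.1.1 * F ((1 - q.1.2) • q.1.1 + q.1.2 • q.2))
            (hg.comp (f := fun q : (E × ℝ) × E => ((q.1.1, q.2), q.1.2))
              (by fun_prop))).aemeasurable
    _ ≤ D * ∫⁻ t in Set.Ioo (0 : ℝ) 1, ENNReal.ofReal (t ^ r) * (K *
          ((∫⁻ x in Q, ρ x ^ b ∂μ) ^ (1 / b) * (∫⁻ x, F x ^ (2 : ℝ) ∂μ) ^ (1 / 2 : ℝ))) := by
        gcongr D * ?_
        refine setLIntegral_mono' measurableSet_Ioo fun t ht => ?_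
        rw [← mul_assoc]
        exact lintegral_segment_holder μ Q hb1 hb2 hρ hFm ht
    _ = _ := by
        rw [lintegral_mul_const _ (by fun_prop)]
        ring

end Euclidean

/-! ### Hermitian forms with real coefficients, and bounds for inverses and determinants. -/

section Matrices

variable {n : ℕ}

open Matrix

/-- The sesquilinear form with a given real coefficient matrix. -/
def herm (S : Matrix (Fin n) (Fin n) ℝ) (a b : Fin n → ℂ) : ℂ :=
  ∑ i, ∑ j, ((S i j : ℝ) : ℂ) * (a i * conj (b j))

theorem herm_add_left (S : Matrix (Fin n) (Fin n) ℝ) (a b c : Fin n → ℂ) :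
    herm S (a + b) c = herm S a c + herm S b c := by
  simp only [herm, Pi.add_apply, ← Finset.sum_add_distrib]
  exact Finset.sum_congr rfl fun i _ => Finset.sum_congr rfl fun j _ => by ring

theorem herm_smul_left (S : Matrix (Fin n) (Fin n) ℝ) (r : ℂ) (a c : Fin n → ℂ) :
    herm S (r • a) c = r * herm S a c := by
  simp only [herm, Pi.smul_apply, smul_eq_mul, Finset.mul_sum]
  exact Finset.sum_congr rfl fun i _ => Finset.sum_congr rfl fun j _ => by ring

theorem herm_conj {S : Matrix (Fin n) (Fin n) ℝ} (hS : S.IsSymm) (a b : Fin n → ℂ) :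
    conj (herm S a b) = herm S b a := by
  simp only [herm, map_sum, map_mul, Complex.conj_ofReal, Complex.conj_conj]
  rw [Finset.sum_comm]
  refine Finset.sum_congr rfl fun i _ => Finset.sum_congr rfl fun j _ => ?_
  rw [hS.apply]; ring

theorem herm_add_right {S : Matrix (Fin n) (Fin n) ℝ} (hS : S.IsSymm) (a b c : Fin n → ℂ) :
    herm S a (b + c) = herm S a b + herm S a c := by
  rw [← herm_conj hS, herm_add_left, map_add, herm_conj hS, herm_conj hS]

theorem herm_smul_right {S : Matrix (Fin n) (Fin n) ℝ} (hS : S.IsSymm) (r : ℂ)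
    (a b : Fin n → ℂ) : herm S a (r • b) = conj r * herm S a b := by
  rw [← herm_conj hS, herm_smul_left, map_mul, herm_conj hS]

theorem herm_self_re (S : Matrix (Fin n) (Fin n) ℝ) (a : Fin n → ℂ) :
    (herm S a a).re = (fun i => (a i).re) ⬝ᵥ S *ᵥ (fun i => (a i).re) +
      (fun i => (a i).im) ⬝ᵥ S *ᵥ (fun i => (a i).im) := by
  simp only [herm, dotProduct, mulVec, Complex.re_sum, Finset.mul_sum, ← Finset.sum_add_distrib]
  refine Finset.sum_congr rfl fun i _ => Finset.sum_congr rfl fun j _ => ?_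
  simp
  ring

theorem herm_self_nonneg {S : Matrix (Fin n) (Fin n) ℝ} (hS : S.PosSemidef) (a : Fin n → ℂ) :
    0 ≤ (herm S a a).re := by
  rw [herm_self_re]
  have h := fun v : Fin n → ℝ => hS.dotProduct_mulVec_nonneg v
  simp only [star_trivial] at h
  exact add_nonneg (h _) (h _)

theorem isSymm_of_posSemidef {S : Matrix (Fin n) (Fin n) ℝ} (hS : S.PosSemidef) : S.IsSymm := by
  have h := hS.1
  rwa [IsHermitian, conjTranspose_eq_transpose_of_trivial] at h

/-- A crude Cauchy-Schwarz inequality: expanding the form at `r • a - b` for `r ∈ {1, -1, I, -I}`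
bounds twice the real and twice the imaginary part. It suffices for integrability of products of
gradients. -/
theorem norm_herm_le {S : Matrix (Fin n) (Fin n) ℝ} (hS : S.PosSemidef) (a b : Fin n → ℂ) :
    ‖herm S a b‖ ≤ (herm S a a).re + (herm S b b).re := by
  have hs := isSymm_of_posSemidef hS
  have key : ∀ r : ℂ, ‖r‖ = 1 →
      2 * (r * herm S a b).re ≤ (herm S a a).re + (herm S b b).re := by
    intro r hr
    have h := herm_self_nonneg hS (r • a + (-1 : ℂ) • b)
    rw [herm_add_left, herm_add_right hs, herm_add_right hs, herm_smul_left, herm_smul_left,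
      herm_smul_left, herm_smul_left,
      herm_smul_right hs, herm_smul_right hs, herm_smul_right hs, herm_smul_right hs] at h
    have e1 : r * (conj r * herm S a a) = herm S a a := by
      rw [← mul_assoc, Complex.mul_conj, Complex.normSq_eq_norm_sq, hr]; simp
    have e2 : herm S b a = conj (herm S a b) := (herm_conj hs a b).symm
    rw [e1, e2] at h
    have e3 : (conj r * conj (herm S a b)).re = (r * herm S a b).re := by
      rw [← map_mul, Complex.conj_re]
    simp only [map_neg, map_one, neg_mul, mul_neg, one_mul, neg_neg, Complex.add_re,
      Complex.neg_re] at h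
    rw [e3] at h
    linarith
  have h1 : 2 * |(herm S a b).re| ≤ (herm S a a).re + (herm S b b).re := by
    rcases abs_cases (herm S a b).re with h | h
    · have := key 1 (by simp); rw [one_mul] at this; rw [h.1]; exact this
    · have := key (-1) (by simp); rw [neg_one_mul, Complex.neg_re] at this; rw [h.1]; exact this
  have h2 : 2 * |(herm S a b).im| ≤ (herm S a a).re + (herm S b b).re := by
    rcases abs_cases (herm S a b).im with h | h
    · have := key (-Complex.I) (by simp)
      rw [h.1]; simpa using this
    · have := key Complex.I (by simp)
      rw [h.1]; simpa using this
  linarith [Complex.norm_le_abs_re_add_abs_im (herm S a b)]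

theorem herm_add_self_le {S : Matrix (Fin n) (Fin n) ℝ} (hS : S.PosSemidef) (a b : Fin n → ℂ) :
    (herm S (a + b) (a + b)).re ≤ 2 * (herm S a a).re + 2 * (herm S b b).re := by
  have hs := isSymm_of_posSemidef hS
  have h := herm_self_nonneg hS (a + (-1 : ℂ) • b)
  rw [herm_add_left, herm_add_right hs, herm_add_right hs, herm_smul_left, herm_smul_left,
      herm_smul_right hs, herm_smul_right hs] at h
  rw [herm_add_left, herm_add_right hs, herm_add_right hs]
  simp only [map_neg, map_one, neg_mul, mul_neg, one_mul, neg_neg, Complex.add_re,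
      Complex.neg_re] at h ⊢
  linarith

/-- Under the frame change `D`, Gram matrices become `Dᵀ G D` and covector components are multiplied
by `Dᵀ`; the inverse Gram matrix absorbs both factors. This allows `coInner`, written in the
standard frame, to be computed in any chart. -/
theorem herm_frame_change (G D : Matrix (Fin n) (Fin n) ℝ) (hD : IsUnit D.det)
    (a b : Fin n → ℂ) :
    herm (Dᵀ * G * D)⁻¹ (fun i => ∑ k, (D k i : ℂ) * a k) (fun i => ∑ k, (D k i : ℂ) * b k)
      = herm G⁻¹ a b := by
  have h1 : ∀ (S : Matrix (Fin n) (Fin n) ℝ) (a b : Fin n → ℂ),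
      herm S a b = a ⬝ᵥ (S.map Complex.ofReal) *ᵥ (fun j => conj (b j)) := by
    intro S a b
    simp only [herm, dotProduct, mulVec, Finset.mul_sum, map_apply]
    exact Finset.sum_congr rfl fun i _ => Finset.sum_congr rfl fun j _ => by ring
  have h2 : ∀ a : Fin n → ℂ, (fun i => ∑ k, (D k i : ℂ) * a k)
      = (D.map Complex.ofReal)ᵀ *ᵥ a := by
    intro a; ext i; simp [mulVec, dotProduct]
  have h3 : (fun j => conj (∑ k, (D k j : ℂ) * b k))
      = (D.map Complex.ofReal)ᵀ *ᵥ (fun j => conj (b j)) := by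
    ext i; simp [mulVec, dotProduct]
  rw [h1, h1, h3, h2, mulVec_transpose, ← dotProduct_mulVec, mulVec_mulVec, mulVec_mulVec]
  congr 2
  have h4 : D * (Dᵀ * G * D)⁻¹ * Dᵀ = G⁻¹ := by
    rw [Matrix.mul_inv_rev, Matrix.mul_inv_rev, ← mul_assoc, mul_nonsing_inv _ hD, one_mul, mul_assoc,
      nonsing_inv_mul _ (by rwa [det_transpose]), mul_one]
  rw [← h4]
  ext i j
  simp [mul_apply, Finset.sum_mul]

theorem posDef_of_le {G : Matrix (Fin n) (Fin n) ℝ} (hG : G.IsSymm) {c : ℝ} (hc : 0 < c)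
    (h : ∀ v, c⁻¹ * (v ⬝ᵥ v) ≤ v ⬝ᵥ G *ᵥ v) : G.PosDef := by
  refine PosDef.of_dotProduct_mulVec_pos ?_ fun v hv => ?_
  · rwa [IsHermitian, conjTranspose_eq_transpose_of_trivial]
  · rw [star_trivial]
    refine lt_of_lt_of_le (mul_pos (inv_pos.2 hc) ?_) (h v)
    have := dotProduct_star_self_pos_iff (v := v)
    rw [star_trivial] at this
    exact this.2 hv

/-- With `v = G⁻¹ w`, the lower bound is positivity of `G` at `v - c⁻¹ w`, and the upper bound is
positivity of `|c w - v|²`; no diagonalization is needed. -/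
theorem dotProduct_inv_mulVec_bounds {G : Matrix (Fin n) (Fin n) ℝ} (hG : G.IsSymm) {c : ℝ}
    (hc : 0 < c) (h : ∀ v, c⁻¹ * (v ⬝ᵥ v) ≤ v ⬝ᵥ G *ᵥ v ∧ v ⬝ᵥ G *ᵥ v ≤ c * (v ⬝ᵥ v))
    (w : Fin n → ℝ) :
    c⁻¹ * (w ⬝ᵥ w) ≤ w ⬝ᵥ G⁻¹ *ᵥ w ∧ w ⬝ᵥ G⁻¹ *ᵥ w ≤ c * (w ⬝ᵥ w) := by
  have hdet : IsUnit G.det := (posDef_of_le hG hc fun v => (h v).1).det_pos.ne'.isUnit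
  set v := G⁻¹ *ᵥ w with hv
  have hGv : G *ᵥ v = w := by rw [hv, mulVec_mulVec, mul_nonsing_inv _ hdet, one_mulVec]
  have hq : v ⬝ᵥ G *ᵥ v = w ⬝ᵥ v := by rw [hGv, dotProduct_comm]
  have sq : ∀ u : Fin n → ℝ, 0 ≤ u ⬝ᵥ u := fun u => by
    have := dotProduct_star_self_nonneg u
    rwa [star_trivial] at this
  constructor
  · have hwv : w ⬝ᵥ G *ᵥ v = w ⬝ᵥ w := by rw [hGv]
    have hvw : v ⬝ᵥ G *ᵥ w = w ⬝ᵥ w := by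
      rw [dotProduct_mulVec, ← mulVec_transpose, hG.eq, hGv]
    have h1 := (h (v - c⁻¹ • w)).1
    have h2 : 0 ≤ (v - c⁻¹ • w) ⬝ᵥ G *ᵥ (v - c⁻¹ • w) :=
      le_trans (mul_nonneg (inv_nonneg.2 hc.le) (sq _)) h1
    have h3 := (h w).2
    simp only [mulVec_sub, mulVec_smul, dotProduct_sub, sub_dotProduct, smul_dotProduct,
      dotProduct_smul, smul_eq_mul] at h2
    rw [hq, hwv, hvw] at h2
    have h4 : c⁻¹ * (c⁻¹ * (w ⬝ᵥ G *ᵥ w)) ≤ c⁻¹ * (c⁻¹ * (c * (w ⬝ᵥ w))) := by gcongr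
    have h5 : c⁻¹ * (c⁻¹ * (c * (w ⬝ᵥ w))) = c⁻¹ * (w ⬝ᵥ w) := by field_simp
    linarith
  · have h1 := (h v).1
    rw [hq] at h1
    have h2 := sq (c • w - v)
    simp only [dotProduct_sub, sub_dotProduct, smul_dotProduct, dotProduct_smul,
      smul_eq_mul] at h2
    rw [dotProduct_comm v w] at h2
    have h3 : c⁻¹ * (v ⬝ᵥ v) * c = v ⬝ᵥ v := by field_simp
    have h4 : v ⬝ᵥ v ≤ (w ⬝ᵥ v) * c := by rw [← h3]; gcongr
    have h5 : 0 ≤ c * (c * (w ⬝ᵥ w) - w ⬝ᵥ v) := by linarith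
    linarith [nonneg_of_mul_nonneg_right h5 hc]

/-- Testing the form on unit eigenvectors puts each eigenvalue in `[c⁻¹, c]`. -/
theorem det_bounds {G : Matrix (Fin n) (Fin n) ℝ} (hG : G.IsSymm) {c : ℝ}
    (hc : 0 < c) (h : ∀ v, c⁻¹ * (v ⬝ᵥ v) ≤ v ⬝ᵥ G *ᵥ v ∧ v ⬝ᵥ G *ᵥ v ≤ c * (v ⬝ᵥ v)) :
    c⁻¹ ^ n ≤ G.det ∧ G.det ≤ c ^ n := by
  have hH : G.IsHermitian := by rwa [IsHermitian, conjTranspose_eq_transpose_of_trivial]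
  have hev : ∀ i, c⁻¹ ≤ hH.eigenvalues i ∧ hH.eigenvalues i ≤ c := by
    intro i
    have h1 := h (hH.eigenvectorBasis i)
    have h2 := hH.mulVec_eigenvectorBasis i
    have h3 : (⇑(hH.eigenvectorBasis i) : Fin n → ℝ) ⬝ᵥ ⇑(hH.eigenvectorBasis i) = 1 := by
      have h4 := hH.eigenvectorBasis.orthonormal.1 i
      have h5 := EuclideanSpace.real_norm_sq_eq (hH.eigenvectorBasis i)
      rw [h4] at h5
      simp only [dotProduct, ← pow_two]
      rw [← h5]; norm_num
    rw [h2] at h1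
    simpa [dotProduct_smul, h3] using h1
  rw [hH.det_eq_prod_eigenvalues]
  simp only [RCLike.ofReal_real_eq_id, id_eq]
  constructor
  · calc c⁻¹ ^ n = ∏ _i : Fin n, c⁻¹ := by simp
      _ ≤ _ := Finset.prod_le_prod (fun _ _ => (inv_pos.2 hc).le) fun i _ => (hev i).1
  · calc _ ≤ ∏ _i : Fin n, c := Finset.prod_le_prod
          (fun i _ => (inv_pos.2 hc).le.trans (hev i).1) fun i _ => (hev i).2
      _ = _ := by simp

end Matrices

/-! ### Differentials of inverse charts and of transition maps, up to the boundary. -/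

section ChartCalculus

variable {n : ℕ} [NeZero n] {M : Type*} [TopologicalSpace M]
  [ChartedSpace (EuclideanHalfSpace n) M]
  {e e' : OpenPartialHomeomorph M (EuclideanHalfSpace n)} {y : EuclideanSpace ℝ (Fin n)}

/-- `chartDiff`, with the tangent space of `M` identified with the model space. -/
def chartD (e : OpenPartialHomeomorph M (EuclideanHalfSpace n))
    (y : EuclideanSpace ℝ (Fin n)) :
    EuclideanSpace ℝ (Fin n) →L[ℝ] EuclideanSpace ℝ (Fin n) :=
  chartDiff e y

/-- `mfderiv` of a vector-valued function, with the tangent space of `M` identified with the model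
space. -/
def manifoldD {F : Type*} [NormedAddCommGroup F] [NormedSpace ℝ F] (φ : M → F) (x : M) :
    EuclideanSpace ℝ (Fin n) →L[ℝ] F :=
  mfderiv (𝓡∂ n) 𝓘(ℝ, F) φ x

/-- The transition map between two charts. -/
def transition (e e' : OpenPartialHomeomorph M (EuclideanHalfSpace n)) :
    EuclideanSpace ℝ (Fin n) → EuclideanSpace ℝ (Fin n) :=
  (𝓡∂ n).extendCoordChange e e'

theorem chartInv_mem_source (hy : y ∈ chartImage e) : chartInv e y ∈ e.source := by
  have := (e.extend (𝓡∂ n)).map_target hy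
  rwa [e.extend_source] at this

theorem extend_chartInv (hy : y ∈ chartImage e) : e.extend (𝓡∂ n) (chartInv e y) = y :=
  (e.extend (𝓡∂ n)).right_inv hy

theorem extend_mem_chartImage {x : M} (hx : x ∈ e.source) :
    e.extend (𝓡∂ n) x ∈ chartImage e :=
  (e.extend (𝓡∂ n)).map_source (by rwa [e.extend_source])

theorem chartInv_extend {x : M} (hx : x ∈ e.source) : chartInv e (e.extend (𝓡∂ n) x) = x :=
  e.extend_left_inv hx

theorem chartImage_mem_nhdsWithin (hy : y ∈ chartImage e) :
    chartImage e ∈ 𝓝[Set.range (𝓡∂ n)] y := by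
  have h := e.extend_target_mem_nhdsWithin (I := 𝓡∂ n) (chartInv_mem_source hy)
  rwa [extend_chartInv hy] at h

theorem chartImage_subset_range : chartImage e ⊆ Set.range (𝓡∂ n) :=
  e.extend_target_subset_range

theorem measurableSet_range_halfSpace : MeasurableSet (Set.range (𝓡∂ n)) := by
  rw [range_modelWithCornersEuclideanHalfSpace]
  exact measurableSet_le measurable_const (by fun_prop)

theorem measurableSet_chartImage : MeasurableSet (chartImage e) := by
  rw [chartImage, e.extend_target]
  exact ((e.open_target.preimage (𝓡∂ n).continuous_symm).measurableSet).inter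
    measurableSet_range_halfSpace

theorem continuousOn_chartInv : ContinuousOn (chartInv e) (chartImage e) :=
  e.continuousOn_extend_symm

theorem uniqueDiffWithinAt_range (hy : y ∈ chartImage e) :
    UniqueDiffWithinAt ℝ (Set.range (𝓡∂ n)) y :=
  (𝓡∂ n).uniqueDiffOn y (chartImage_subset_range hy)

theorem mdifferentiableWithinAt_chartInv (he : e ∈ charts n M) (hy : y ∈ chartImage e) :
    MDifferentiableWithinAt 𝓘(ℝ, EuclideanSpace ℝ (Fin n)) (𝓡∂ n) (chartInv e)
      (Set.range (𝓡∂ n)) y := by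
  have h1 := contMDiffOn_extend_symm he
  rw [← e.extend_target'] at h1
  exact ((h1 y hy).mdifferentiableWithinAt (by simp)).mono_of_mem_nhdsWithin
    (chartImage_mem_nhdsWithin hy)

theorem hasMFDerivWithinAt_chartInv (he : e ∈ charts n M) (hy : y ∈ chartImage e) :
    HasMFDerivWithinAt 𝓘(ℝ, EuclideanSpace ℝ (Fin n)) (𝓡∂ n) (chartInv e)
      (Set.range (𝓡∂ n)) y (chartDiff e y) :=
  (mdifferentiableWithinAt_chartInv he hy).hasMFDerivWithinAt

theorem hasFDerivWithinAt_comp_chartInv {F : Type*} [NormedAddCommGroup F] [NormedSpace ℝ F]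
    {φ : M → F} (he : e ∈ charts n M) (hy : y ∈ chartImage e)
    (hφ : MDifferentiableAt (𝓡∂ n) 𝓘(ℝ, F) φ (chartInv e y)) :
    HasFDerivWithinAt (φ ∘ chartInv e)
      ((manifoldD φ (chartInv e y)).comp (chartD e y)) (Set.range (𝓡∂ n)) y :=
  hasMFDerivWithinAt_iff_hasFDerivWithinAt.1
    (HasMFDerivAt.comp_hasMFDerivWithinAt y hφ.hasMFDerivAt (hasMFDerivWithinAt_chartInv he hy))

/-- The chart composed with its inverse is the identity near `y` in the half-space. Derivatives
within the half-space are unique even at boundary points, so the chain rule exhibits a left inverse.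
-/
theorem isUnit_det_chartD (he : e ∈ charts n M) (hy : y ∈ chartImage e) :
    IsUnit (chartD e y).det := by
  have h1 : MDifferentiableAt (𝓡∂ n) 𝓘(ℝ, EuclideanSpace ℝ (Fin n)) (e.extend (𝓡∂ n))
      (chartInv e y) :=
    (e.contMDiffAt_extend he (chartInv_mem_source hy)).mdifferentiableAt (by simp)
  have h2 := hasFDerivWithinAt_comp_chartInv he hy h1
  have h3 : HasFDerivWithinAt (e.extend (𝓡∂ n) ∘ chartInv e)
      (ContinuousLinearMap.id ℝ (EuclideanSpace ℝ (Fin n))) (Set.range (𝓡∂ n)) y := by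
    refine (hasFDerivWithinAt_id y _).congr_of_eventuallyEq ?_ (extend_chartInv hy)
    filter_upwards [chartImage_mem_nhdsWithin hy] with z hz using extend_chartInv hz
  have h4 := (uniqueDiffWithinAt_range hy).eq h2 h3
  have h5 := congrArg ContinuousLinearMap.det h4
  rw [ContinuousLinearMap.det, ContinuousLinearMap.toLinearMap_comp, LinearMap.det_comp] at h5
  have h6 : (ContinuousLinearMap.id ℝ (EuclideanSpace ℝ (Fin n))).det = 1 := by
    simp [ContinuousLinearMap.det]
  rw [h6] at h5
  exact IsUnit.of_mul_eq_one_right _ h5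

theorem mem_transition_source : y ∈ ((𝓡∂ n).extendCoordChange e e').source ↔
    y ∈ chartImage e ∧ chartInv e y ∈ e'.source := by
  rw [ModelWithCorners.extendCoordChange, PartialEquiv.trans_source, e'.extend_source]
  rfl

theorem hasFDerivWithinAt_transition (he : e ∈ charts n M) (he' : e' ∈ charts n M)
    (hy : y ∈ chartImage e) (hy' : chartInv e y ∈ e'.source) :
    HasFDerivWithinAt (transition e e') (fderivWithin ℝ (transition e e') (Set.range (𝓡∂ n)) y)
      (Set.range (𝓡∂ n)) y :=
  (((𝓡∂ n).contDiffWithinAt_extendCoordChange he he'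
    (mem_transition_source.2 ⟨hy, hy'⟩)).differentiableWithinAt (by simp)).hasFDerivWithinAt

theorem transition_apply : transition e e' y = e'.extend (𝓡∂ n) (chartInv e y) := rfl

theorem chartD_eq_comp (he : e ∈ charts n M) (he' : e' ∈ charts n M)
    (hy : y ∈ chartImage e) (hy' : chartInv e y ∈ e'.source) :
    chartD e y = (chartD e' (transition e e' y)).comp
      (fderivWithin ℝ (transition e e') (Set.range (𝓡∂ n)) y) := by
  have h1 := hasMFDerivWithinAt_chartInv he' (y := transition e e' y) (extend_mem_chartImage hy')
  have h2 := (hasFDerivWithinAt_transition he he' hy hy').hasMFDerivWithinAt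
  have h3 := HasMFDerivWithinAt.comp y h1 (h2.mono Set.inter_subset_left)
    (s := Set.range (𝓡∂ n) ∩ transition e e' ⁻¹' Set.range (𝓡∂ n)) Set.inter_subset_right
  -- The transition map, by its formula, takes values in the half-space everywhere, even at points
  -- outside the overlap.
  have hset : Set.range (𝓡∂ n) ∩ transition e e' ⁻¹' Set.range (𝓡∂ n) = Set.range (𝓡∂ n) := by
    refine Set.inter_eq_left.2 fun z _ => ?_
    exact ⟨e' (chartInv e z), rfl⟩
  rw [hset] at h3
  have hev : chartInv e =ᶠ[𝓝[Set.range (𝓡∂ n)] y] chartInv e' ∘ transition e e' := by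
    filter_upwards [(𝓡∂ n).extendCoordChange_source_mem_nhdsWithin
      (mem_transition_source.2 ⟨hy, hy'⟩)] with z hz
    exact (chartInv_extend (mem_transition_source.1 hz).2).symm
  have h4 := h3.congr_of_eventuallyEq hev (chartInv_extend hy').symm
  have h5 := h4.mfderivWithin
    (uniqueMDiffWithinAt_iff_uniqueDiffWithinAt.2 (uniqueDiffWithinAt_range hy))
  exact h5

end ChartCalculus

/-! ### Matrices of linear maps and bilinear forms in the standard basis. -/

section Gram

open Matrix

variable {n : ℕ}

/-- The matrix of an endomorphism of Euclidean space in the standard basis. -/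
def stdMatrix (L : EuclideanSpace ℝ (Fin n) →L[ℝ] EuclideanSpace ℝ (Fin n)) :
    Matrix (Fin n) (Fin n) ℝ :=
  Matrix.of fun k i => L (EuclideanSpace.single i 1) k

theorem stdMatrix_eq (L : EuclideanSpace ℝ (Fin n) →L[ℝ] EuclideanSpace ℝ (Fin n)) :
    stdMatrix L = LinearMap.toMatrix (EuclideanSpace.basisFun (Fin n) ℝ).toBasis
      (EuclideanSpace.basisFun (Fin n) ℝ).toBasis (L : _ →ₗ[ℝ] _) := by
  ext k i
  simp [stdMatrix, LinearMap.toMatrix_apply]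

theorem det_stdMatrix (L : EuclideanSpace ℝ (Fin n) →L[ℝ] EuclideanSpace ℝ (Fin n)) :
    (stdMatrix L).det = L.det := by
  rw [stdMatrix_eq, LinearMap.det_toMatrix]

theorem stdMatrix_comp (L L' : EuclideanSpace ℝ (Fin n) →L[ℝ] EuclideanSpace ℝ (Fin n)) :
    stdMatrix (L.comp L') = stdMatrix L * stdMatrix L' := by
  rw [stdMatrix_eq, stdMatrix_eq, stdMatrix_eq, ContinuousLinearMap.toLinearMap_comp,
    LinearMap.toMatrix_comp _ (EuclideanSpace.basisFun (Fin n) ℝ).toBasis]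

theorem euclidean_eq_sum_single (v : EuclideanSpace ℝ (Fin n)) :
    v = ∑ k, v k • (EuclideanSpace.single k 1 : EuclideanSpace ℝ (Fin n)) := by
  ext j
  simp [Finset.sum_apply, Pi.single_apply]

/-- The Gram matrix of a bilinear form on Euclidean space in the standard basis. -/
def stdGram (B : LinearMap.BilinForm ℝ (EuclideanSpace ℝ (Fin n))) : Matrix (Fin n) (Fin n) ℝ :=
  Matrix.of fun i j => B (EuclideanSpace.single i 1) (EuclideanSpace.single j 1)

theorem bilinForm_apply_eq (B : LinearMap.BilinForm ℝ (EuclideanSpace ℝ (Fin n)))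
    (u v : EuclideanSpace ℝ (Fin n)) : B u v = u.ofLp ⬝ᵥ stdGram B *ᵥ v.ofLp := by
  conv_lhs => rw [euclidean_eq_sum_single u, euclidean_eq_sum_single v]
  simp only [map_sum, LinearMap.sum_apply, map_smul, LinearMap.smul_apply, smul_eq_mul,
    dotProduct, mulVec, stdGram, Matrix.of_apply, Finset.mul_sum]
  rw [Finset.sum_comm]
  exact Finset.sum_congr rfl fun i _ => Finset.sum_congr rfl fun j _ => by ring

theorem stdGram_comp (B : LinearMap.BilinForm ℝ (EuclideanSpace ℝ (Fin n)))
    (L : EuclideanSpace ℝ (Fin n) →L[ℝ] EuclideanSpace ℝ (Fin n)) :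
    (Matrix.of fun i j => B (L (EuclideanSpace.single i 1)) (L (EuclideanSpace.single j 1)))
      = (stdMatrix L)ᵀ * stdGram B * stdMatrix L := by
  ext i j
  rw [Matrix.of_apply, bilinForm_apply_eq, mul_assoc]
  simp only [dotProduct, mulVec, mul_apply, transpose_apply, stdMatrix, Matrix.of_apply]

end Gram

/-! ### The volume measure in charts and its independence of the chart. -/

section ChartVolume

open Matrix

variable {n : ℕ} [NeZero n] {M : Type*} [TopologicalSpace M]
  [ChartedSpace (EuclideanHalfSpace n) M]
  {e e' : OpenPartialHomeomorph M (EuclideanHalfSpace n)} {y : EuclideanSpace ℝ (Fin n)}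
  (g : RoughMetric n M)

/-- The bilinear form of a rough metric, on the model space. -/
def RoughMetric.modelForm (x : M) : LinearMap.BilinForm ℝ (EuclideanSpace ℝ (Fin n)) := g.form x

/-- The Gram matrix of a rough metric in the coordinate frame of a chart. -/
def RoughMetric.chartGram (e : OpenPartialHomeomorph M (EuclideanHalfSpace n))
    (y : EuclideanSpace ℝ (Fin n)) : Matrix (Fin n) (Fin n) ℝ :=
  gram (g.form (chartInv e y)) (chartFrame e y)

/-- The density of the volume measure of a rough metric in a chart. -/
def RoughMetric.chartDensity (e : OpenPartialHomeomorph M (EuclideanHalfSpace n))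
    (y : EuclideanSpace ℝ (Fin n)) : ℝ≥0∞ :=
  ENNReal.ofReal √(g.chartGram e y).det

theorem chartGram_eq : g.chartGram e y = (stdMatrix (chartD e y))ᵀ *
    stdGram (g.modelForm (chartInv e y)) * stdMatrix (chartD e y) :=
  stdGram_comp (g.modelForm (chartInv e y)) (chartD e y)

theorem isSymm_chartGram : (g.chartGram e y).IsSymm := by
  ext i j
  exact g.symm' _ _ _

theorem isSymm_stdGram (x : M) : (stdGram (g.modelForm x)).IsSymm := by
  ext i j
  exact g.symm' _ _ _

theorem form_chartDiff (u : EuclideanSpace ℝ (Fin n)) :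
    g.form (chartInv e y) (chartDiff e y u) (chartDiff e y u)
      = u.ofLp ⬝ᵥ g.chartGram e y *ᵥ u.ofLp := by
  let B : LinearMap.BilinForm ℝ (EuclideanSpace ℝ (Fin n)) :=
    (g.modelForm (chartInv e y)).compl₁₂ (chartD e y : _ →ₗ[ℝ] _) (chartD e y : _ →ₗ[ℝ] _)
  exact bilinForm_apply_eq B u u

/-- By the chain rule the Gram determinant acquires the square of the Jacobian of the transition
map, whose square root is exactly the factor in the change of variables formula. -/
theorem chartDensity_transition (he : e ∈ charts n M) (he' : e' ∈ charts n M)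
    (hy : y ∈ chartImage e) (hy' : chartInv e y ∈ e'.source) :
    g.chartDensity e y =
      ENNReal.ofReal |(fderivWithin ℝ (transition e e') (Set.range (𝓡∂ n)) y).det| *
        g.chartDensity e' (transition e e' y) := by
  have h1 : chartInv e' (transition e e' y) = chartInv e y := chartInv_extend hy'
  rw [RoughMetric.chartDensity, RoughMetric.chartDensity, chartGram_eq, chartGram_eq, h1,
    chartD_eq_comp he he' hy hy', stdMatrix_comp, ← ENNReal.ofReal_mul (abs_nonneg _),
    ← Real.sqrt_sq_eq_abs, ← Real.sqrt_mul (sq_nonneg _), ← det_stdMatrix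
      (fderivWithin ℝ (transition e e') (Set.range (𝓡∂ n)) y)]
  congr 2
  simp only [det_mul, det_transpose]
  ring

variable [MeasurableSpace M] [BorelSpace M]

theorem measurableSet_source : MeasurableSet e.source := e.open_source.measurableSet

theorem measurableSet_chartImage_inter_preimage {A : Set M} (hA : MeasurableSet A) :
    MeasurableSet (chartImage e ∩ chartInv e ⁻¹' A) := by
  have h1 : Measurable ((chartImage e).domRestrict (chartInv e)) :=
    (continuousOn_iff_continuous_domRestrict.1 continuousOn_chartInv).measurable
  have h2 := (MeasurableEmbedding.subtype_coe (measurableSet_chartImage (e := e))).measurableSet_image.2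
    (h1 hA)
  convert h2 using 1
  ext z
  simp [Set.domRestrict, and_comm]

theorem aemeasurable_chartInv : AEMeasurable (chartInv e) (volume.restrict (chartImage e)) :=
  continuousOn_chartInv.aemeasurable measurableSet_chartImage

theorem aemeasurable_extend : AEMeasurable (e.extend (𝓡∂ n)) (g.vol.restrict e.source) := by
  have := e.continuousOn_extend (I := 𝓡∂ n)
  rw [e.extend_source] at this
  exact this.aemeasurable measurableSet_source

theorem chartVolume_eq : g.chartVolume e =
    ((volume.restrict (chartImage e)).withDensity (g.chartDensity e)).map (chartInv e) := rfl

theorem aemeasurable_chartInv_withDensity : AEMeasurable (chartInv e)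
    ((volume.restrict (chartImage e)).withDensity (g.chartDensity e)) :=
  aemeasurable_chartInv.mono_ac (withDensity_absolutelyContinuous _ _)

/-- `chartInv e` is controlled only on the chart image, so the preimage of `A` is first cut down to
that set; the rest is null for the restricted measure. -/
theorem chartVolume_apply {A : Set M} (hA : MeasurableSet A) :
    g.chartVolume e A = ∫⁻ y in chartImage e ∩ chartInv e ⁻¹' A, g.chartDensity e y := by
  have h0 := measurableSet_chartImage_inter_preimage (e := e) hA
  have hnull : NullMeasurableSet (chartInv e ⁻¹' A)
      ((volume.restrict (chartImage e)).withDensity (g.chartDensity e)) :=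
    (aemeasurable_chartInv_withDensity g).nullMeasurable hA
  rw [chartVolume_eq, Measure.map_apply_of_aemeasurable (aemeasurable_chartInv_withDensity g) hA]
  have h1 : ((volume.restrict (chartImage e)).withDensity (g.chartDensity e)) (chartImage e)ᶜ = 0 :=
    (withDensity_absolutelyContinuous _ _) (by
      rw [Measure.restrict_apply measurableSet_chartImage.compl]; simp)
  rw [← measure_inter_add_sdiff (chartInv e ⁻¹' A) (measurableSet_chartImage (e := e)),
    measure_mono_null (Set.sdiff_subset_compl _ _) h1, add_zero, Set.inter_comm,
    withDensity_apply _ h0, Measure.restrict_restrict h0,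
    Set.inter_assoc, Set.inter_comm (chartInv e ⁻¹' A), ← Set.inter_assoc, Set.inter_self]

theorem chartVolume_eq_of_subset (he : e ∈ charts n M) (he' : e' ∈ charts n M) {A : Set M}
    (hA : MeasurableSet A) (hAe : A ⊆ e.source) (hAe' : A ⊆ e'.source) :
    g.chartVolume e A = g.chartVolume e' A := by
  rw [chartVolume_apply g hA, chartVolume_apply g hA]
  have himg : transition e e' '' (chartImage e ∩ chartInv e ⁻¹' A)
      = chartImage e' ∩ chartInv e' ⁻¹' A := by
    ext z
    constructor
    · rintro ⟨y, ⟨hy, hyA⟩, rfl⟩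
      refine ⟨extend_mem_chartImage (hAe' hyA), ?_⟩
      rw [Set.mem_preimage, transition_apply, chartInv_extend (hAe' hyA)]
      exact hyA
    · rintro ⟨hz, hzA⟩
      refine ⟨e.extend (𝓡∂ n) (chartInv e' z), ⟨extend_mem_chartImage (hAe hzA), ?_⟩, ?_⟩
      · rw [Set.mem_preimage, chartInv_extend (hAe hzA)]
        exact hzA
      · rw [transition_apply, chartInv_extend (hAe hzA), extend_chartInv hz]
  have hinj : Set.InjOn (transition e e') (chartImage e ∩ chartInv e ⁻¹' A) := by
    rintro y ⟨hy, hyA⟩ z ⟨hz, hzA⟩ h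
    have h' := congrArg (chartInv e') h
    rw [transition_apply, transition_apply, chartInv_extend (hAe' hyA),
      chartInv_extend (hAe' hzA)] at h'
    rw [← extend_chartInv hy, ← extend_chartInv hz, h']
  rw [← himg, lintegral_image_eq_lintegral_abs_det_fderiv_mul volume
    (measurableSet_chartImage_inter_preimage hA)
    (fun y hy => (hasFDerivWithinAt_transition he he' hy.1 (hAe' hy.2)).mono
      (Set.inter_subset_left.trans chartImage_subset_range)) hinj]
  exact setLIntegral_congr_fun (measurableSet_chartImage_inter_preimage hA)
    fun y hy => chartDensity_transition g he he' hy.1 (hAe' hy.2)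

theorem chartVolume_compl_source : g.chartVolume e e.sourceᶜ = 0 := by
  rw [chartVolume_apply g measurableSet_source.compl]
  have : chartImage e ∩ chartInv e ⁻¹' e.sourceᶜ = ∅ := by
    ext z
    simp only [Set.mem_inter_iff, Set.mem_preimage, Set.mem_compl_iff, Set.mem_empty_iff_false,
      iff_false, not_and, not_not]
    exact fun hz => chartInv_mem_source hz
  rw [this]; simp

/-- The measure `g.chartVolume e + g.vol.restrict e.sourceᶜ` dominates every chart volume, by
agreement on overlaps, hence it dominates their supremum `g.vol`. On `e.source` its second summand
vanishes. -/
theorem vol_restrict_source (he : e ∈ charts n M) :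
    g.vol.restrict e.source = g.chartVolume e := by
  have hle : g.chartVolume e ≤ g.vol := le_iSup₂_of_le e he le_rfl
  have hup : g.vol ≤ g.chartVolume e + g.vol.restrict e.sourceᶜ := by
    refine iSup₂_le fun e' he' => ?_
    rw [Measure.le_iff]
    intro A hA
    have h1 : g.chartVolume e' (A ∩ e.source) ≤ g.chartVolume e A := by
      have h2 : g.chartVolume e' (A ∩ e.source) = g.chartVolume e' (A ∩ e.source ∩ e'.source) := by
        rw [← measure_inter_add_sdiff (A ∩ e.source) (measurableSet_source (e := e')),
          measure_mono_null (Set.sdiff_subset_compl _ _) (chartVolume_compl_source g), add_zero]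
      rw [h2, chartVolume_eq_of_subset g he' he ((hA.inter measurableSet_source).inter
        measurableSet_source) Set.inter_subset_right
          (Set.inter_subset_left.trans Set.inter_subset_right)]
      exact measure_mono (Set.inter_subset_left.trans Set.inter_subset_left)
    have h3 : g.chartVolume e' (A \ e.source) ≤ g.vol.restrict e.sourceᶜ A := by
      rw [Measure.restrict_apply hA, ← Set.sdiff_eq]
      exact (le_iSup₂_of_le e' he' le_rfl : g.chartVolume e' ≤ g.vol) _
    rw [Measure.add_apply, ← measure_inter_add_sdiff A (measurableSet_source (e := e))]
    gcongr
  refine le_antisymm ?_ ?_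
  · rw [Measure.le_iff]
    intro A hA
    rw [Measure.restrict_apply hA]
    refine (hup _).trans ?_
    rw [Measure.add_apply, Measure.restrict_apply (hA.inter measurableSet_source)]
    have : A ∩ e.source ∩ e.sourceᶜ = ∅ := by
      rw [Set.inter_assoc, Set.inter_compl_self, Set.inter_empty]
    rw [this, measure_empty, add_zero]
    exact measure_mono Set.inter_subset_left
  · rw [Measure.le_iff]
    intro A hA
    rw [Measure.restrict_apply hA,
      ← measure_inter_add_sdiff A (measurableSet_source (e := e)),
      measure_mono_null (Set.sdiff_subset_compl _ _) (chartVolume_compl_source g), add_zero]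
    exact hle _

end ChartVolume

/-! ### Coordinate cells and comparison of the volume with Lebesgue measure. -/

section Cells

open Matrix

variable {n : ℕ} [NeZero n] {M : Type*} [TopologicalSpace M]
  [ChartedSpace (EuclideanHalfSpace n) M]
  {e e' : OpenPartialHomeomorph M (EuclideanHalfSpace n)} {y : EuclideanSpace ℝ (Fin n)}
  (g : RoughMetric n M)

/-- The Gram matrix in a chart is uniformly comparable to the identity matrix. -/
def RoughMetric.GramBounded (e : OpenPartialHomeomorph M (EuclideanHalfSpace n)) (c : ℝ) : Prop :=
  1 ≤ c ∧ ∀ᵐ y ∂(volume.restrict (chartImage e)), ∀ v : Fin n → ℝ,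
    c⁻¹ * (v ⬝ᵥ v) ≤ v ⬝ᵥ g.chartGram e y *ᵥ v ∧ v ⬝ᵥ g.chartGram e y *ᵥ v ≤ c * (v ⬝ᵥ v)

theorem exists_gramBounded (x : M) : ∃ e ∈ charts n M, x ∈ e.source ∧ ∃ c, g.GramBounded e c := by
  obtain ⟨e, he, hx, C, hC, h⟩ := g.comparable' x
  have hC0 : 0 < C := by linarith
  refine ⟨e, he, hx, C ^ 2, by nlinarith, ?_⟩
  filter_upwards [h] with y hy v
  obtain ⟨h1, h2⟩ := hy (WithLp.toLp 2 v)
  have hn : v ⬝ᵥ v = ‖WithLp.toLp 2 v‖ ^ 2 := by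
    rw [EuclideanSpace.real_norm_sq_eq]
    simp [dotProduct, pow_two]
  rw [form_chartDiff] at h1 h2
  rw [hn]
  dsimp only at h1 h2
  set q := v ⬝ᵥ g.chartGram e y *ᵥ v with hq
  set r := ‖WithLp.toLp 2 v‖ with hr
  -- The real square root vanishes on negative numbers, so bounds on `√q` give bounds on `q` only
  -- once the lower bound makes `√q` positive.
  by_cases hr0 : r = 0
  · have hv : v = 0 := by
      have := norm_eq_zero.1 hr0
      simpa using congrArg WithLp.ofLp this
    have hq0 : q = 0 := by rw [hq, hv]; simp
    rw [hq0, hr0]; simp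
  · have hrpos : 0 < r := lt_of_le_of_ne (norm_nonneg _) (Ne.symm hr0)
    have hs : 0 < √q := lt_of_lt_of_le (by positivity) h1
    have hqs : √q ^ 2 = q := Real.sq_sqrt (Real.sqrt_pos.1 hs).le
    rw [← hqs]
    constructor
    · calc (C ^ 2)⁻¹ * r ^ 2 = (C⁻¹ * r) ^ 2 := by rw [mul_pow, inv_pow]
        _ ≤ √q ^ 2 := by gcongr
    · calc √q ^ 2 ≤ (C * r) ^ 2 := by gcongr
        _ = _ := by ring

theorem aemeasurable_chartGram (he : e ∈ charts n M) (i j : Fin n) :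
    AEMeasurable (fun y => g.chartGram e y i j) (volume.restrict (chartImage e)) :=
  g.measurable' e he i j

theorem aemeasurable_comp_chartGram {β : Type*} [TopologicalSpace β] [MeasurableSpace β]
    [BorelSpace β] (he : e ∈ charts n M) {F : Matrix (Fin n) (Fin n) ℝ → β} (hF : Continuous F) :
    AEMeasurable (fun y => F (g.chartGram e y)) (volume.restrict (chartImage e)) := by
  have h1 : AEMeasurable (fun y => (fun i j => g.chartGram e y i j : Fin n → Fin n → ℝ))
      (volume.restrict (chartImage e)) :=
    aemeasurable_pi_lambda _ fun i => aemeasurable_pi_lambda _ fun j =>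
      aemeasurable_chartGram g he i j
  have h3 : Continuous (fun A : Fin n → Fin n → ℝ => F (Matrix.of A)) := hF
  have h2 : Measurable (fun A : Fin n → Fin n → ℝ => F (Matrix.of A)) := h3.measurable
  exact h2.comp_aemeasurable h1

/-- Cramer's rule: the determinant and the adjugate are continuous in the entries, whereas matrix
inversion is not. -/
theorem aemeasurable_chartGram_inv (he : e ∈ charts n M) (i j : Fin n) :
    AEMeasurable (fun y => (g.chartGram e y)⁻¹ i j) (volume.restrict (chartImage e)) := by
  have h1 := aemeasurable_comp_chartGram g he (F := fun A => A.det)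
    (Continuous.matrix_det continuous_id)
  have h2 := aemeasurable_comp_chartGram g he (F := fun A => A.adjugate i j)
    ((Continuous.matrix_adjugate continuous_id).matrix_elem i j)
  simp_rw [Matrix.inv_def, Ring.inverse_eq_inv', Matrix.smul_apply, smul_eq_mul]
  exact h1.inv.mul h2

theorem aemeasurable_chartDensity (he : e ∈ charts n M) :
    AEMeasurable (g.chartDensity e) (volume.restrict (chartImage e)) :=
  (aemeasurable_comp_chartGram g he (F := fun A => A.det)
    (Continuous.matrix_det continuous_id)).sqrt.ennreal_ofReal

/-- The components of a covector field in a chart. -/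
def CovectorField.components (α : CovectorField n M)
    (e : OpenPartialHomeomorph M (EuclideanHalfSpace n)) (y : EuclideanSpace ℝ (Fin n))
    (i : Fin n) : ℂ :=
  α (chartInv e y) (chartFrame e y i)

theorem coInner_eq_herm (x : M) (a b : TangentSpace (𝓡∂ n) x →L[ℝ] ℂ) :
    g.coInner x a b = herm (stdGram (g.modelForm x))⁻¹ (fun i => a (stdFrame x i))
      (fun i => b (stdFrame x i)) := rfl

theorem components_eq (a : EuclideanSpace ℝ (Fin n) →L[ℝ] ℂ)
    (L : EuclideanSpace ℝ (Fin n) →L[ℝ] EuclideanSpace ℝ (Fin n)) (i : Fin n) :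
    a (L (EuclideanSpace.single i 1)) =
      ∑ k, (stdMatrix L k i : ℂ) * a (EuclideanSpace.single k 1) := by
  conv_lhs => rw [euclidean_eq_sum_single (L (EuclideanSpace.single i 1))]
  simp [stdMatrix]

theorem coInner_chart (he : e ∈ charts n M) (hy : y ∈ chartImage e) (α η : CovectorField n M) :
    g.coInner (chartInv e y) (α (chartInv e y)) (η (chartInv e y)) =
      herm (g.chartGram e y)⁻¹ (α.components e y) (η.components e y) := by
  have h1 : ∀ α : CovectorField n M, α.components e y = fun i =>
      ∑ k, (stdMatrix (chartD e y) k i : ℂ) * α (chartInv e y) (stdFrame _ k) :=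
    fun α => funext fun i => components_eq (α (chartInv e y)) (chartD e y) i
  rw [h1, h1, chartGram_eq, herm_frame_change, coInner_eq_herm]
  rw [det_stdMatrix]
  exact isUnit_det_chartD he hy

theorem posDef_chartGram {c : ℝ} (hc : g.GramBounded e c) :
    ∀ᵐ y ∂(volume.restrict (chartImage e)), (g.chartGram e y).PosDef := by
  filter_upwards [hc.2] with y hy
  exact posDef_of_le (isSymm_chartGram g) (by linarith [hc.1]) fun v => (hy v).1

/-- Comparability is known in the chart frame; congruence by the invertible differential of the
inverse chart carries positivity to the standard frame, in which `coInner` is written. -/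
theorem posSemidef_stdGram_inv {c : ℝ} (he : e ∈ charts n M) (hc : g.GramBounded e c) :
    ∀ᵐ y ∂(volume.restrict (chartImage e)),
      (stdGram (g.modelForm (chartInv e y)))⁻¹.PosSemidef := by
  filter_upwards [posDef_chartGram g hc, ae_restrict_mem measurableSet_chartImage] with y hy hyi
  rw [chartGram_eq] at hy
  have hu : IsUnit (stdMatrix (chartD e y)) := by
    rw [Matrix.isUnit_iff_isUnit_det, det_stdMatrix]
    exact isUnit_det_chartD he hyi
  have h1 := (Matrix.IsUnit.posDef_star_left_conjugate_iff hu
    (x := stdGram (g.modelForm (chartInv e y)))).1 hy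
  exact h1.inv.posSemidef

theorem chartDensity_bounds {c : ℝ} (hc : g.GramBounded e c) :
    ∀ᵐ y ∂(volume.restrict (chartImage e)),
      g.chartDensity e y ≤ ENNReal.ofReal √(c ^ n) ∧
      1 ≤ ENNReal.ofReal √(c ^ n) * g.chartDensity e y := by
  have hc0 : 0 < c := by linarith [hc.1]
  filter_upwards [hc.2] with y hy
  obtain ⟨h1, h2⟩ := det_bounds (isSymm_chartGram g) hc0 hy
  refine ⟨ENNReal.ofReal_le_ofReal (Real.sqrt_le_sqrt h2), ?_⟩
  rw [RoughMetric.chartDensity, ← ENNReal.ofReal_mul (Real.sqrt_nonneg _),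
    ← Real.sqrt_mul (by positivity), ENNReal.one_le_ofReal, Real.one_le_sqrt]
  calc (1 : ℝ) = c ^ n * c⁻¹ ^ n := by rw [← mul_pow, mul_inv_cancel₀ hc0.ne', one_pow]
    _ ≤ _ := by gcongr

/-- A coordinate neighbourhood `U` whose image in the chart is, up to a null set, the bounded convex
open set `Q`. -/
structure RoughMetric.IsCell (U : Set M) (Q : Set (EuclideanSpace ℝ (Fin n)))
    (e : OpenPartialHomeomorph M (EuclideanHalfSpace n)) (c : ℝ) : Prop where
  mem_charts : e ∈ charts n M
  bounded : g.GramBounded e c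
  isOpen : IsOpen U
  subset_source : U ⊆ e.source
  isOpen_image : IsOpen Q
  convex : Convex ℝ Q
  isBounded : Bornology.IsBounded Q
  nonempty : Q.Nonempty
  closure_subset : closure Q ⊆ chartImage e
  mapsTo : Q ⊆ chartInv e ⁻¹' U
  null : volume ((chartImage e ∩ chartInv e ⁻¹' U) \ Q) = 0

theorem convex_range_halfSpace : Convex ℝ (Set.range (𝓡∂ n)) := (𝓡∂ n).convex_range

/-- `Q` is a small ball about the image of `x`, intersected with the open half-space. It is convex
and open also when `x` is a boundary point. -/
theorem exists_isCell (x : M) {V : Set M} (hV : IsOpen V) (hx : x ∈ V) :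
    ∃ U Q e c, x ∈ U ∧ U ⊆ V ∧ g.IsCell U Q e c := by
  obtain ⟨e, he, hxe, c, hc⟩ := exists_gramBounded g x
  set p := e.extend (𝓡∂ n) x with hp
  have hpim : p ∈ chartImage e := extend_mem_chartImage hxe
  have hnhds : chartImage e ∩ chartInv e ⁻¹' V ∈ 𝓝[Set.range (𝓡∂ n)] p := by
    refine inter_mem (chartImage_mem_nhdsWithin hpim) ?_
    have h1 := (e.continuousAt_extend_symm (I := 𝓡∂ n) hxe).preimage_mem_nhds
      (t := V) (by rw [e.extend_left_inv hxe]; exact hV.mem_nhds hx)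
    exact mem_nhdsWithin_of_mem_nhds h1
  obtain ⟨r, hr, hsub⟩ := Metric.mem_nhdsWithin_iff.1 hnhds
  -- Halving the radius keeps the closed ball inside the good neighbourhood, which places `closure
  -- Q` in the chart image.
  set s := r / 2 with hs
  have hs0 : 0 < s := by positivity
  have hcl : Metric.closedBall p s ∩ Set.range (𝓡∂ n) ⊆ chartImage e ∩ chartInv e ⁻¹' V :=
    (Set.inter_subset_inter_left _ (Metric.closedBall_subset_ball (by rw [hs]; linarith))).trans
      hsub
  have hcl' : Metric.ball p s ∩ Set.range (𝓡∂ n) ⊆ chartImage e ∩ chartInv e ⁻¹' V :=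
    (Set.inter_subset_inter_left _ Metric.ball_subset_closedBall).trans hcl
  set Q := Metric.ball p s ∩ interior (Set.range (𝓡∂ n)) with hQ
  have hQr : Q ⊆ Metric.ball p s ∩ Set.range (𝓡∂ n) :=
    Set.inter_subset_inter_right _ interior_subset
  set U := e.source ∩ e.extend (𝓡∂ n) ⁻¹' Metric.ball p s with hU
  have hQopen : IsOpen Q := Metric.isOpen_ball.inter isOpen_interior
  have hpcl : p ∈ closure (interior (Set.range (𝓡∂ n))) :=
    (𝓡∂ n).range_subset_closure_interior (chartImage_subset_range hpim)
  refine ⟨U, Q, e, c, ⟨hxe, Metric.mem_ball_self hs0⟩, ?_, he, hc, ?_, Set.inter_subset_left,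
    hQopen, (convex_ball p s).inter convex_range_halfSpace.interior,
    Metric.isBounded_ball.subset Set.inter_subset_left, ?_, ?_, ?_, ?_⟩
  · rintro z ⟨hz, hzb⟩
    have := (hcl' ⟨hzb, chartImage_subset_range (extend_mem_chartImage hz)⟩).2
    rwa [Set.mem_preimage, chartInv_extend hz] at this
  · exact e.isOpen_extend_preimage Metric.isOpen_ball
  · exact mem_closure_iff_nhds.1 hpcl _ (Metric.ball_mem_nhds p hs0)
  · calc closure Q ⊆ closure (Metric.ball p s) ∩ closure (interior (Set.range (𝓡∂ n))) :=
        closure_inter_subset_inter_closure _ _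
      _ ⊆ Metric.closedBall p s ∩ Set.range (𝓡∂ n) :=
        Set.inter_subset_inter Metric.closure_ball_subset_closedBall
          ((closure_mono interior_subset).trans (𝓡∂ n).isClosed_range.closure_subset)
      _ ⊆ _ := hcl.trans Set.inter_subset_left
  · intro z hz
    have hz' := (hcl' (hQr hz)).1
    refine ⟨chartInv_mem_source hz', ?_⟩
    rw [Set.mem_preimage, extend_chartInv hz']
    exact hz.1
  -- Points of the image of `U` outside `Q` lie on the frontier of the half-space, which is null
  -- since the half-space is convex.
  · refine measure_mono_null ?_ ((convex_range_halfSpace (n := n)).addHaar_frontier volume)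
    rintro z ⟨⟨hz, hzU⟩, hzQ⟩
    have hzb : z ∈ Metric.ball p s := by
      have := hzU.2
      rwa [Set.mem_preimage, extend_chartInv hz] at this
    exact ⟨subset_closure (chartImage_subset_range hz), fun h => hzQ ⟨hzb, h⟩⟩

variable [MeasurableSpace M] [BorelSpace M]

/-- Since `P` need not be measurable, the exceptional set is first enlarged to a Borel null set,
whose preimage under the chart is measurable and null. -/
theorem ae_vol_of_ae_chart (he : e ∈ charts n M) {P : M → Prop}
    (h : ∀ᵐ y ∂(volume.restrict (chartImage e)), P (chartInv e y)) :
    ∀ᵐ x ∂(g.vol.restrict e.source), P x := by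
  obtain ⟨N, hN, hNm, hN0⟩ := exists_measurable_superset_of_null
    ((ae_restrict_iff' measurableSet_chartImage).1 h)
  have hcont := e.continuousOn_extend (I := 𝓡∂ n)
  rw [e.extend_source] at hcont
  have hA : MeasurableSet (e.source ∩ e.extend (𝓡∂ n) ⁻¹' N) := by
    have h1 : Measurable (e.source.domRestrict (e.extend (𝓡∂ n))) :=
      (continuousOn_iff_continuous_domRestrict.1 hcont).measurable
    have h2 := (MeasurableEmbedding.subtype_coe
      (measurableSet_source (e := e))).measurableSet_image.2 (h1 hNm)
    convert h2 using 1
    ext z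
    simp [Set.domRestrict, and_comm]
  rw [ae_restrict_iff' measurableSet_source]
  refine measure_mono_null (t := e.source ∩ e.extend (𝓡∂ n) ⁻¹' N) ?_ ?_
  · intro x hx
    simp only [Set.mem_compl_iff, Set.mem_ofPred_eq, Classical.not_imp] at hx
    refine ⟨hx.1, hN ?_⟩
    simp only [Set.mem_compl_iff, Set.mem_ofPred_eq, Classical.not_imp]
    rw [chartInv_extend hx.1]
    exact ⟨extend_mem_chartImage hx.1, hx.2⟩
  · have h1 : g.vol (e.source ∩ e.extend (𝓡∂ n) ⁻¹' N) =
        g.vol.restrict e.source (e.source ∩ e.extend (𝓡∂ n) ⁻¹' N) := by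
      rw [Measure.restrict_apply hA, Set.inter_right_comm, Set.inter_self]
    rw [h1, vol_restrict_source g he, chartVolume_apply g hA]
    refine setLIntegral_measure_zero _ _ (measure_mono_null ?_ hN0)
    rintro y ⟨hy, hyN⟩
    have := hyN.2
    rwa [Set.mem_preimage, extend_chartInv hy] at this

theorem aemeasurable_vol_of_chart {β : Type*} [MeasurableSpace β] (he : e ∈ charts n M)
    {f : M → β} (h : AEMeasurable (fun y => f (chartInv e y)) (volume.restrict (chartImage e))) :
    AEMeasurable f (g.vol.restrict e.source) := by
  have h1 : AEMeasurable (fun x => h.mk _ (e.extend (𝓡∂ n) x)) (g.vol.restrict e.source) :=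
    h.measurable_mk.comp_aemeasurable (aemeasurable_extend g)
  refine h1.congr ?_
  have h2 : ∀ᵐ x ∂(g.vol.restrict e.source),
      f (chartInv e (e.extend (𝓡∂ n) x)) = h.mk _ (e.extend (𝓡∂ n) x) := by
    refine ae_vol_of_ae_chart g he ?_
    filter_upwards [h.ae_eq_mk, ae_restrict_mem measurableSet_chartImage] with y hy hyi
    rw [extend_chartInv hyi]
    exact hy
  filter_upwards [h2, ae_restrict_mem measurableSet_source] with x hx hxs
  rw [← hx, chartInv_extend hxs]

theorem lintegral_source (he : e ∈ charts n M) {f : M → ℝ≥0∞}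
    (hf : AEMeasurable f (g.vol.restrict e.source)) :
    ∫⁻ x in e.source, f x ∂g.vol
      = ∫⁻ y in chartImage e, g.chartDensity e y * f (chartInv e y) := by
  rw [vol_restrict_source g he] at hf ⊢
  rw [chartVolume_eq] at hf ⊢
  rw [lintegral_map' hf (aemeasurable_chartInv_withDensity g),
    lintegral_withDensity_eq_lintegral_mul₀' (g := fun y => f (chartInv e y)) (aemeasurable_chartDensity g he)
      (hf.comp_aemeasurable (aemeasurable_chartInv_withDensity g))]
  rfl

theorem lintegral_cell {U : Set M} {Q : Set (EuclideanSpace ℝ (Fin n))} {c : ℝ}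
    (h : g.IsCell U Q e c) {f : M → ℝ≥0∞} (hf : AEMeasurable f g.vol) :
    ∫⁻ x in U, f x ∂g.vol = ∫⁻ y in Q, g.chartDensity e y * f (chartInv e y) := by
  have hU := h.isOpen.measurableSet
  have h1 : ∫⁻ x in U, f x ∂g.vol = ∫⁻ x in e.source, U.indicator f x ∂g.vol := by
    rw [lintegral_indicator hU, Measure.restrict_restrict hU,
      Set.inter_eq_left.2 h.subset_source]
  rw [h1, lintegral_source g h.mem_charts (hf.indicator hU).restrict]
  have hm := measurableSet_chartImage_inter_preimage (e := e) hU
  have hQc : Q ⊆ chartImage e ∩ chartInv e ⁻¹' U :=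
    fun z hz => ⟨h.closure_subset (subset_closure hz), h.mapsTo hz⟩
  have hae : (chartImage e ∩ chartInv e ⁻¹' U : Set _) =ᵐ[volume] Q :=
    ((ae_le_set.2 h.null).antisymm (LE.le.eventuallyLE hQc))
  rw [← setLIntegral_congr hae]
  have h2 : ∫⁻ y in chartImage e, g.chartDensity e y * U.indicator f (chartInv e y) =
      ∫⁻ y in chartImage e, (chartImage e ∩ chartInv e ⁻¹' U).indicator
        (fun y => g.chartDensity e y * f (chartInv e y)) y := by
    refine setLIntegral_congr_fun measurableSet_chartImage fun y hy => ?_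
    by_cases hyU : chartInv e y ∈ U
    · simp [hyU, hy]
    · simp [hyU]
  rw [h2, lintegral_indicator hm, Measure.restrict_restrict hm, Set.inter_assoc,
    Set.inter_comm _ (chartImage e), ← Set.inter_assoc, Set.inter_self]

theorem cell_ae {U : Set M} {Q : Set (EuclideanSpace ℝ (Fin n))} {c : ℝ}
    (h : g.IsCell U Q e c) : volume.restrict Q ≤ volume.restrict (chartImage e) :=
  Measure.restrict_mono (subset_closure.trans h.closure_subset) le_rfl

theorem lintegral_cell_le {U : Set M} {Q : Set (EuclideanSpace ℝ (Fin n))} {c : ℝ}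
    (h : g.IsCell U Q e c) {f : M → ℝ≥0∞} (hf : AEMeasurable f g.vol) :
    ∫⁻ x in U, f x ∂g.vol ≤ ENNReal.ofReal √(c ^ n) * ∫⁻ y in Q, f (chartInv e y) := by
  rw [lintegral_cell g h hf, ← lintegral_const_mul' _ _ ENNReal.ofReal_ne_top]
  refine lintegral_mono_ae ?_
  filter_upwards [ae_mono (cell_ae g h) (chartDensity_bounds g h.bounded)] with y hy
  gcongr
  exact hy.1

theorem le_lintegral_cell {U : Set M} {Q : Set (EuclideanSpace ℝ (Fin n))} {c : ℝ}
    (h : g.IsCell U Q e c) {f : M → ℝ≥0∞} (hf : AEMeasurable f g.vol) :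
    ∫⁻ y in Q, f (chartInv e y) ≤ ENNReal.ofReal √(c ^ n) * ∫⁻ x in U, f x ∂g.vol := by
  rw [lintegral_cell g h hf, ← lintegral_const_mul' _ _ ENNReal.ofReal_ne_top]
  refine lintegral_mono_ae ?_
  filter_upwards [ae_mono (cell_ae g h) (chartDensity_bounds g h.bounded)] with y hy
  rw [← mul_assoc]
  exact le_mul_of_one_le_left' hy.2

theorem vol_cell_lt_top {U : Set M} {Q : Set (EuclideanSpace ℝ (Fin n))} {c : ℝ}
    (h : g.IsCell U Q e c) : g.vol U < ⊤ := by
  have h1 := lintegral_cell_le g h (f := fun _ => 1) aemeasurable_const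
  simp only [lintegral_const, one_mul, Measure.restrict_apply MeasurableSet.univ,
    Set.univ_inter] at h1
  exact h1.trans_lt (ENNReal.mul_lt_top ENNReal.ofReal_lt_top h.isBounded.measure_lt_top)

theorem vol_cell_pos {U : Set M} {Q : Set (EuclideanSpace ℝ (Fin n))} {c : ℝ}
    (h : g.IsCell U Q e c) : 0 < g.vol U := by
  have h1 := le_lintegral_cell g h (f := fun _ => 1) aemeasurable_const
  simp only [lintegral_const, one_mul, Measure.restrict_apply MeasurableSet.univ,
    Set.univ_inter] at h1
  by_contra h0
  have h0' : g.vol U = 0 := by simpa using h0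
  rw [h0', mul_zero] at h1
  exact absurd (h.isOpen_image.measure_pos volume h.nonempty) (by simpa using h1)

/-- Used to compare the constants of two overlapping sets: an overlap must carry volume. -/
theorem vol_pos_of_isOpen {V : Set M} (hV : IsOpen V) (hne : V.Nonempty) : 0 < g.vol V := by
  obtain ⟨x, hx⟩ := hne
  obtain ⟨U, Q, e, c, _, hUV, h⟩ := exists_isCell g x hV hx
  exact (vol_cell_pos g h).trans_le (measure_mono hUV)

/-- A compact manifold is covered by finitely many cells. -/
theorem exists_finite_cells [CompactSpace M] : ∃ t : Finset M, ∃ U : M → Set M,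
    (∀ x, ∃ Q e c, g.IsCell (U x) Q e c) ∧ ⋃ x ∈ t, U x = Set.univ := by
  choose U Q e c hx _ hc using fun x : M => exists_isCell g x isOpen_univ (Set.mem_univ x)
  obtain ⟨t, ht⟩ := CompactSpace.elim_nhds_subcover U
    fun x => (hc x).isOpen.mem_nhds (hx x)
  exact ⟨t, U, fun x => ⟨_, _, _, hc x⟩, ht⟩

instance isFiniteMeasure_vol [CompactSpace M] : IsFiniteMeasure g.vol := by
  obtain ⟨t, U, hU, ht⟩ := exists_finite_cells g
  refine ⟨?_⟩
  rw [← ht]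
  refine (measure_biUnion_finset_le _ _).trans_lt (ENNReal.sum_lt_top.2 fun x _ => ?_)
  obtain ⟨Q, e, c, h⟩ := hU x
  exact vol_cell_lt_top g h

theorem ae_vol_of_chart [CompactSpace M] {P : M → Prop}
    (h : ∀ e ∈ charts n M, ∀ c, g.GramBounded e c →
      ∀ᵐ y ∂(volume.restrict (chartImage e)), P (chartInv e y)) : ∀ᵐ x ∂g.vol, P x := by
  obtain ⟨t, U, hU, ht⟩ := exists_finite_cells g
  rw [← Measure.restrict_univ (μ := g.vol), ← ht,
    ae_restrict_biUnion_finset_iff]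
  intro x _
  obtain ⟨Q, e, c, hc⟩ := hU x
  exact ae_mono (Measure.restrict_mono hc.subset_source le_rfl)
    (ae_vol_of_ae_chart g hc.mem_charts (h e hc.mem_charts c hc.bounded))

theorem aemeasurable_vol_of_forall_chart [CompactSpace M] {β : Type*} [MeasurableSpace β] {f : M → β}
    (h : ∀ e ∈ charts n M, ∀ c, g.GramBounded e c →
      AEMeasurable (fun y => f (chartInv e y)) (volume.restrict (chartImage e))) :
    AEMeasurable f g.vol := by
  obtain ⟨t, U, hU, ht⟩ := exists_finite_cells g
  have ht' : ⋃ x : t, U x = Set.univ := by rw [← ht, Set.iUnion_subtype]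
  rw [← Measure.restrict_univ (μ := g.vol), ← ht']
  refine AEMeasurable.iUnion fun x => ?_
  obtain ⟨Q, e, c, hc⟩ := hU x
  exact (aemeasurable_vol_of_chart g hc.mem_charts (h e hc.mem_charts c hc.bounded)).mono_measure
    (Measure.restrict_mono hc.subset_source le_rfl)

end Cells

/-! ### Energy densities of covector fields in charts. -/

section Energy

open Matrix

variable {n : ℕ} [NeZero n] {M : Type*} [TopologicalSpace M]
  [ChartedSpace (EuclideanHalfSpace n) M]
  {e e' : OpenPartialHomeomorph M (EuclideanHalfSpace n)} {y : EuclideanSpace ℝ (Fin n)}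
  (g : RoughMetric n M)

/-- The inverse Gram matrix satisfies the same bounds as the Gram matrix, and these are applied to
real and imaginary parts. The exceptional null set does not depend on `α`. -/
theorem sum_norm_sq_le_coInner {c : ℝ} (he : e ∈ charts n M) (hc : g.GramBounded e c) :
    ∀ᵐ y ∂(volume.restrict (chartImage e)), ∀ α : CovectorField n M,
      ∑ i, ‖α.components e y i‖ ^ 2 ≤
          c * (g.coInner (chartInv e y) (α (chartInv e y)) (α (chartInv e y))).re ∧
      (g.coInner (chartInv e y) (α (chartInv e y)) (α (chartInv e y))).re ≤
          c * ∑ i, ‖α.components e y i‖ ^ 2 := by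
  have hc0 : 0 < c := by linarith [hc.1]
  filter_upwards [hc.2, ae_restrict_mem measurableSet_chartImage] with y hy hyi α
  have hb := dotProduct_inv_mulVec_bounds (isSymm_chartGram g) hc0 hy
  rw [coInner_chart g he hyi, herm_self_re]
  set a := α.components e y
  have hs : ∑ i, ‖a i‖ ^ 2 = (fun i => (a i).re) ⬝ᵥ (fun i => (a i).re) +
      (fun i => (a i).im) ⬝ᵥ (fun i => (a i).im) := by
    simp only [dotProduct, ← Finset.sum_add_distrib]
    refine Finset.sum_congr rfl fun i _ => ?_
    rw [← Complex.normSq_eq_norm_sq, Complex.normSq_apply]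
  obtain ⟨h1, h2⟩ := hb fun i => (a i).re
  obtain ⟨h3, h4⟩ := hb fun i => (a i).im
  rw [hs]
  refine ⟨?_, by linarith⟩
  rw [← inv_mul_le_iff₀ hc0]
  linarith

theorem uniqueDiffOn_chartImage : UniqueDiffOn ℝ (chartImage e) := by
  rw [chartImage, e.extend_target]
  exact (𝓡∂ n).uniqueDiffOn_preimage e.open_target

variable {φ : M → ℂ}

theorem contDiffOn_comp_chartInv (he : e ∈ charts n M) (hφ : φ ∈ smoothFunctions n M) :
    ContDiffOn ℝ ∞ (φ ∘ chartInv e) (chartImage e) := by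
  have h1 := contMDiffOn_extend_symm he
  rw [← e.extend_target'] at h1
  exact contMDiffOn_iff_contDiffOn.1 (ContMDiff.comp_contMDiffOn hφ h1)

theorem mdifferentiableAt_of_smooth (hφ : φ ∈ smoothFunctions n M) (x : M) :
    MDifferentiableAt (𝓡∂ n) 𝓘(ℝ, ℂ) φ x :=
  (hφ x).mdifferentiableAt (by simp)

theorem components_differential (he : e ∈ charts n M) (hφ : φ ∈ smoothFunctions n M)
    (hy : y ∈ chartImage e) (i : Fin n) :
    CovectorField.components (differential φ) e y i =
      fderivWithin ℝ (φ ∘ chartInv e) (chartImage e) y (EuclideanSpace.single i 1) := by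
  have h := hasFDerivWithinAt_comp_chartInv he hy (mdifferentiableAt_of_smooth hφ _)
  rw [(h.mono chartImage_subset_range).fderivWithin (uniqueDiffOn_chartImage y hy)]
  rfl

theorem components_differential_of_mem_interior (he : e ∈ charts n M)
    (hφ : φ ∈ smoothFunctions n M) (hy : chartImage e ∈ 𝓝 y) (i : Fin n) :
    CovectorField.components (differential φ) e y i =
      fderiv ℝ (φ ∘ chartInv e) y (EuclideanSpace.single i 1) := by
  rw [components_differential he hφ (mem_of_mem_nhds hy), fderivWithin_of_mem_nhds hy]

theorem continuousOn_components_differential (he : e ∈ charts n M)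
    (hφ : φ ∈ smoothFunctions n M) (i : Fin n) :
    ContinuousOn (fun y => CovectorField.components (differential φ) e y i) (chartImage e) := by
  have h1 := (contDiffOn_comp_chartInv he hφ).continuousOn_fderivWithin uniqueDiffOn_chartImage
    (by simp)
  exact (h1.clm_apply continuousOn_const).congr fun y hy => components_differential he hφ hy i

theorem isMeasurable_differential (hφ : φ ∈ smoothFunctions n M) :
    CovectorField.IsMeasurable (differential (n := n) φ) := fun _ he i =>
  (continuousOn_components_differential he hφ i).aemeasurable measurableSet_chartImage

variable [MeasurableSpace M] [BorelSpace M]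

/-- The squared `L²` norm of a covector field. -/
def RoughMetric.energy (α : CovectorField n M) : ℝ≥0∞ :=
  ∫⁻ x, ENNReal.ofReal (g.coInner x (α x) (α x)).re ∂g.vol

variable [CompactSpace M]

theorem aemeasurable_coInner {α η : CovectorField n M} (hα : α.IsMeasurable)
    (hη : η.IsMeasurable) : AEMeasurable (fun x => g.coInner x (α x) (η x)) g.vol := by
  refine aemeasurable_vol_of_forall_chart g fun e he c hc => ?_
  have h1 : AEMeasurable (fun y => herm (g.chartGram e y)⁻¹ (α.components e y) (η.components e y))
      (volume.restrict (chartImage e)) := by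
    refine Finset.aemeasurable_fun_sum _ fun i _ => Finset.aemeasurable_fun_sum _ fun j _ => ?_
    refine AEMeasurable.mul ?_ ((hα e he i).mul ?_)
    · exact Complex.measurable_ofReal.comp_aemeasurable (aemeasurable_chartGram_inv g he i j)
    · exact (Complex.continuous_conj.measurable).comp_aemeasurable (hη e he j)
  refine h1.congr ?_
  filter_upwards [ae_restrict_mem measurableSet_chartImage] with y hy
  rw [coInner_chart g he hy]

theorem aemeasurable_energyDensity {α : CovectorField n M} (hα : α.IsMeasurable) :
    AEMeasurable (fun x => ENNReal.ofReal (g.coInner x (α x) (α x)).re) g.vol :=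
  (Complex.measurable_re.comp_aemeasurable (aemeasurable_coInner g hα hα)).ennreal_ofReal

theorem ae_posSemidef : ∀ᵐ x ∂g.vol, (stdGram (g.modelForm x))⁻¹.PosSemidef :=
  ae_vol_of_chart g fun _ he _ hc => posSemidef_stdGram_inv g he hc

variable {U : Set M} {Q : Set (EuclideanSpace ℝ (Fin n))} {c : ℝ}

theorem cell_image_mem_nhds (h : g.IsCell U Q e c) (hy : y ∈ Q) : chartImage e ∈ 𝓝 y :=
  mem_of_superset (h.isOpen_image.mem_nhds hy) (subset_closure.trans h.closure_subset)

/-- The operator norm is at most the Hilbert-Schmidt norm, which is comparable to the norm defined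
by `g`. -/
theorem enorm_fderiv_sq_le (h : g.IsCell U Q e c) :
    ∀ᵐ y ∂(volume.restrict Q), ∀ φ ∈ smoothFunctions n M,
      ‖fderiv ℝ (φ ∘ chartInv e) y‖ₑ ^ (2 : ℝ) ≤
        ENNReal.ofReal c * ENNReal.ofReal (g.coInner (chartInv e y)
          (differential φ (chartInv e y)) (differential φ (chartInv e y))).re := by
  have hc0 : 0 < c := by linarith [h.bounded.1]
  filter_upwards [ae_mono (cell_ae g h) (sum_norm_sq_le_coInner g h.mem_charts h.bounded),
    ae_restrict_mem h.isOpen_image.measurableSet] with y hy hyQ φ hφ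
  have h1 := (hy (differential φ)).1
  have h2 : ‖fderiv ℝ (φ ∘ chartInv e) y‖ ^ 2 ≤
      ∑ i, ‖CovectorField.components (differential φ) e y i‖ ^ 2 := by
    simp_rw [components_differential_of_mem_interior h.mem_charts hφ (cell_image_mem_nhds g h hyQ)]
    set L := fderiv ℝ (φ ∘ chartInv e) y
    have h3 : ‖L‖ ≤ √(∑ i, ‖L (EuclideanSpace.single i 1)‖ ^ 2) := by
      refine L.opNorm_le_bound (Real.sqrt_nonneg _) fun v => ?_
      conv_lhs => rw [euclidean_eq_sum_single v]
      rw [map_sum]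
      calc ‖∑ i, L (v i • EuclideanSpace.single i 1)‖
          ≤ ∑ i, ‖L (EuclideanSpace.single i 1)‖ * ‖v i‖ := by
            refine (norm_sum_le _ _).trans (le_of_eq ?_)
            refine Finset.sum_congr rfl fun i _ => ?_
            rw [map_smul, norm_smul, mul_comm]
        _ ≤ √(∑ i, ‖L (EuclideanSpace.single i 1)‖ ^ 2) * √(∑ i, ‖v i‖ ^ 2) :=
            Real.sum_mul_le_sqrt_mul_sqrt _ _ _
        _ = _ := by rw [EuclideanSpace.norm_eq v]
    calc ‖L‖ ^ 2 ≤ √(∑ i, ‖L (EuclideanSpace.single i 1)‖ ^ 2) ^ 2 := by gcongr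
      _ = _ := Real.sq_sqrt (Finset.sum_nonneg fun i _ => by positivity)
  rw [← ENNReal.ofReal_mul hc0.le, ← ofReal_norm,
    ENNReal.ofReal_rpow_of_nonneg (norm_nonneg _) (by norm_num)]
  apply ENNReal.ofReal_le_ofReal
  rw [Real.rpow_two]
  exact h2.trans h1

/-- On a cell the `L²` norm of the coordinate gradient is controlled by the energy. -/
theorem lintegral_fderiv_sq_le (h : g.IsCell U Q e c) (hφ : φ ∈ smoothFunctions n M) :
    ∫⁻ y in Q, ‖fderiv ℝ (φ ∘ chartInv e) y‖ₑ ^ (2 : ℝ) ≤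
      ENNReal.ofReal c * ENNReal.ofReal √(c ^ n) * g.energy (differential φ) := by
  have hm := aemeasurable_energyDensity g (isMeasurable_differential hφ)
  calc _ ≤ ∫⁻ y in Q, ENNReal.ofReal c * ENNReal.ofReal (g.coInner (chartInv e y)
          (differential φ (chartInv e y)) (differential φ (chartInv e y))).re :=
        lintegral_mono_ae (by filter_upwards [enorm_fderiv_sq_le g h] with y hy using hy φ hφ)
    _ = ENNReal.ofReal c * ∫⁻ y in Q, ENNReal.ofReal (g.coInner (chartInv e y)
          (differential φ (chartInv e y)) (differential φ (chartInv e y))).re :=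
        lintegral_const_mul' _ _ ENNReal.ofReal_ne_top
    _ ≤ ENNReal.ofReal c * (ENNReal.ofReal √(c ^ n) * g.energy (differential φ)) := by
        gcongr
        refine (le_lintegral_cell g h hm).trans ?_
        gcongr
        exact lintegral_mono' Measure.restrict_le_self le_rfl
    _ = _ := by ring

/-- The components of `dφ` extend continuously to the compact set `closure Q`, up to the boundary of
`M`, and are therefore bounded. -/
theorem lintegral_energyDensity_cell_lt_top (h : g.IsCell U Q e c)
    (hφ : φ ∈ smoothFunctions n M) :
    ∫⁻ x in U, ENNReal.ofReal (g.coInner x (differential φ x) (differential φ x)).re ∂g.vol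
      < ⊤ := by
  have hm := aemeasurable_energyDensity g (isMeasurable_differential hφ)
  refine (lintegral_cell_le g h hm).trans_lt (ENNReal.mul_lt_top ENNReal.ofReal_lt_top ?_)
  have hcpt : IsCompact (closure Q) := h.isBounded.isCompact_closure
  have hcont : ContinuousOn (fun y => c * ∑ i,
      ‖CovectorField.components (differential φ) e y i‖ ^ 2) (closure Q) := by
    refine continuousOn_const.mul (continuousOn_finsetSum _ fun i _ => ?_)
    exact ((continuousOn_components_differential h.mem_charts hφ i).mono
      h.closure_subset).norm.pow 2
  obtain ⟨B, hB⟩ := hcpt.bddAbove_image hcont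
  calc _ ≤ ∫⁻ _ in Q, ENNReal.ofReal B := by
        refine lintegral_mono_ae ?_
        filter_upwards [ae_mono (cell_ae g h) (sum_norm_sq_le_coInner g h.mem_charts h.bounded),
          ae_restrict_mem h.isOpen_image.measurableSet] with y hy hyQ
        exact ENNReal.ofReal_le_ofReal ((hy _).2.trans
          (hB (Set.mem_image_of_mem _ (subset_closure hyQ))))
    _ < ⊤ := by
        rw [setLIntegral_const]
        exact ENNReal.mul_lt_top ENNReal.ofReal_lt_top h.isBounded.measure_lt_top

theorem energy_differential_lt_top (hφ : φ ∈ smoothFunctions n M) :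
    g.energy (differential φ) < ⊤ := by
  obtain ⟨t, U, hU, ht⟩ := exists_finite_cells g
  have ht' : ⋃ x : t, U x = Set.univ := by rw [← ht, Set.iUnion_subtype]
  rw [RoughMetric.energy, ← setLIntegral_univ, ← ht']
  refine (lintegral_iUnion_le _ _).trans_lt ?_
  rw [tsum_fintype]
  refine ENNReal.sum_lt_top.2 fun x _ => ?_
  obtain ⟨Q, e, c, h⟩ := hU x
  exact lintegral_energyDensity_cell_lt_top g h hφ

end Energy

/-! ### The dual Poincaré-Sobolev inequality, from cells to the whole manifold. -/

theorem lintegral_le_rpow_lintegral {X : Type*} [MeasurableSpace X] (μ : Measure X) {b : ℝ}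
    (hb1 : 1 < b) {ρ : X → ℝ≥0∞} (hρ : AEMeasurable ρ μ) :
    ∫⁻ x, ρ x ∂μ ≤ (∫⁻ x, ρ x ^ b ∂μ) ^ (1 / b) * μ Set.univ ^ (1 - 1 / b) := by
  have hc : b.HolderConjugate (b / (b - 1)) := Real.HolderConjugate.conjExponent hb1
  have h := ENNReal.lintegral_mul_le_Lp_mul_Lq μ hc hρ (g := fun _ => 1) aemeasurable_const
  have h2 : 1 / (b / (b - 1)) = 1 - 1 / b := by
    have : b ≠ 0 := by positivity
    rw [one_div_div]; field_simp
  simpa [h2] using h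

section Poincare

variable {n : ℕ} [NeZero n] {M : Type*} [TopologicalSpace M]
  [ChartedSpace (EuclideanHalfSpace n) M] [MeasurableSpace M] [BorelSpace M] [CompactSpace M]
  {e : OpenPartialHomeomorph M (EuclideanHalfSpace n)}
  (g : RoughMetric n M) {U V : Set M} {Q : Set (EuclideanSpace ℝ (Fin n))} {c b : ℝ}

/-- A Poincaré-Sobolev inequality on a subset of `M`, with the energy over all of `M`. -/
def RoughMetric.HasPoincare (b : ℝ) (U : Set M) : Prop :=
  ∃ C : ℝ≥0∞, C ≠ ⊤ ∧ ∀ φ ∈ smoothFunctions n M, ∃ m : ℂ, ∀ ρ : M → ℝ≥0∞, Measurable ρ →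
    ∫⁻ x in U, ρ x * ‖φ x - m‖ₑ ∂g.vol ≤
      C * ((∫⁻ x, ρ x ^ b ∂g.vol) ^ (1 / b) * g.energy (differential φ) ^ (1 / 2 : ℝ))

theorem continuous_of_smooth {φ : M → ℂ} (hφ : φ ∈ smoothFunctions n M) : Continuous φ :=
  ContMDiff.continuous hφ

/-- The constant `m` is the Lebesgue mean of `φ` over `Q` in coordinates, so that `f y - m` is the
average of `f y - f z` over `z` and the double-integral inequality on `Q` applies. -/
theorem hasPoincare_cell (h : g.IsCell U Q e c) (hb1 : 1 < b) (hb2 : b ≤ 2)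
    (hb : n * (1 / b - 1 / 2) < 1) : g.HasPoincare b U := by
  have hb0 : 0 < b := by linarith
  obtain ⟨C, hC, hP⟩ := exists_lintegral_sub_le_of_convex (volume : Measure (EuclideanSpace ℝ (Fin n)))
    h.isOpen_image h.convex h.isBounded hb1 hb2 (by simpa using hb)
  have hQ0 : volume Q ≠ 0 := (h.isOpen_image.measure_pos volume h.nonempty).ne'
  have hQt : volume Q ≠ ⊤ := h.isBounded.measure_lt_top.ne
  set K := ENNReal.ofReal √(c ^ n) with hK
  have hKt : K ≠ ⊤ := ENNReal.ofReal_ne_top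
  set K' := ENNReal.ofReal c * K with hK'
  have hK't : K' ≠ ⊤ := ENNReal.mul_ne_top ENNReal.ofReal_ne_top hKt
  refine ⟨K * ((volume Q)⁻¹ * (C * (K ^ (1 / b) * K' ^ (1 / 2 : ℝ)))), ?_, fun φ hφ => ?_⟩
  · refine ENNReal.mul_ne_top hKt (ENNReal.mul_ne_top (ENNReal.inv_ne_top.2 hQ0)
      (ENNReal.mul_ne_top hC (ENNReal.mul_ne_top ?_ ?_)))
    · exact ENNReal.rpow_ne_top_of_nonneg (by positivity) hKt
    · exact ENNReal.rpow_ne_top_of_nonneg (by norm_num) hK't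
  set f : EuclideanSpace ℝ (Fin n) → ℂ := φ ∘ chartInv e with hf
  have hQch : Q ⊆ chartImage e := subset_closure.trans h.closure_subset
  have hfc : ContDiffOn ℝ 1 f Q :=
    ((contDiffOn_comp_chartInv h.mem_charts hφ).mono hQch).of_le (by exact_mod_cast le_top)
  have hfm : AEStronglyMeasurable f (volume.restrict Q) :=
    hfc.continuousOn.aestronglyMeasurable h.isOpen_image.measurableSet
  have hφc := continuous_of_smooth hφ
  obtain ⟨B, hB⟩ := (isCompact_range hφc.norm).bddAbove
  have hfB : ∀ y, ‖f y‖ ≤ B := fun y => hB ⟨chartInv e y, rfl⟩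
  have : IsFiniteMeasure (volume.restrict Q) := ⟨by simpa using h.isBounded.measure_lt_top⟩
  have hfi : Integrable f (volume.restrict Q) := Integrable.of_bound hfm B (ae_of_all _ hfB)
  set m : ℂ := ((volume Q).toReal)⁻¹ • ∫ y in Q, f y with hm
  refine ⟨m, fun ρ hρ => ?_⟩
  have hQr : (volume Q).toReal ≠ 0 := (ENNReal.toReal_pos hQ0 hQt).ne'
  have hpt : ∀ y, ‖f y - m‖ₑ ≤ (volume Q)⁻¹ * ∫⁻ z in Q, ‖f y - f z‖ₑ := by
    intro y
    have h1 : f y - m = ((volume Q).toReal)⁻¹ • ∫ z in Q, (f y - f z) := by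
      rw [integral_sub (integrable_const _) hfi, smul_sub, ← hm]
      congr 1
      rw [setIntegral_const, smul_smul, Measure.real, inv_mul_cancel₀ hQr, one_smul]
    rw [h1, enorm_smul]
    have h2 : ‖((volume Q).toReal)⁻¹‖ₑ = (volume Q)⁻¹ := by
      rw [Real.enorm_eq_ofReal (by positivity), ENNReal.ofReal_inv_of_pos
        (ENNReal.toReal_pos hQ0 hQt), ENNReal.ofReal_toReal hQt]
    rw [h2]
    gcongr
    exact enorm_integral_le_lintegral_enorm _
  have hρm : AEMeasurable (fun y => ρ (chartInv e y)) (volume.restrict Q) :=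
    hρ.comp_aemeasurable (aemeasurable_chartInv.mono_measure (cell_ae g h))
  -- The Euclidean inequality asks for a measurable weight, while `ρ ∘ chartInv e` is only almost
  -- everywhere measurable on `Q`.
  set r := hρm.mk _ with hr
  have hrm : Measurable r := hρm.measurable_mk
  have hrae : ∀ᵐ y ∂(volume.restrict Q), ρ (chartInv e y) = r y := hρm.ae_eq_mk
  have e1 : ∫⁻ x in U, ρ x * ‖φ x - m‖ₑ ∂g.vol ≤ K * ∫⁻ y in Q, r y * ‖f y - m‖ₑ := by
    refine (lintegral_cell_le g h ?_).trans (le_of_eq ?_)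
    · exact (hρ.mul (hφc.measurable.sub_const m).enorm).aemeasurable
    · congr 1
      refine lintegral_congr_ae ?_
      filter_upwards [hrae] with y hy
      rw [hy]; rfl
  have e2 : ∫⁻ y in Q, r y * ‖f y - m‖ₑ ≤
      (volume Q)⁻¹ * ∫⁻ y in Q, ∫⁻ z in Q, r y * ‖f y - f z‖ₑ := by
    rw [← lintegral_const_mul' _ _ (ENNReal.inv_ne_top.2 hQ0)]
    refine lintegral_mono fun y => ?_
    calc r y * ‖f y - m‖ₑ ≤ r y * ((volume Q)⁻¹ * ∫⁻ z in Q, ‖f y - f z‖ₑ) := by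
          gcongr; exact hpt y
      _ = (volume Q)⁻¹ * (r y * ∫⁻ z in Q, ‖f y - f z‖ₑ) := by ring
      _ = _ := by
        rw [lintegral_const_mul'' _ (hfm.aemeasurable.const_sub (f y)).enorm]
  have e3 : ∫⁻ y in Q, r y ^ b ≤ K * ∫⁻ x, ρ x ^ b ∂g.vol := by
    calc ∫⁻ y in Q, r y ^ b = ∫⁻ y in Q, ρ (chartInv e y) ^ b := by
          refine lintegral_congr_ae ?_
          filter_upwards [hrae] with y hy
          rw [hy]
      _ ≤ K * ∫⁻ x in U, ρ x ^ b ∂g.vol := le_lintegral_cell g h (hρ.pow_const b).aemeasurable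
      _ ≤ _ := by gcongr; exact Measure.restrict_le_self
  have e4 := lintegral_fderiv_sq_le g h hφ
  calc _ ≤ K * ((volume Q)⁻¹ * (C * ((K * ∫⁻ x, ρ x ^ b ∂g.vol) ^ (1 / b) *
        (K' * g.energy (differential φ)) ^ (1 / 2 : ℝ)))) := by
        refine e1.trans ?_
        gcongr
        refine e2.trans ?_
        gcongr
        refine (hP f hfc r hrm).trans ?_
        gcongr
    _ = _ := by
        rw [ENNReal.mul_rpow_of_nonneg _ _ (by positivity),
          ENNReal.mul_rpow_of_nonneg _ _ (by norm_num)]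
        ring

/-- The weight `1` on the overlap, which has positive volume, bounds `|m₂ - m₁|` by the energy.
Hence `m₁` also serves on `V`, at the cost of `∫ ρ |m₂ - m₁|`, which Hölder controls. Measuring the
energy over all of `M` avoids bookkeeping of domains. -/
theorem HasPoincare.union (hU : g.HasPoincare b U) (hV : g.HasPoincare b V) (hUo : IsOpen U)
    (hVo : IsOpen V) (hne : (U ∩ V).Nonempty) (hb1 : 1 < b) : g.HasPoincare b (U ∪ V) := by
  have hb0 : 0 < b := by linarith
  have he0 : 0 ≤ 1 - 1 / b := by
    have : 1 / b ≤ 1 := by rw [div_le_one hb0]; exact hb1.le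
    linarith
  obtain ⟨C₁, hC₁, h₁⟩ := hU
  obtain ⟨C₂, hC₂, h₂⟩ := hV
  set v := g.vol (U ∩ V) with hv
  have hv0 : v ≠ 0 := (vol_pos_of_isOpen g (hUo.inter hVo) hne).ne'
  have hvt : v ≠ ⊤ := measure_ne_top _ _
  set w := g.vol Set.univ with hw
  have hwt : w ≠ ⊤ := measure_ne_top _ _
  set D := v⁻¹ * ((C₁ + C₂) * w ^ (1 / b)) * w ^ (1 - 1 / b) with hD
  have hDt : D ≠ ⊤ := by
    refine ENNReal.mul_ne_top (ENNReal.mul_ne_top (ENNReal.inv_ne_top.2 hv0)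
      (ENNReal.mul_ne_top (ENNReal.add_ne_top.2 ⟨hC₁, hC₂⟩) ?_)) ?_
    · exact ENNReal.rpow_ne_top_of_nonneg (by positivity) hwt
    · exact ENNReal.rpow_ne_top_of_nonneg he0 hwt
  refine ⟨C₁ + (C₂ + D), ENNReal.add_ne_top.2 ⟨hC₁, ENNReal.add_ne_top.2 ⟨hC₂, hDt⟩⟩,
    fun φ hφ => ?_⟩
  obtain ⟨m₁, hm₁⟩ := h₁ φ hφ
  obtain ⟨m₂, hm₂⟩ := h₂ φ hφ
  have hφm : Measurable φ := (continuous_of_smooth hφ).measurable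
  set E := g.energy (differential φ) ^ (1 / 2 : ℝ) with hE
  have hdiff : ‖m₂ - m₁‖ₑ ≤ v⁻¹ * ((C₁ + C₂) * w ^ (1 / b)) * E := by
    have a1 : ‖m₂ - m₁‖ₑ * v ≤ (C₁ + C₂) * (w ^ (1 / b) * E) := by
      calc ‖m₂ - m₁‖ₑ * v = ∫⁻ _ in U ∩ V, ‖m₂ - m₁‖ₑ ∂g.vol := by rw [setLIntegral_const]
        _ ≤ ∫⁻ x in U ∩ V, (1 * ‖φ x - m₁‖ₑ + 1 * ‖φ x - m₂‖ₑ) ∂g.vol := by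
          refine lintegral_mono fun x => ?_
          have : m₂ - m₁ = (φ x - m₁) - (φ x - m₂) := by ring
          rw [this, one_mul, one_mul]
          exact enorm_sub_le
        _ = ∫⁻ x in U ∩ V, 1 * ‖φ x - m₁‖ₑ ∂g.vol + ∫⁻ x in U ∩ V, 1 * ‖φ x - m₂‖ₑ ∂g.vol := by
          rw [lintegral_add_left]
          exact (hφm.sub_const m₁).enorm.const_mul 1
        _ ≤ ∫⁻ x in U, 1 * ‖φ x - m₁‖ₑ ∂g.vol + ∫⁻ x in V, 1 * ‖φ x - m₂‖ₑ ∂g.vol := by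
          gcongr
          · exact Set.inter_subset_left
          · exact Set.inter_subset_right
        _ ≤ C₁ * (w ^ (1 / b) * E) + C₂ * (w ^ (1 / b) * E) := by
          have b1 := hm₁ (fun _ => 1) measurable_const
          have b2 := hm₂ (fun _ => 1) measurable_const
          simp only [ENNReal.one_rpow, lintegral_const, one_mul] at b1 b2
          simp only [one_mul]
          exact add_le_add b1 b2
        _ = _ := by ring
    calc ‖m₂ - m₁‖ₑ = v⁻¹ * (‖m₂ - m₁‖ₑ * v) := by
          rw [mul_comm (‖m₂ - m₁‖ₑ), ← mul_assoc, ENNReal.inv_mul_cancel hv0 hvt, one_mul]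
      _ ≤ v⁻¹ * ((C₁ + C₂) * (w ^ (1 / b) * E)) := by gcongr
      _ = _ := by ring
  refine ⟨m₁, fun ρ hρ => ?_⟩
  set R := (∫⁻ x, ρ x ^ b ∂g.vol) ^ (1 / b) with hR
  have hVm : ∫⁻ x in V, ρ x * ‖φ x - m₁‖ₑ ∂g.vol ≤ (C₂ + D) * (R * E) := by
    calc _ ≤ ∫⁻ x in V, (ρ x * ‖φ x - m₂‖ₑ + ρ x * ‖m₂ - m₁‖ₑ) ∂g.vol := by
          refine lintegral_mono fun x => ?_
          have : φ x - m₁ = (φ x - m₂) + (m₂ - m₁) := by ring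
          rw [← mul_add, this]
          gcongr
          exact enorm_add_le _ _
      _ = ∫⁻ x in V, ρ x * ‖φ x - m₂‖ₑ ∂g.vol + (∫⁻ x in V, ρ x ∂g.vol) * ‖m₂ - m₁‖ₑ := by
          rw [lintegral_add_left (f := fun x => ρ x * ‖φ x - m₂‖ₑ)
            (hρ.mul (hφm.sub_const m₂).enorm), lintegral_mul_const _ hρ]
      _ ≤ C₂ * (R * E) + (R * w ^ (1 - 1 / b)) * (v⁻¹ * ((C₁ + C₂) * w ^ (1 / b)) * E) := by
          gcongr
          · exact hm₂ ρ hρ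
          · exact (lintegral_mono' Measure.restrict_le_self le_rfl).trans
              (lintegral_le_rpow_lintegral g.vol hb1 hρ.aemeasurable)
      _ = _ := by rw [hD]; ring
  calc _ ≤ C₁ * (R * E) + (C₂ + D) * (R * E) :=
        (lintegral_union_le _ _ _).trans (add_le_add (hm₁ ρ hρ) hVm)
    _ = _ := by ring

/-- The points that share with `x₀` an open set having the inequality form a nonempty clopen set,
hence all of `M`. Finitely many of these sets cover `M`. -/
theorem hasPoincare_univ [ConnectedSpace M] (hb1 : 1 < b) (hb2 : b ≤ 2)
    (hb : n * (1 / b - 1 / 2) < 1) : g.HasPoincare b (Set.univ : Set M) := by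
  obtain ⟨x₀⟩ := (inferInstance : Nonempty M)
  have hcell : ∀ x : M, ∃ V, IsOpen V ∧ x ∈ V ∧ g.HasPoincare b V := fun x => by
    obtain ⟨V, Q, e, c, hx, _, h⟩ := exists_isCell g x isOpen_univ (Set.mem_univ x)
    exact ⟨V, h.isOpen, hx, hasPoincare_cell g h hb1 hb2 hb⟩
  set S : Set M := {x | ∃ U, IsOpen U ∧ x₀ ∈ U ∧ x ∈ U ∧ g.HasPoincare b U} with hS
  have hSo : IsOpen S := isOpen_iff_mem_nhds.2 fun x ⟨U, hU, h0, hx, hP⟩ =>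
    mem_of_superset (hU.mem_nhds hx) fun y hy => ⟨U, hU, h0, hy, hP⟩
  have hSc : IsClosed S := isClosed_of_closure_subset fun x hx => by
    obtain ⟨V, hV, hxV, hPV⟩ := hcell x
    obtain ⟨y, hyV, U, hU, h0, hyU, hPU⟩ := mem_closure_iff.1 hx V hV hxV
    exact ⟨U ∪ V, hU.union hV, Or.inl h0, Or.inr hxV,
      HasPoincare.union g hPU hPV hU hV ⟨y, hyU, hyV⟩ hb1⟩
  have hSu : S = Set.univ := IsClopen.eq_univ ⟨hSc, hSo⟩ (by
    obtain ⟨V, hV, hxV, hPV⟩ := hcell x₀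
    exact ⟨x₀, V, hV, hxV, hxV, hPV⟩)
  have hall : ∀ x : M, ∃ U, IsOpen U ∧ x₀ ∈ U ∧ x ∈ U ∧ g.HasPoincare b U := fun x => by
    have : x ∈ S := hSu ▸ Set.mem_univ x
    exact this
  choose U hUo h0 hx hP using hall
  obtain ⟨t, ht⟩ := CompactSpace.elim_nhds_subcover U fun x => (hUo x).mem_nhds (hx x)
  -- All the sets contain `x₀`, so the overlap needed for each union is automatic; `U x₀` starts the
  -- induction at the empty cover.
  have hfin : ∀ t : Finset M, g.HasPoincare b (U x₀ ∪ ⋃ x ∈ t, U x) := by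
    classical
    intro t
    induction t using Finset.induction_on with
    | empty => simpa using hP x₀
    | insert a s _ ih =>
      have : U x₀ ∪ ⋃ x ∈ insert a s, U x = (U x₀ ∪ ⋃ x ∈ s, U x) ∪ U a := by
        rw [Finset.set_biUnion_insert, Set.union_comm (U a), Set.union_assoc]
      rw [this]
      exact HasPoincare.union g ih (hP a) ((hUo x₀).union
        (isOpen_biUnion fun x _ => hUo x)) (hUo a) ⟨x₀, Or.inl (h0 x₀), h0 a⟩ hb1
  have := hfin t
  rwa [ht, Set.top_eq_univ, Set.union_univ] at this

end Poincare

/-! ### Algebra of the energy and of limits in the graph of the differential. -/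

section EnergyCalculus

variable {n : ℕ} [NeZero n] {M : Type*} [TopologicalSpace M]
  [ChartedSpace (EuclideanHalfSpace n) M] (g : RoughMetric n M)

theorem coInner_add_left (x : M) (a b d : TangentSpace (𝓡∂ n) x →L[ℝ] ℂ) :
    g.coInner x (a + b) d = g.coInner x a d + g.coInner x b d :=
  herm_add_left _ _ _ _

theorem coInner_smul_left (x : M) (r : ℂ) (a d : TangentSpace (𝓡∂ n) x →L[ℝ] ℂ) :
    g.coInner x (r • a) d = r * g.coInner x a d :=
  herm_smul_left _ _ _ _

theorem isSymm_stdGram_inv (x : M) : (stdGram (g.modelForm x))⁻¹.IsSymm :=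
  (isSymm_stdGram g x).inv

theorem conj_coInner (x : M) (a b : TangentSpace (𝓡∂ n) x →L[ℝ] ℂ) :
    conj (g.coInner x a b) = g.coInner x b a :=
  herm_conj (isSymm_stdGram_inv g x) _ _

theorem coInner_self_smul (x : M) (r : ℂ) (a : TangentSpace (𝓡∂ n) x →L[ℝ] ℂ) :
    (g.coInner x (r • a) (r • a)).re = ‖r‖ ^ 2 * (g.coInner x a a).re := by
  have h : g.coInner x (r • a) (r • a) = r * (conj r * g.coInner x a a) := by
    rw [coInner_smul_left, ← conj_coInner g x (r • a) a, coInner_smul_left, map_mul, conj_coInner]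
  rw [h, ← mul_assoc, Complex.mul_conj, Complex.normSq_eq_norm_sq, Complex.re_ofReal_mul]

theorem CovectorField.IsMeasurable.add {α η : CovectorField n M} (hα : α.IsMeasurable)
    (hη : η.IsMeasurable) : (α + η : CovectorField n M).IsMeasurable :=
  fun e he i => (hα e he i).add (hη e he i)

theorem CovectorField.IsMeasurable.smul {α : CovectorField n M} (hα : α.IsMeasurable) (r : ℂ) :
    (r • α : CovectorField n M).IsMeasurable :=
  fun e he i => (hα e he i).const_mul r

theorem CovectorField.IsMeasurable.sub {α η : CovectorField n M} (hα : α.IsMeasurable)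
    (hη : η.IsMeasurable) : (α - η : CovectorField n M).IsMeasurable :=
  fun e he i => (hα e he i).sub (hη e he i)

theorem covectorField_neg_one_smul (α : CovectorField n M) : (-1 : ℂ) • α = -α :=
  funext fun x => ContinuousLinearMap.ext fun v => neg_one_mul (α x v)

theorem covectorField_zero_smul (α : CovectorField n M) : (0 : ℂ) • α = 0 :=
  funext fun x => ContinuousLinearMap.ext fun v => zero_mul (α x v)

theorem smooth_add {φ ψ : M → ℂ} (hφ : φ ∈ smoothFunctions n M) (hψ : ψ ∈ smoothFunctions n M) :
    φ + ψ ∈ smoothFunctions n M := ContMDiff.add hφ hψ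

theorem smooth_smul {φ : M → ℂ} (hφ : φ ∈ smoothFunctions n M) (r : ℂ) :
    r • φ ∈ smoothFunctions n M := by
  have h : ContMDiff 𝓘(ℝ, ℂ) 𝓘(ℝ, ℂ) ∞ (fun z : ℂ => r • z) :=
    (contDiff_const_smul r).contMDiff
  exact ContMDiff.comp (g := fun z : ℂ => r • z) (f := φ) h hφ

theorem differential_add {φ ψ : M → ℂ} (hφ : φ ∈ smoothFunctions n M)
    (hψ : ψ ∈ smoothFunctions n M) :
    differential (n := n) (φ + ψ) = differential φ + differential ψ := by
  funext x
  exact mfderiv_add (mdifferentiableAt_of_smooth hφ x) (mdifferentiableAt_of_smooth hψ x)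

theorem differential_smul {φ : M → ℂ} (hφ : φ ∈ smoothFunctions n M) (r : ℂ) :
    differential (n := n) (r • φ) = r • differential φ := by
  funext x
  have h1 := (mdifferentiableAt_of_smooth hφ x).hasMFDerivAt
  have h2 : HasMFDerivAt 𝓘(ℝ, ℂ) 𝓘(ℝ, ℂ) (fun z : ℂ => r • z) (φ x)
      (r • ContinuousLinearMap.id ℝ ℂ) :=
    ((hasFDerivAt_id (φ x)).const_smul r).hasMFDerivAt
  exact (HasMFDerivAt.comp x h2 h1).mfderiv

variable [MeasurableSpace M] [BorelSpace M] [CompactSpace M]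

theorem energy_add_le {α : CovectorField n M} (hα : α.IsMeasurable) (η : CovectorField n M) :
    g.energy (α + η) ≤ 2 * g.energy α + 2 * g.energy η := by
  have m1 := aemeasurable_energyDensity g hα
  rw [RoughMetric.energy, RoughMetric.energy, RoughMetric.energy,
    ← lintegral_const_mul' _ _ (by norm_num), ← lintegral_const_mul' _ _ (by norm_num),
    ← lintegral_add_left' (m1.const_mul 2)]
  refine lintegral_mono_ae ?_
  filter_upwards [ae_posSemidef g] with x hx
  have h := herm_add_self_le hx (fun i => α x (stdFrame x i)) (fun i => η x (stdFrame x i))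
  have h1 := herm_self_nonneg hx (fun i => α x (stdFrame x i))
  have h2 := herm_self_nonneg hx (fun i => η x (stdFrame x i))
  have key : ∀ p q r : ℝ, 0 ≤ p → 0 ≤ q → r ≤ 2 * p + 2 * q →
      ENNReal.ofReal r ≤ 2 * ENNReal.ofReal p + 2 * ENNReal.ofReal q := fun p q r hp hq hr => by
    have e2 : (2 : ℝ≥0∞) = ENNReal.ofReal 2 := by simp
    rw [e2, ← ENNReal.ofReal_mul (by norm_num), ← ENNReal.ofReal_mul (by norm_num),
      ← ENNReal.ofReal_add (by positivity) (by positivity)]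
    exact ENNReal.ofReal_le_ofReal hr
  exact key _ _ _ h1 h2 h

theorem energy_smul (α : CovectorField n M) (r : ℂ) :
    g.energy (r • α) = ENNReal.ofReal (‖r‖ ^ 2) * g.energy α := by
  rw [RoughMetric.energy, RoughMetric.energy, ← lintegral_const_mul' _ _ ENNReal.ofReal_ne_top]
  refine lintegral_congr fun x => ?_
  rw [← ENNReal.ofReal_mul (by positivity), ← coInner_self_smul]
  rfl

theorem energy_neg (α : CovectorField n M) : g.energy (-α) = g.energy α := by
  have h := energy_smul g α (-1)
  rw [covectorField_neg_one_smul] at h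
  simpa using h

theorem energy_sub_le {α : CovectorField n M} (hα : α.IsMeasurable) (η : CovectorField n M) :
    g.energy (α - η) ≤ 2 * g.energy α + 2 * g.energy η := by
  rw [sub_eq_add_neg, ← energy_neg g η]
  exact energy_add_le g hα _

theorem energy_congr {α η : CovectorField n M} (h : ∀ᵐ x ∂g.vol, α x = η x) :
    g.energy α = g.energy η := by
  refine lintegral_congr_ae ?_
  filter_upwards [h] with x hx
  rw [hx]

theorem integrable_coInner {α η : CovectorField n M} (hα : α.IsMeasurable) (hη : η.IsMeasurable)
    (hαf : g.energy α < ⊤) (hηf : g.energy η < ⊤) :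
    Integrable (fun x => g.coInner x (α x) (η x)) g.vol := by
  refine ⟨(aemeasurable_coInner g hα hη).aestronglyMeasurable, ?_⟩
  have m1 := aemeasurable_energyDensity g hα
  have h : ∫⁻ x, ‖g.coInner x (α x) (η x)‖ₑ ∂g.vol ≤ g.energy α + g.energy η := by
    rw [RoughMetric.energy, RoughMetric.energy, ← lintegral_add_left' m1]
    refine lintegral_mono_ae ?_
    filter_upwards [ae_posSemidef g] with x hx
    have h := norm_herm_le hx (fun i => α x (stdFrame x i)) (fun i => η x (stdFrame x i))
    have h1 := herm_self_nonneg hx (fun i => α x (stdFrame x i))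
    have h2 := herm_self_nonneg hx (fun i => η x (stdFrame x i))
    rw [← ofReal_norm]
    exact (ENNReal.ofReal_le_ofReal h).trans (le_of_eq (ENNReal.ofReal_add h1 h2))
  exact h.trans_lt (ENNReal.add_lt_top.2 ⟨hαf, hηf⟩)

theorem ae_coInner_self_nonneg (α : CovectorField n M) :
    ∀ᵐ x ∂g.vol, 0 ≤ (g.coInner x (α x) (α x)).re := by
  filter_upwards [ae_posSemidef g] with x hx
  exact herm_self_nonneg hx (fun i => α x (stdFrame x i))

/-- `(u, α)` lies in the closure of the graph of the differential on smooth functions, for a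
function `u` instead of a class of functions. -/
def RoughMetric.GraphLimit (u : M → ℂ) (α : CovectorField n M) : Prop :=
  α.IsMeasurable ∧ ∃ φ : ℕ → M → ℂ, (∀ k, φ k ∈ smoothFunctions n M) ∧
    Tendsto (fun k => eLpNorm (fun x => φ k x - u x) 2 g.vol) atTop (𝓝 0) ∧
    Tendsto (fun k => g.energy (differential (φ k) - α)) atTop (𝓝 0)

theorem aestronglyMeasurable_smooth {φ : M → ℂ} (hφ : φ ∈ smoothFunctions n M) :
    AEStronglyMeasurable φ g.vol :=
  (continuous_of_smooth hφ).measurable.aestronglyMeasurable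

variable {g} {u v : M → ℂ} {α η : CovectorField n M}

theorem graphLimit_smooth {φ : M → ℂ} (hφ : φ ∈ smoothFunctions n M) :
    g.GraphLimit φ (differential φ) := by
  refine ⟨isMeasurable_differential hφ, fun _ => φ, fun _ => hφ, ?_, ?_⟩
  · simp
  · have h := energy_smul g (differential φ) 0
    rw [covectorField_zero_smul] at h
    simp only [sub_self, h]
    simp

theorem RoughMetric.GraphLimit.congr (h : g.GraphLimit u α) (huv : u =ᵐ[g.vol] v) :
    g.GraphLimit v α := by
  obtain ⟨hα, φ, hφ, h1, h2⟩ := h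
  refine ⟨hα, φ, hφ, ?_, h2⟩
  refine h1.congr fun k => eLpNorm_congr_ae ?_
  filter_upwards [huv] with x hx
  rw [hx]

theorem RoughMetric.GraphLimit.smul (h : g.GraphLimit u α) (r : ℂ) :
    g.GraphLimit (r • u) (r • α) := by
  obtain ⟨hα, φ, hφ, h1, h2⟩ := h
  refine ⟨hα.smul r, fun k => r • φ k, fun k => smooth_smul (hφ k) r, ?_, ?_⟩
  · have : Tendsto (fun k => ‖r‖ₑ * eLpNorm (fun x => φ k x - u x) 2 g.vol) atTop (𝓝 0) := by
      simpa using ENNReal.Tendsto.const_mul h1 (Or.inr enorm_ne_top)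
    refine this.congr fun k => ?_
    rw [← eLpNorm_const_smul]
    congr 1
    ext x
    simp [mul_sub]
  · have : Tendsto (fun k => ENNReal.ofReal (‖r‖ ^ 2) * g.energy (differential (φ k) - α))
        atTop (𝓝 0) := by
      have h3 := ENNReal.Tendsto.const_mul (a := ENNReal.ofReal (‖r‖ ^ 2)) h2
        (Or.inr ENNReal.ofReal_ne_top)
      rwa [mul_zero] at h3
    refine this.congr fun k => ?_
    rw [← energy_smul, differential_smul (hφ k), smul_sub]

theorem RoughMetric.GraphLimit.add (hu : AEStronglyMeasurable u g.vol)
    (hv : AEStronglyMeasurable v g.vol) (h : g.GraphLimit u α) (h' : g.GraphLimit v η) :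
    g.GraphLimit (u + v) (α + η) := by
  obtain ⟨hα, φ, hφ, h1, h2⟩ := h
  obtain ⟨hη, ψ, hψ, h1', h2'⟩ := h'
  refine ⟨hα.add hη, fun k => φ k + ψ k, fun k => smooth_add (hφ k) (hψ k), ?_, ?_⟩
  · refine tendsto_of_tendsto_of_tendsto_of_le_of_le tendsto_const_nhds
      (by simpa using h1.add h1') (fun _ => zero_le) fun k => ?_
    have e : (fun x => (φ k + ψ k) x - (u + v) x) =
        (fun x => φ k x - u x) + (fun x => ψ k x - v x) := by
      ext x; simp; ring
    rw [e]
    exact eLpNorm_add_le ((aestronglyMeasurable_smooth g (hφ k)).sub hu)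
      ((aestronglyMeasurable_smooth g (hψ k)).sub hv) (by norm_num)
  · have hlim : Tendsto (fun k => 2 * g.energy (differential (φ k) - α) +
        2 * g.energy (differential (ψ k) - η)) atTop (𝓝 0) := by
      simpa using (ENNReal.Tendsto.const_mul h2 (Or.inr (by norm_num : (2 : ℝ≥0∞) ≠ ⊤))).add
        (ENNReal.Tendsto.const_mul h2' (Or.inr (by norm_num : (2 : ℝ≥0∞) ≠ ⊤)))
    refine tendsto_of_tendsto_of_tendsto_of_le_of_le tendsto_const_nhds hlim
      (fun _ => zero_le) fun k => ?_
    have e : differential (n := n) (φ k + ψ k) - (α + η) =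
        (differential (φ k) - α) + (differential (ψ k) - η) := by
      rw [differential_add (hφ k) (hψ k)]; abel
    dsimp only
    rw [e]
    exact energy_add_le g ((isMeasurable_differential (hφ k)).sub hα) _

theorem RoughMetric.GraphLimit.sub (hu : AEStronglyMeasurable u g.vol)
    (hv : AEStronglyMeasurable v g.vol) (h : g.GraphLimit u α) (h' : g.GraphLimit v η) :
    g.GraphLimit (u - v) (α - η) := by
  have := h.add hu (hv.const_smul (-1 : ℂ)) (h'.smul (-1))
  rwa [neg_one_smul, covectorField_neg_one_smul, ← sub_eq_add_neg, ← sub_eq_add_neg] at this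

/-- `α` differs from some smooth differential by a field of energy at most `1`, and smooth
differentials have finite energy. -/
theorem RoughMetric.GraphLimit.energy_lt_top (h : g.GraphLimit u α) : g.energy α < ⊤ := by
  obtain ⟨hα, φ, hφ, h1, h2⟩ := h
  obtain ⟨k, hk⟩ := ((ENNReal.tendsto_nhds_zero.1 h2) 1 one_pos).exists
  have e : α = differential (φ k) - (differential (φ k) - α) := by abel
  rw [e]
  refine (energy_sub_le g (isMeasurable_differential (hφ k)) _).trans_lt (ENNReal.add_lt_top.2 ⟨?_, ?_⟩)
  · exact ENNReal.mul_lt_top (by norm_num) (energy_differential_lt_top g (hφ k))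
  · exact ENNReal.mul_lt_top (by norm_num) (hk.trans_lt ENNReal.one_lt_top)

end EnergyCalculus

/-! ### Closability of the derivative on open sets of a finite-dimensional space. -/

section Closability

variable {E : Type*} [NormedAddCommGroup E] [NormedSpace ℝ E] [FiniteDimensional ℝ E]
  [MeasurableSpace E] [BorelSpace E]

theorem integrable_mul_of_tsupport_subset {μ : Measure E} [IsFiniteMeasureOnCompacts μ] {Q : Set E}
    {f χ : E → ℂ} (hf : ContinuousOn f Q) (hχ : Continuous χ) (hχc : HasCompactSupport χ)
    (hχQ : tsupport χ ⊆ Q) : Integrable (fun x => f x * χ x) μ := by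
  have h1 : IntegrableOn (fun x => f x * χ x) (tsupport χ) μ :=
    ((hf.mono hχQ).mul hχ.continuousOn).integrableOn_compact hχc
  rwa [integrableOn_iff_integrable_of_support_subset] at h1
  intro x hx
  refine subset_tsupport _ fun h => hx ?_
  simp [h]

/-- Weak convergence to zero passes to derivatives: the derivative is a closable operator. -/
theorem ae_eq_zero_of_tendsto_fderiv {μ : Measure E} [μ.IsAddHaarMeasure] {Q : Set E}
    (hQ : IsOpen Q) {f : ℕ → E → ℂ} (hf : ∀ k, ContDiffOn ℝ 1 (f k) Q) {a : E → ℂ}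
    (ha : IntegrableOn a Q μ) (w : E)
    (h0 : Tendsto (fun k => ∫⁻ x in Q, ‖f k x‖ₑ ∂μ) atTop (𝓝 0))
    (h1 : Tendsto (fun k => ∫⁻ x in Q, ‖fderiv ℝ (f k) x w - a x‖ₑ ∂μ) atTop (𝓝 0)) :
    ∀ᵐ x ∂μ, x ∈ Q → a x = 0 := by
  refine hQ.ae_eq_zero_of_integral_contDiff_smul_eq_zero ha.locallyIntegrableOn
    fun χ hχ hχc hχQ => ?_
  set X : E → ℂ := fun x => (χ x : ℂ) with hX
  have hXd : ContDiff ℝ 1 X :=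
    (Complex.ofRealCLM.contDiff.comp hχ).of_le (by exact_mod_cast le_top)
  have hXs : tsupport X ⊆ tsupport χ := closure_mono fun x hx h => hx (by simp [hX, h])
  have hXc : HasCompactSupport X := hχc.mono fun x hx h => hx (by simp [hX, h])
  set X' : E → ℂ := fun x => fderiv ℝ X x w with hX'
  have hX'c : Continuous X' := (hXd.continuous_fderiv one_ne_zero).clm_apply continuous_const
  have hX'cs : HasCompactSupport X' := hXc.fderiv_apply ℝ w
  have hX's : tsupport X' ⊆ tsupport X := tsupport_fderiv_apply_subset ℝ w
  obtain ⟨B₁, hB₁⟩ := hXd.continuous.bounded_above_of_compact_support hXc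
  obtain ⟨B₂, hB₂⟩ := hX'c.bounded_above_of_compact_support hX'cs
  set B : ℝ≥0∞ := ENNReal.ofReal (max B₁ B₂) with hB
  have hXb : ∀ x, ‖X x‖ₑ ≤ B := fun x => by
    rw [← ofReal_norm]; exact ENNReal.ofReal_le_ofReal ((hB₁ x).trans (le_max_left _ _))
  have hX'b : ∀ x, ‖X' x‖ₑ ≤ B := fun x => by
    rw [← ofReal_norm]; exact ENNReal.ofReal_le_ofReal ((hB₂ x).trans (le_max_right _ _))
  have hsupp : ∀ (h : E → ℂ) (Y : E → ℂ), tsupport Y ⊆ Q →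
      ∫ x, h x * Y x ∂μ = ∫ x in Q, h x * Y x ∂μ := fun h Y hY => by
    refine (setIntegral_eq_integral_of_forall_compl_eq_zero fun x hx => ?_).symm
    rw [image_eq_zero_of_notMem_tsupport fun h' => hx (hY h'), mul_zero]
  have hXQ : tsupport X ⊆ Q := hXs.trans hχQ
  have hX'Q : tsupport X' ⊆ Q := hX's.trans hXQ
  have hf'c : ∀ k, ContinuousOn (fun x => fderiv ℝ (f k) x w) Q := fun k =>
    ((hf k).continuousOn_fderiv_of_isOpen hQ le_rfl).clm_apply continuousOn_const
  -- Integration by parts gives `∫ χ a = -∫ (∂_w f_k - a) χ - ∫ f_k ∂_w χ`, and both integrals tend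
  -- to zero because `χ` and `∂_w χ` are bounded.
  have key : ∀ k, ‖∫ x, χ x • a x ∂μ‖ₑ ≤ B * ∫⁻ x in Q, ‖fderiv ℝ (f k) x w - a x‖ₑ ∂μ +
      B * ∫⁻ x in Q, ‖f k x‖ₑ ∂μ := by
    intro k
    have i1 : Integrable (fun x => fderiv ℝ (f k) x w * X x) μ :=
      integrable_mul_of_tsupport_subset (hf'c k) hXd.continuous hXc hXQ
    have i2 : Integrable (fun x => f k x * X' x) μ :=
      integrable_mul_of_tsupport_subset (hf k).continuousOn hX'c hX'cs hX'Q
    have i3 : Integrable (fun x => f k x * X x) μ :=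
      integrable_mul_of_tsupport_subset (hf k).continuousOn hXd.continuous hXc hXQ
    have ibp := integral_mul_fderiv_eq_neg_fderiv_mul_of_integrable i1 i2 i3
      (fun x hx => ((hf k).differentiableOn one_ne_zero).differentiableAt
        (hQ.mem_nhds (hXQ hx)))
      (fun x _ => (hXd.differentiable one_ne_zero) x)
    have i4 : IntegrableOn (fun x => a x * X x) Q μ :=
      Integrable.mul_bdd ha hXd.continuous.aestronglyMeasurable (ae_of_all _ hB₁)
    have e1 : ∫ x, χ x • a x ∂μ = ∫ x in Q, a x * X x ∂μ := by
      rw [← hsupp a X hXQ]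
      congr 1 with x
      rw [Complex.real_smul, mul_comm]
    have e2 : ∫ x in Q, a x * X x ∂μ =
        -(∫ x in Q, (fderiv ℝ (f k) x w - a x) * X x ∂μ) - ∫ x in Q, f k x * X' x ∂μ := by
      have e3 : ∫ x in Q, (fderiv ℝ (f k) x w - a x) * X x ∂μ =
          ∫ x in Q, fderiv ℝ (f k) x w * X x ∂μ - ∫ x in Q, a x * X x ∂μ := by
        rw [← integral_sub i1.integrableOn i4]
        congr 1 with x
        ring
      rw [e3, ← hsupp (fun x => fderiv ℝ (f k) x w) X hXQ, ← hsupp _ X' hX'Q, ibp]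
      ring
    rw [e1, e2]
    refine enorm_sub_le.trans ?_
    rw [enorm_neg]
    gcongr
    · refine (enorm_integral_le_lintegral_enorm _).trans ?_
      rw [← lintegral_const_mul' _ _ ENNReal.ofReal_ne_top]
      refine lintegral_mono fun x => ?_
      rw [enorm_mul, mul_comm]
      gcongr
      exact hXb x
    · refine (enorm_integral_le_lintegral_enorm _).trans ?_
      rw [← lintegral_const_mul' _ _ ENNReal.ofReal_ne_top]
      refine lintegral_mono fun x => ?_
      rw [enorm_mul, mul_comm]
      gcongr
      exact hX'b x
  have hlim : Tendsto (fun k => B * ∫⁻ x in Q, ‖fderiv ℝ (f k) x w - a x‖ₑ ∂μ +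
      B * ∫⁻ x in Q, ‖f k x‖ₑ ∂μ) atTop (𝓝 0) := by
    simpa using (ENNReal.Tendsto.const_mul h1 (Or.inr ENNReal.ofReal_ne_top)).add
      (ENNReal.Tendsto.const_mul h0 (Or.inr ENNReal.ofReal_ne_top))
  have := ge_of_tendsto' hlim key
  simpa using this

end Closability

/-! ### Uniqueness of the gradient on the manifold. -/

section GradientUniqueness

variable {n : ℕ} [NeZero n] {M : Type*} [TopologicalSpace M]
  [ChartedSpace (EuclideanHalfSpace n) M] [MeasurableSpace M] [BorelSpace M] [CompactSpace M]
  {e : OpenPartialHomeomorph M (EuclideanHalfSpace n)}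
  {g : RoughMetric n M} {U : Set M} {Q : Set (EuclideanSpace ℝ (Fin n))} {c : ℝ}
  {u v : M → ℂ} {α η : CovectorField n M}

theorem lintegral_components_sq_le (h : g.IsCell U Q e c) (hα : α.IsMeasurable) (i : Fin n) :
    ∫⁻ y in Q, ‖α.components e y i‖ₑ ^ (2 : ℝ) ≤
      ENNReal.ofReal c * (ENNReal.ofReal √(c ^ n) * g.energy α) := by
  have hc0 : 0 < c := by linarith [h.bounded.1]
  have hm := aemeasurable_energyDensity g hα
  calc _ ≤ ∫⁻ y in Q, ENNReal.ofReal c * ENNReal.ofReal (g.coInner (chartInv e y)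
          (α (chartInv e y)) (α (chartInv e y))).re := by
        refine lintegral_mono_ae ?_
        filter_upwards [ae_mono (cell_ae g h)
          (sum_norm_sq_le_coInner g h.mem_charts h.bounded)] with y hy
        rw [← ENNReal.ofReal_mul hc0.le, ← ofReal_norm,
          ENNReal.ofReal_rpow_of_nonneg (norm_nonneg _) (by norm_num)]
        apply ENNReal.ofReal_le_ofReal
        rw [Real.rpow_two]
        exact (Finset.single_le_sum (f := fun i => ‖α.components e y i‖ ^ 2)
          (fun i _ => by positivity) (Finset.mem_univ i)).trans (hy α).1
    _ = ENNReal.ofReal c * ∫⁻ y in Q, ENNReal.ofReal (g.coInner (chartInv e y)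
          (α (chartInv e y)) (α (chartInv e y))).re :=
        lintegral_const_mul' _ _ ENNReal.ofReal_ne_top
    _ ≤ ENNReal.ofReal c * (ENNReal.ofReal √(c ^ n) * g.energy α) := by
        gcongr
        refine (le_lintegral_cell g h hm).trans ?_
        gcongr
        exact lintegral_mono' Measure.restrict_le_self le_rfl

theorem aemeasurable_components_cell (h : g.IsCell U Q e c) (hα : α.IsMeasurable) (i : Fin n) :
    AEMeasurable (fun y => α.components e y i) (volume.restrict Q) :=
  (hα e h.mem_charts i).mono_measure (cell_ae g h)

theorem lintegral_cell_le_sqrt {Q : Set (EuclideanSpace ℝ (Fin n))}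
    {F : EuclideanSpace ℝ (Fin n) → ℝ≥0∞} (hF : AEMeasurable F (volume.restrict Q)) :
    ∫⁻ y in Q, F y ≤ (∫⁻ y in Q, F y ^ (2 : ℝ)) ^ (1 / 2 : ℝ) * volume Q ^ (1 / 2 : ℝ) := by
  have h := lintegral_le_rpow_lintegral (volume.restrict Q) one_lt_two hF
  rw [Measure.restrict_apply_univ] at h
  convert h using 2
  norm_num

theorem ae_cell_of_ae (h : g.IsCell U Q e c) {P : M → Prop}
    (hP : ∀ᵐ y : EuclideanSpace ℝ (Fin n), y ∈ Q → P (chartInv e y)) :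
    ∀ᵐ x ∂g.vol, x ∈ U → P x := by
  have h1 : ∀ᵐ x ∂(g.vol.restrict e.source), x ∈ U → P x := by
    refine ae_vol_of_ae_chart g h.mem_charts (P := fun x => x ∈ U → P x) ?_
    have h2 : ∀ᵐ y : EuclideanSpace ℝ (Fin n),
        y ∉ (chartImage e ∩ chartInv e ⁻¹' U) \ Q := measure_eq_zero_iff_ae_notMem.1 h.null
    filter_upwards [ae_restrict_mem measurableSet_chartImage, ae_restrict_of_ae h2,
      ae_restrict_of_ae hP] with y hy hy2 hyP hyU
    exact hyP (by_contra fun hyQ => hy2 ⟨⟨hy, hyU⟩, hyQ⟩)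
  filter_upwards [(ae_restrict_iff' measurableSet_source).1 h1] with x hx hxU
  exact hx (h.subset_source hxU) hxU

theorem tendsto_rpow_zero {f : ℕ → ℝ≥0∞} (hf : Tendsto f atTop (𝓝 0)) {a : ℝ} (ha : 0 < a) :
    Tendsto (fun k => f k ^ a) atTop (𝓝 0) := by
  have h := ((ENNReal.continuous_rpow_const (y := a)).tendsto 0).comp hf
  rwa [ENNReal.zero_rpow_of_pos ha] at h

theorem tendsto_const_mul_zero {f : ℕ → ℝ≥0∞} (hf : Tendsto f atTop (𝓝 0)) {a : ℝ≥0∞}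
    (ha : a ≠ ⊤) : Tendsto (fun k => a * f k) atTop (𝓝 0) := by
  have h := ENNReal.Tendsto.const_mul (a := a) hf (Or.inr ha)
  rwa [mul_zero] at h

theorem tendsto_mul_const_zero {f : ℕ → ℝ≥0∞} (hf : Tendsto f atTop (𝓝 0)) {a : ℝ≥0∞}
    (ha : a ≠ ⊤) : Tendsto (fun k => f k * a) atTop (𝓝 0) := by
  simpa only [mul_comm] using tendsto_const_mul_zero hf ha

theorem tendsto_zero_of_le {f h : ℕ → ℝ≥0∞} (hh : Tendsto h atTop (𝓝 0)) (hle : ∀ k, f k ≤ h k) :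
    Tendsto f atTop (𝓝 0) :=
  tendsto_of_tendsto_of_tendsto_of_le_of_le tendsto_const_nhds hh (fun _ => zero_le) hle

theorem eLpNorm_two_eq (f : M → ℂ) :
    eLpNorm f 2 g.vol = (∫⁻ x, ‖f x‖ₑ ^ (2 : ℝ) ∂g.vol) ^ (1 / 2 : ℝ) := by
  rw [eLpNorm_eq_lintegral_rpow_enorm_toReal (by norm_num) (by norm_num)]
  simp

/-- On a cell of finite volume, `L²` convergence of the functions and of their differentials implies
`L¹` convergence in coordinates. Closability of each partial derivative then kills every component
of `α`. -/
theorem RoughMetric.GraphLimit.ae_eq_zero (h : g.GraphLimit 0 α) : ∀ᵐ x ∂g.vol, α x = 0 := by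
  have hαE := h.energy_lt_top
  obtain ⟨hα, ψ, hψ, h0, h1⟩ := h
  obtain ⟨t, U, hU, ht⟩ := exists_finite_cells g
  have hcell : ∀ x : M, ∀ᵐ z ∂g.vol, z ∈ U x → α z = 0 := by
    intro x
    obtain ⟨Q, e, c, hc⟩ := hU x
    refine ae_cell_of_ae hc ?_
    have hQt : volume Q ≠ ⊤ := hc.isBounded.measure_lt_top.ne
    have hQt' : volume Q ^ (1 / 2 : ℝ) ≠ ⊤ := ENNReal.rpow_ne_top_of_nonneg (by norm_num) hQt
    have hQch : Q ⊆ chartImage e := subset_closure.trans hc.closure_subset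
    have hint : ∀ η : CovectorField n M, η.IsMeasurable → ∀ i,
        ∫⁻ y in Q, ‖η.components e y i‖ₑ ≤
          (ENNReal.ofReal c * (ENNReal.ofReal √(c ^ n) * g.energy η)) ^ (1 / 2 : ℝ) *
            volume Q ^ (1 / 2 : ℝ) := by
      intro η hη i
      refine (lintegral_cell_le_sqrt (aemeasurable_components_cell hc hη i).enorm).trans ?_
      gcongr
      exact lintegral_components_sq_le hc hη i
    have hzero : ∀ i, ∀ᵐ y : EuclideanSpace ℝ (Fin n), y ∈ Q → α.components e y i = 0 := by
      intro i
      refine ae_eq_zero_of_tendsto_fderiv hc.isOpen_image (f := fun k => ψ k ∘ chartInv e)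
        (fun k => ((contDiffOn_comp_chartInv hc.mem_charts (hψ k)).mono hQch).of_le
          (by exact_mod_cast le_top)) ?_ (EuclideanSpace.single i 1) ?_ ?_
      · refine ⟨(aemeasurable_components_cell hc hα i).aestronglyMeasurable, ?_⟩
        refine (hint α hα i).trans_lt (ENNReal.mul_lt_top ?_ hQt'.lt_top)
        exact ENNReal.rpow_lt_top_of_nonneg (by norm_num) (ENNReal.mul_ne_top ENNReal.ofReal_ne_top
          (ENNReal.mul_ne_top ENNReal.ofReal_ne_top hαE.ne))
      · have hlim : Tendsto (fun k => (ENNReal.ofReal √(c ^ n)) ^ (1 / 2 : ℝ) *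
            eLpNorm (fun x => ψ k x - (0 : M → ℂ) x) 2 g.vol * volume Q ^ (1 / 2 : ℝ))
            atTop (𝓝 0) :=
          tendsto_mul_const_zero (tendsto_const_mul_zero h0
            (ENNReal.rpow_ne_top_of_nonneg (by norm_num) ENNReal.ofReal_ne_top)) hQt'
        refine tendsto_zero_of_le hlim fun k => ?_
        have hψm : Measurable (ψ k) := (continuous_of_smooth (hψ k)).measurable
        have hm : AEMeasurable (fun y => ‖(ψ k ∘ chartInv e) y‖ₑ) (volume.restrict Q) :=
          (hψm.comp_aemeasurable (aemeasurable_chartInv.mono_measure (cell_ae g hc))).enorm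
        refine (lintegral_cell_le_sqrt hm).trans ?_
        gcongr
        rw [eLpNorm_two_eq, ← ENNReal.mul_rpow_of_nonneg _ _ (by norm_num)]
        gcongr
        refine (le_lintegral_cell g hc (f := fun x => ‖ψ k x‖ₑ ^ (2 : ℝ))
          (hψm.enorm.pow_const 2).aemeasurable).trans ?_
        refine mul_le_mul_right (lintegral_mono' Measure.restrict_le_self fun x => ?_) _
        simp
      · have hlim : Tendsto (fun k => (ENNReal.ofReal c * (ENNReal.ofReal √(c ^ n) *
            g.energy (differential (ψ k) - α))) ^ (1 / 2 : ℝ) * volume Q ^ (1 / 2 : ℝ))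
            atTop (𝓝 0) :=
          tendsto_mul_const_zero (tendsto_rpow_zero (tendsto_const_mul_zero
            (tendsto_const_mul_zero h1 ENNReal.ofReal_ne_top) ENNReal.ofReal_ne_top)
            (by norm_num)) hQt'
        refine tendsto_zero_of_le hlim fun k => ?_
        refine le_trans (le_of_eq ?_) (hint _ ((isMeasurable_differential (hψ k)).sub hα) i)
        refine setLIntegral_congr_fun hc.isOpen_image.measurableSet fun y hy => ?_
        rw [← components_differential_of_mem_interior hc.mem_charts (hψ k)
          (cell_image_mem_nhds g hc hy)]
        rfl
    filter_upwards [ae_all_iff.2 hzero] with y hy hyQ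
    -- The coordinate frame spans the tangent space, so a covector with vanishing components is
    -- zero.
    have hinj : Function.Surjective (chartD e y) := by
      have hu := isUnit_det_chartD hc.mem_charts (hQch hyQ)
      exact (LinearMap.equivOfDetNeZero (chartD e y).toLinearMap hu.ne_zero).surjective
    have hzero' : ∀ v : EuclideanSpace ℝ (Fin n), α (chartInv e y) (chartD e y v) = 0 := by
      intro v
      have key : ∀ (a : EuclideanSpace ℝ (Fin n) →L[ℝ] ℂ)
          (L : EuclideanSpace ℝ (Fin n) →L[ℝ] EuclideanSpace ℝ (Fin n)),
          (∀ i, a (L (EuclideanSpace.single i 1)) = 0) → a (L v) = 0 := by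
        intro a L haL
        conv_lhs => rw [euclidean_eq_sum_single v]
        simp [map_sum, haL]
      exact key (α (chartInv e y)) (chartD e y) fun i => hy i hyQ
    refine ContinuousLinearMap.ext fun w => ?_
    obtain ⟨v, rfl⟩ := hinj w
    exact hzero' v
  filter_upwards [ae_all_iff.2 fun x : t => hcell x] with z hz
  have : z ∈ ⋃ x ∈ t, U x := ht ▸ Set.mem_univ z
  simp only [Set.mem_iUnion] at this
  obtain ⟨x, hx, hzx⟩ := this
  exact hz ⟨x, hx⟩ hzx

/-- The gradient is determined almost everywhere. -/
theorem RoughMetric.GraphLimit.unique (hu : AEStronglyMeasurable u g.vol) (h : g.GraphLimit u α)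
    (h' : g.GraphLimit u η) : ∀ᵐ x ∂g.vol, α x = η x := by
  have h1 := h.sub hu hu h'
  rw [sub_self] at h1
  filter_upwards [h1.ae_eq_zero] with x hx
  exact sub_eq_zero.1 hx

end GradientUniqueness

/-! ### Consequences of the dual inequality for functions and for a fixed weight. -/

section WeightedPoincare

variable {n : ℕ} [NeZero n] {M : Type*} [TopologicalSpace M]
  [ChartedSpace (EuclideanHalfSpace n) M] [MeasurableSpace M] [BorelSpace M] [CompactSpace M]
  {g : RoughMetric n M} {b : ℝ} {u : M → ℂ} {α : CovectorField n M}

theorem memLp_smooth {φ : M → ℂ} (hφ : φ ∈ smoothFunctions n M) (p : ℝ≥0∞) : MemLp φ p g.vol := by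
  have hφc := continuous_of_smooth hφ
  obtain ⟨B, hB⟩ := (isCompact_range hφc.norm).bddAbove
  exact MemLp.of_bound (aestronglyMeasurable_smooth g hφ) B (ae_of_all _ fun x => hB ⟨x, rfl⟩)

/-- The weight `|φ - m|` gives `‖φ - m‖₂² ≤ C ‖φ - m‖_b E`, where `E` is the `L²` norm of `dφ`. As
`b ≤ 2` and the volume is finite, the `b`-norm is bounded by the `L²` norm, which cancels. The same
`m` keeps serving for all other weights. -/
theorem exists_poincare_smooth (h : g.HasPoincare b Set.univ) (hb1 : 1 < b) (hb2 : b ≤ 2) :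
    ∃ C : ℝ≥0∞, C ≠ ⊤ ∧ ∀ φ ∈ smoothFunctions n M, ∃ m : ℂ,
      eLpNorm (fun x => φ x - m) 2 g.vol ≤ C * g.energy (differential φ) ^ (1 / 2 : ℝ) ∧
      ∀ ρ : M → ℝ≥0∞, AEMeasurable ρ g.vol → ∫⁻ x, ρ x * ‖φ x - m‖ₑ ∂g.vol ≤
        C * ((∫⁻ x, ρ x ^ b ∂g.vol) ^ (1 / b) * g.energy (differential φ) ^ (1 / 2 : ℝ)) := by
  have hb0 : 0 < b := by linarith
  have hd : 0 ≤ 1 / b - 1 / 2 := by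
    have : (1 : ℝ) / 2 ≤ 1 / b := one_div_le_one_div_of_le hb0 hb2
    linarith
  obtain ⟨C, hC, hP⟩ := h
  set w := g.vol Set.univ ^ (1 / b - 1 / 2) with hw
  have hwt : w ≠ ⊤ := ENNReal.rpow_ne_top_of_nonneg hd (measure_ne_top _ _)
  refine ⟨max C (C * w), by simp [hC, ENNReal.mul_ne_top hC hwt], fun φ hφ => ?_⟩
  obtain ⟨m, hm⟩ := hP φ hφ
  simp only [Measure.restrict_univ] at hm
  set E := g.energy (differential φ) ^ (1 / 2 : ℝ) with hE
  refine ⟨m, ?_, fun ρ hρ => ?_⟩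
  · have hmem : MemLp (fun x => φ x - m) 2 g.vol := (memLp_smooth hφ 2).sub (memLp_const m)
    set A := eLpNorm (fun x => φ x - m) 2 g.vol with hA
    have hAt : A ≠ ⊤ := hmem.2.ne
    have hφm : Measurable fun x => φ x - m := (continuous_of_smooth hφ).measurable.sub_const m
    have h1 := hm (fun x => ‖φ x - m‖ₑ) hφm.enorm
    have h2 : ∫⁻ x, ‖φ x - m‖ₑ * ‖φ x - m‖ₑ ∂g.vol = A * A := by
      have e1 : A ^ (2 : ℝ) = ∫⁻ x, ‖φ x - m‖ₑ ^ (2 : ℝ) ∂g.vol := by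
        rw [hA, eLpNorm_two_eq, ← ENNReal.rpow_mul]; norm_num
      rw [ENNReal.rpow_two, pow_two] at e1
      rw [e1]
      refine lintegral_congr fun x => ?_
      rw [ENNReal.rpow_two, pow_two]
    have h3 : (∫⁻ x, ‖φ x - m‖ₑ ^ b ∂g.vol) ^ (1 / b) ≤ A * w := by
      have e1 := eLpNorm_le_eLpNorm_mul_rpow_measure_univ (μ := g.vol)
        (p := ENNReal.ofReal b) (q := 2) (f := fun x => φ x - m)
        (by rw [← ENNReal.ofReal_ofNat 2]; exact ENNReal.ofReal_le_ofReal hb2) hmem.1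
      rw [eLpNorm_eq_lintegral_rpow_enorm_toReal (by simpa using hb0) ENNReal.ofReal_ne_top,
        ENNReal.toReal_ofReal hb0.le] at e1
      simpa [hA, hw] using e1
    rw [h2] at h1
    have h4 : A * A ≤ A * (C * w * E) := by
      refine h1.trans ?_
      calc _ ≤ C * ((A * w) * E) := by gcongr
        _ = _ := by ring
    -- Cancelling `A` requires it to be nonzero and finite; finiteness holds because `φ` is bounded.
    by_cases hA0 : A = 0
    · rw [hA0]; exact zero_le
    · have h5 := (ENNReal.mul_le_mul_iff_right hA0 hAt).1 h4
      exact h5.trans (by gcongr; exact le_max_right _ _)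
  · have h1 := hm (hρ.mk ρ) hρ.measurable_mk
    have e1 : ∫⁻ x, ρ x * ‖φ x - m‖ₑ ∂g.vol = ∫⁻ x, hρ.mk ρ x * ‖φ x - m‖ₑ ∂g.vol :=
      lintegral_congr_ae (by filter_upwards [hρ.ae_eq_mk] with x hx; rw [← hx])
    have e2 : ∫⁻ x, ρ x ^ b ∂g.vol = ∫⁻ x, hρ.mk ρ x ^ b ∂g.vol :=
      lintegral_congr_ae (by filter_upwards [hρ.ae_eq_mk] with x hx; rw [← hx])
    rw [e1, e2]
    exact h1.trans (by gcongr; exact le_max_left _ _)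

theorem enorm_mul_rpow_vol (m : ℂ) :
    eLpNorm (fun _ : M => m) 2 g.vol = ‖m‖ₑ * g.vol Set.univ ^ (1 / 2 : ℝ) := by
  rw [eLpNorm_const' _ (by norm_num) (by norm_num)]
  simp

/-- Split `φ = (φ - m) + m`. The first part is the dual inequality, and `|m|` is read off from the
`L²` norm of the constant `m = φ - (φ - m)`. -/
theorem exists_lintegral_mul_smooth_le [Nonempty M] (h : g.HasPoincare b Set.univ) (hb1 : 1 < b)
    (hb2 : b ≤ 2) {ρ : M → ℝ≥0∞} (hρ : AEMeasurable ρ g.vol)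
    (hρb : ∫⁻ x, ρ x ^ b ∂g.vol ≠ ⊤) :
    ∃ C : ℝ≥0∞, C ≠ ⊤ ∧ ∀ φ ∈ smoothFunctions n M, ∫⁻ x, ρ x * ‖φ x‖ₑ ∂g.vol ≤
      C * (eLpNorm φ 2 g.vol + g.energy (differential φ) ^ (1 / 2 : ℝ)) := by
  have hb0 : 0 < b := by linarith
  obtain ⟨C, hC, hP⟩ := exists_poincare_smooth h hb1 hb2
  have he0 : 0 ≤ 1 - 1 / b := by
    have : 1 / b ≤ 1 := by rw [div_le_one hb0]; exact hb1.le
    linarith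
  set W := (∫⁻ x, ρ x ^ b ∂g.vol) ^ (1 / b) with hW
  have hWt : W ≠ ⊤ := ENNReal.rpow_ne_top_of_nonneg (by positivity) hρb
  set I := ∫⁻ x, ρ x ∂g.vol with hI
  have hIt : I ≠ ⊤ := by
    refine ((lintegral_le_rpow_lintegral g.vol hb1 hρ).trans_lt (ENNReal.mul_lt_top hWt.lt_top
      (ENNReal.rpow_lt_top_of_nonneg he0 (measure_ne_top _ _)))).ne
  set w := g.vol Set.univ ^ (1 / 2 : ℝ) with hw
  have hv0 : g.vol Set.univ ≠ 0 := (vol_pos_of_isOpen g isOpen_univ Set.univ_nonempty).ne'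
  have hwt : w ≠ ⊤ := ENNReal.rpow_ne_top_of_nonneg (by norm_num) (measure_ne_top _ _)
  have hw0 : w ≠ 0 := (ENNReal.rpow_pos (pos_iff_ne_zero.2 hv0) (measure_ne_top _ _)).ne'
  refine ⟨C * W + w⁻¹ * (1 + C) * I, ENNReal.add_ne_top.2 ⟨ENNReal.mul_ne_top hC hWt,
    ENNReal.mul_ne_top (ENNReal.mul_ne_top (ENNReal.inv_ne_top.2 hw0)
      (ENNReal.add_ne_top.2 ⟨ENNReal.one_ne_top, hC⟩)) hIt⟩, fun φ hφ => ?_⟩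
  obtain ⟨m, hm1, hm2⟩ := hP φ hφ
  set E := g.energy (differential φ) ^ (1 / 2 : ℝ) with hE
  set N := eLpNorm φ 2 g.vol with hN
  have hφm : AEStronglyMeasurable φ g.vol := aestronglyMeasurable_smooth g hφ
  have h1 : ‖m‖ₑ ≤ w⁻¹ * (1 + C) * (N + E) := by
    have h2 : ‖m‖ₑ * w ≤ (1 + C) * (N + E) := by
      rw [← enorm_mul_rpow_vol]
      have e : (fun _ : M => m) = φ - (fun x => φ x - m) := by ext x; simp
      rw [e]
      refine (eLpNorm_sub_le hφm (hφm.sub aestronglyMeasurable_const) (by norm_num)).trans ?_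
      calc N + _ ≤ N + C * E := by gcongr; exact hm1
        _ ≤ (N + C * E) + (E + C * N) := le_self_add
        _ = _ := by ring
    calc ‖m‖ₑ = w⁻¹ * (‖m‖ₑ * w) := by
          rw [mul_comm (‖m‖ₑ), ← mul_assoc, ENNReal.inv_mul_cancel hw0 hwt, one_mul]
      _ ≤ w⁻¹ * ((1 + C) * (N + E)) := by gcongr
      _ = _ := by ring
  calc ∫⁻ x, ρ x * ‖φ x‖ₑ ∂g.vol ≤ ∫⁻ x, (ρ x * ‖φ x - m‖ₑ + ρ x * ‖m‖ₑ) ∂g.vol := by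
        refine lintegral_mono fun x => ?_
        rw [← mul_add]
        gcongr
        calc ‖φ x‖ₑ = ‖(φ x - m) + m‖ₑ := by rw [sub_add_cancel]
          _ ≤ _ := enorm_add_le _ _
    _ = ∫⁻ x, ρ x * ‖φ x - m‖ₑ ∂g.vol + I * ‖m‖ₑ := by
        rw [lintegral_add_left' (f := fun x => ρ x * ‖φ x - m‖ₑ) (hρ.mul (hφm.sub aestronglyMeasurable_const).enorm),
          lintegral_mul_const'' _ hρ]
    _ ≤ C * (W * E) + I * (w⁻¹ * (1 + C) * (N + E)) := by
        gcongr
        exact hm2 ρ hρ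
    _ ≤ C * (W * (N + E)) + I * (w⁻¹ * (1 + C) * (N + E)) := by
        gcongr
        exact le_add_self
    _ = _ := by ring

theorem energy_differential_le {φ : M → ℂ} (hφ : φ ∈ smoothFunctions n M) (hα : α.IsMeasurable) :
    g.energy (differential φ) ≤ 2 * g.energy (differential φ - α) + 2 * g.energy α := by
  have e : differential (n := n) φ = (differential φ - α) + α := by abel
  conv_lhs => rw [e]
  exact energy_add_le g ((isMeasurable_differential hφ).sub hα) _

theorem tendsto_energy_bound {φ : ℕ → M → ℂ}
    (h : Tendsto (fun k => g.energy (differential (φ k) - α)) atTop (𝓝 0)) :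
    Tendsto (fun k => (2 * g.energy (differential (φ k) - α) + 2 * g.energy α) ^ (1 / 2 : ℝ))
      atTop (𝓝 ((2 * g.energy α) ^ (1 / 2 : ℝ))) := by
  have h1 : Tendsto (fun k => 2 * g.energy (differential (φ k) - α) + 2 * g.energy α) atTop
      (𝓝 (0 + 2 * g.energy α)) :=
    (tendsto_const_mul_zero h (by norm_num)).add tendsto_const_nhds
  rw [zero_add] at h1
  exact ((ENNReal.continuous_rpow_const (y := 1 / 2)).tendsto _).comp h1

theorem ae_lt_top_of_rpow {ρ : M → ℝ≥0∞} (hρ : AEMeasurable ρ g.vol)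
    (hρb : ∫⁻ x, ρ x ^ b ∂g.vol ≠ ⊤) (hb1 : 1 < b) : ∀ᵐ x ∂g.vol, ρ x < ⊤ := by
  filter_upwards [ae_lt_top' (hρ.pow_const b) hρb] with x hx
  exact (ENNReal.rpow_lt_top_iff_of_pos (by linarith)).1 hx

/-- Fatou's lemma along an almost everywhere convergent subsequence of the smooth approximations.
The factor `2` comes from the crude bound for the energy of a sum. -/
theorem exists_lintegral_mul_le [Nonempty M] (h : g.HasPoincare b Set.univ) (hb1 : 1 < b)
    (hb2 : b ≤ 2) {ρ : M → ℝ≥0∞} (hρ : AEMeasurable ρ g.vol)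
    (hρb : ∫⁻ x, ρ x ^ b ∂g.vol ≠ ⊤) :
    ∃ C : ℝ≥0∞, C ≠ ⊤ ∧ ∀ u : M → ℂ, ∀ α, AEStronglyMeasurable u g.vol → g.GraphLimit u α →
      ∫⁻ x, ρ x * ‖u x‖ₑ ∂g.vol ≤
        C * (eLpNorm u 2 g.vol + (2 * g.energy α) ^ (1 / 2 : ℝ)) := by
  obtain ⟨C, hC, hP⟩ := exists_lintegral_mul_smooth_le h hb1 hb2 hρ hρb
  refine ⟨C, hC, fun u α hu hα => ?_⟩
  obtain ⟨hαm, φ, hφ, h1, h2⟩ := hα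
  have hconv : TendstoInMeasure g.vol φ atTop u :=
    tendstoInMeasure_of_tendsto_eLpNorm (p := 2) (by norm_num)
      (fun k => aestronglyMeasurable_smooth g (hφ k)) hu h1
  obtain ⟨ns, hns, hae⟩ := hconv.exists_seq_tendsto_ae
  have hpt : ∀ k, ∫⁻ x, ρ x * ‖φ (ns k) x‖ₑ ∂g.vol ≤
      C * ((eLpNorm (fun x => φ (ns k) x - u x) 2 g.vol + eLpNorm u 2 g.vol) +
        (2 * g.energy (differential (φ (ns k)) - α) + 2 * g.energy α) ^ (1 / 2 : ℝ)) := by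
    intro k
    refine (hP _ (hφ _)).trans ?_
    gcongr
    · have e : φ (ns k) = (fun x => φ (ns k) x - u x) + u := by ext x; simp
      conv_lhs => rw [e]
      exact eLpNorm_add_le ((aestronglyMeasurable_smooth g (hφ _)).sub hu) hu (by norm_num)
    · exact energy_differential_le (hφ _) hαm
  have hlim : Tendsto (fun k => C *
      ((eLpNorm (fun x => φ (ns k) x - u x) 2 g.vol + eLpNorm u 2 g.vol) +
        (2 * g.energy (differential (φ (ns k)) - α) + 2 * g.energy α) ^ (1 / 2 : ℝ))) atTop
      (𝓝 (C * (eLpNorm u 2 g.vol + (2 * g.energy α) ^ (1 / 2 : ℝ)))) := by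
    refine ENNReal.Tendsto.const_mul ?_ (Or.inr hC)
    have a1 := (h1.comp hns.tendsto_atTop).add_const (eLpNorm u 2 g.vol)
    rw [zero_add] at a1
    exact a1.add ((tendsto_energy_bound h2).comp hns.tendsto_atTop)
  calc ∫⁻ x, ρ x * ‖u x‖ₑ ∂g.vol ≤ ∫⁻ x, liminf (fun k => ρ x * ‖φ (ns k) x‖ₑ) atTop ∂g.vol := by
        refine lintegral_mono_ae ?_
        -- Multiplication by `ρ x` respects limits in `ℝ≥0∞` because `ρ x` is finite almost
        -- everywhere.
        filter_upwards [hae, ae_lt_top_of_rpow hρ hρb hb1] with x hx hρx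
        have := ENNReal.Tendsto.const_mul (a := ρ x)
          ((continuous_enorm.tendsto (u x)).comp hx) (Or.inr hρx.ne)
        exact this.liminf_eq.ge
    _ ≤ liminf (fun k => ∫⁻ x, ρ x * ‖φ (ns k) x‖ₑ ∂g.vol) atTop :=
        lintegral_liminf_le' fun k => hρ.mul (aestronglyMeasurable_smooth g (hφ _)).enorm
    _ ≤ _ := by
        rw [← hlim.liminf_eq]
        exact liminf_le_liminf (Eventually.of_forall hpt)

end WeightedPoincare

/-! ### Deviation from the weighted mean. -/

section Deviation

variable {n : ℕ} [NeZero n] {M : Type*} [TopologicalSpace M]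
  [ChartedSpace (EuclideanHalfSpace n) M] [MeasurableSpace M] [BorelSpace M] [CompactSpace M]
  {g : RoughMetric n M} {b : ℝ} {ρ : M → ℝ}

theorem enorm_ofReal_mul (r : ℝ) (z : ℂ) : ‖(r : ℂ) * z‖ₑ = ‖r‖ₑ * ‖z‖ₑ := by
  rw [enorm_mul, ← ofReal_norm, Complex.norm_real, ofReal_norm]

theorem integrable_weight_mul {u : M → ℂ} (hρ : AEStronglyMeasurable ρ g.vol)
    (hu : AEStronglyMeasurable u g.vol) (h : ∫⁻ x, ‖ρ x‖ₑ * ‖u x‖ₑ ∂g.vol ≠ ⊤) :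
    Integrable (fun x => (ρ x : ℂ) * u x) g.vol := by
  refine ⟨(Complex.continuous_ofReal.comp_aestronglyMeasurable hρ).mul hu, ?_⟩
  simp only [HasFiniteIntegral, enorm_ofReal_mul]
  exact h.lt_top

theorem enorm_integral_weight_mul_le (u : M → ℂ) :
    ‖∫ x, (ρ x : ℂ) * u x ∂g.vol‖ₑ ≤ ∫⁻ x, ‖ρ x‖ₑ * ‖u x‖ₑ ∂g.vol := by
  refine (enorm_integral_le_lintegral_enorm _).trans (le_of_eq ?_)
  simp only [enorm_ofReal_mul]

theorem exists_integrable_weight_mul [Nonempty M] (h : g.HasPoincare b Set.univ) (hb1 : 1 < b)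
    (hb2 : b ≤ 2) (hρ : AEStronglyMeasurable ρ g.vol) (hρb : ∫⁻ x, ‖ρ x‖ₑ ^ b ∂g.vol ≠ ⊤) :
    ∃ C : ℝ≥0∞, C ≠ ⊤ ∧ ∀ (u : M → ℂ) (α : CovectorField n M), MemLp u 2 g.vol →
      g.GraphLimit u α → Integrable (fun x => (ρ x : ℂ) * u x) g.vol ∧
      ‖∫ x, (ρ x : ℂ) * u x ∂g.vol‖ₑ ≤
        C * (eLpNorm u 2 g.vol + (2 * g.energy α) ^ (1 / 2 : ℝ)) := by
  obtain ⟨C, hC, hP⟩ := exists_lintegral_mul_le h hb1 hb2 hρ.enorm hρb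
  refine ⟨C, hC, fun u α hu hα => ?_⟩
  have h1 := hP u α hu.1 hα
  refine ⟨integrable_weight_mul hρ hu.1 (ne_top_of_le_ne_top ?_ h1),
    (enorm_integral_weight_mul_le u).trans h1⟩
  refine ENNReal.mul_ne_top hC (ENNReal.add_ne_top.2 ⟨hu.2.ne, ?_⟩)
  exact ENNReal.rpow_ne_top_of_nonneg (by norm_num)
    (ENNReal.mul_ne_top (by norm_num) hα.energy_lt_top.ne)

theorem integrable_weight [Nonempty M] (hb1 : 1 < b) (hρ : AEStronglyMeasurable ρ g.vol)
    (hρb : ∫⁻ x, ‖ρ x‖ₑ ^ b ∂g.vol ≠ ⊤) : Integrable ρ g.vol := by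
  have he0 : 0 ≤ 1 - 1 / b := by
    have : 1 / b ≤ 1 := by rw [div_le_one (by linarith)]; exact hb1.le
    linarith
  refine ⟨hρ, (lintegral_le_rpow_lintegral g.vol hb1 hρ.enorm).trans_lt (ENNReal.mul_lt_top ?_ ?_)⟩
  · exact ENNReal.rpow_lt_top_of_nonneg (by positivity) hρb
  · exact ENNReal.rpow_lt_top_of_nonneg he0 (measure_ne_top _ _)

/-- The deviation of `u` from its weighted mean. -/
def deviation (g : RoughMetric n M) (ρ : M → ℝ) (u : M → ℂ) : M → ℂ := fun x =>
  u x - ((∫ z, ρ z ∂g.vol : ℝ) : ℂ)⁻¹ * ∫ z, (ρ z : ℂ) * u z ∂g.vol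

theorem deviation_sub {u v : M → ℂ} (hu : Integrable (fun x => (ρ x : ℂ) * u x) g.vol)
    (hv : Integrable (fun x => (ρ x : ℂ) * v x) g.vol) :
    deviation g ρ (u - v) = deviation g ρ u - deviation g ρ v := by
  ext x
  simp only [deviation, Pi.sub_apply, mul_sub]
  rw [integral_sub hu hv]
  ring

theorem deviation_const (hρ0 : ∫ x, ρ x ∂g.vol ≠ 0) (m : ℂ) :
    deviation g ρ (fun _ => m) = 0 := by
  ext x
  have h : ∫ z, (ρ z : ℂ) * m ∂g.vol = ((∫ z, ρ z ∂g.vol : ℝ) : ℂ) * m := by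
    rw [integral_mul_const, integral_complex_ofReal]
  have h0 : ((∫ z, ρ z ∂g.vol : ℝ) : ℂ) ≠ 0 := by exact_mod_cast hρ0
  simp only [deviation, h, Pi.zero_apply]
  field_simp
  ring

theorem eLpNorm_deviation_le {u : M → ℂ} (hu : AEStronglyMeasurable u g.vol) :
    eLpNorm (deviation g ρ u) 2 g.vol ≤ eLpNorm u 2 g.vol +
      ‖((∫ z, ρ z ∂g.vol : ℝ) : ℂ)⁻¹‖ₑ * g.vol Set.univ ^ (1 / 2 : ℝ) *
        ‖∫ x, (ρ x : ℂ) * u x ∂g.vol‖ₑ := by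
  refine (eLpNorm_sub_le hu aestronglyMeasurable_const (by norm_num)).trans ?_
  rw [enorm_mul_rpow_vol, enorm_mul]
  refine le_of_eq ?_
  ring

/-- Constants have zero deviation, so `φ` may be replaced by `φ - m`. Its `L²` norm and its weighted
integral are both bounded by the gradient alone. -/
theorem exists_deviation_smooth_le [Nonempty M] (h : g.HasPoincare b Set.univ) (hb1 : 1 < b)
    (hb2 : b ≤ 2) (hρ : AEStronglyMeasurable ρ g.vol) (hρb : ∫⁻ x, ‖ρ x‖ₑ ^ b ∂g.vol ≠ ⊤)
    (hρ0 : ∫ x, ρ x ∂g.vol ≠ 0) :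
    ∃ C : ℝ≥0∞, C ≠ ⊤ ∧ ∀ φ ∈ smoothFunctions n M,
      eLpNorm (deviation g ρ φ) 2 g.vol ≤ C * g.energy (differential φ) ^ (1 / 2 : ℝ) := by
  obtain ⟨C, hC, hP⟩ := exists_poincare_smooth h hb1 hb2
  obtain ⟨D, _, hI⟩ := exists_integrable_weight_mul h hb1 hb2 hρ hρb
  have hρi := integrable_weight hb1 hρ hρb
  set K := ‖((∫ z, ρ z ∂g.vol : ℝ) : ℂ)⁻¹‖ₑ * g.vol Set.univ ^ (1 / 2 : ℝ) with hK
  have hKt : K ≠ ⊤ := ENNReal.mul_ne_top enorm_ne_top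
    (ENNReal.rpow_ne_top_of_nonneg (by norm_num) (measure_ne_top _ _))
  set W := (∫⁻ x, ‖ρ x‖ₑ ^ b ∂g.vol) ^ (1 / b) with hW
  have hWt : W ≠ ⊤ := ENNReal.rpow_ne_top_of_nonneg (by positivity) hρb
  refine ⟨C + K * (C * W), ENNReal.add_ne_top.2 ⟨hC, ENNReal.mul_ne_top hKt
    (ENNReal.mul_ne_top hC hWt)⟩, fun φ hφ => ?_⟩
  obtain ⟨m, hm1, hm2⟩ := hP φ hφ
  have hφm : AEStronglyMeasurable φ g.vol := aestronglyMeasurable_smooth g hφ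
  have e : deviation g ρ φ = deviation g ρ (φ - fun _ => m) := by
    have i2 : Integrable (fun x => (ρ x : ℂ) * (fun _ : M => m) x) g.vol := hρi.ofReal.mul_const m
    rw [deviation_sub (hI φ _ (memLp_smooth hφ 2) (graphLimit_smooth hφ)).1 i2,
      deviation_const hρ0, sub_zero]
  rw [e]
  refine (eLpNorm_deviation_le (hφm.sub aestronglyMeasurable_const)).trans ?_
  calc _ ≤ C * g.energy (differential φ) ^ (1 / 2 : ℝ) +
        K * (C * (W * g.energy (differential φ) ^ (1 / 2 : ℝ))) := by
        gcongr
        · exact hm1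
        · exact (enorm_integral_weight_mul_le _).trans (hm2 _ hρ.enorm)
    _ = _ := by ring

/-- The Poincaré inequality on the closure of the graph of the differential. -/
theorem exists_deviation_le [Nonempty M] (h : g.HasPoincare b Set.univ) (hb1 : 1 < b)
    (hb2 : b ≤ 2) (hρ : AEStronglyMeasurable ρ g.vol) (hρb : ∫⁻ x, ‖ρ x‖ₑ ^ b ∂g.vol ≠ ⊤)
    (hρ0 : ∫ x, ρ x ∂g.vol ≠ 0) :
    ∃ C : ℝ≥0∞, C ≠ ⊤ ∧ ∀ (u : M → ℂ) (α : CovectorField n M), MemLp u 2 g.vol →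
      g.GraphLimit u α →
      eLpNorm (deviation g ρ u) 2 g.vol ≤ C * (2 * g.energy α) ^ (1 / 2 : ℝ) := by
  obtain ⟨C, hC, hP⟩ := exists_deviation_smooth_le h hb1 hb2 hρ hρb hρ0
  obtain ⟨D, hD, hI⟩ := exists_integrable_weight_mul h hb1 hb2 hρ hρb
  set K := ‖((∫ z, ρ z ∂g.vol : ℝ) : ℂ)⁻¹‖ₑ * g.vol Set.univ ^ (1 / 2 : ℝ) with hK
  have hKt : K ≠ ⊤ := ENNReal.mul_ne_top enorm_ne_top
    (ENNReal.rpow_ne_top_of_nonneg (by norm_num) (measure_ne_top _ _))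
  refine ⟨C, hC, fun u α hu hα => ?_⟩
  obtain ⟨hαm, φ, hφ, h1, h2⟩ := id hα
  -- Write the deviation of `u` as that of `φ k` minus that of `φ k - u`. The former obeys the
  -- smooth inequality; the latter tends to zero by the bound on `∫ ρ (φ k - u)` in terms of the
  -- `L²` norm and the energy.
  have hbound : ∀ k, eLpNorm (deviation g ρ u) 2 g.vol ≤
      (eLpNorm (fun x => φ k x - u x) 2 g.vol + K * (D * (eLpNorm (fun x => φ k x - u x) 2 g.vol +
        (2 * g.energy (differential (φ k) - α)) ^ (1 / 2 : ℝ)))) +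
      C * (2 * g.energy (differential (φ k) - α) + 2 * g.energy α) ^ (1 / 2 : ℝ) := by
    intro k
    have hφk := memLp_smooth (g := g) (hφ k) 2
    have i1 := (hI _ _ hφk (graphLimit_smooth (hφ k))).1
    have i2 := (hI _ _ hu hα).1
    have i3 := (hI _ _ (hφk.sub hu) ((graphLimit_smooth (hφ k)).sub hφk.1 hu.1 hα)).2
    have e : deviation g ρ u = deviation g ρ (φ k) - deviation g ρ (φ k - u) := by
      rw [deviation_sub i1 i2, sub_sub_cancel]
    rw [e]
    refine (eLpNorm_sub_le (hφk.1.sub aestronglyMeasurable_const)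
      ((hφk.1.sub hu.1).sub aestronglyMeasurable_const) (by norm_num)).trans ?_
    rw [add_comm]
    gcongr
    · refine (eLpNorm_deviation_le (hφk.1.sub hu.1)).trans ?_
      exact add_le_add le_rfl (mul_le_mul_right i3 K)
    · refine (hP _ (hφ k)).trans ?_
      gcongr
      exact energy_differential_le (hφ k) hαm
  refine ge_of_tendsto' (x := atTop) ?_ hbound
  have a1 : Tendsto (fun k => (2 * g.energy (differential (φ k) - α)) ^ (1 / 2 : ℝ)) atTop
      (𝓝 0) := tendsto_rpow_zero (tendsto_const_mul_zero h2 (by norm_num)) (by norm_num)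
  have a2 := h1.add a1
  rw [add_zero] at a2
  have a3 := h1.add (tendsto_const_mul_zero (tendsto_const_mul_zero a2 hD) hKt)
  rw [add_zero] at a3
  have a4 := a3.add (ENNReal.Tendsto.const_mul (a := C) (tendsto_energy_bound h2) (Or.inr hC))
  rwa [zero_add] at a4

end Deviation

/-! ### Choice of the exponent. -/

section Exponents

variable {n : ℕ} [NeZero n] {M : Type*} [TopologicalSpace M]
  [ChartedSpace (EuclideanHalfSpace n) M] [MeasurableSpace M] [BorelSpace M] [CompactSpace M]
  {g : RoughMetric n M}

/-- An exponent above `n / 2` may be lowered to a real exponent in `(1, 2]` that is subcritical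
for the Sobolev embedding. -/
theorem exists_subcritical_exponent {μ : Measure M} [IsFiniteMeasure μ] {ρ : M → ℝ} (hn : 2 ≤ n)
    {β : ℝ≥0∞} (hβ : (n : ℝ≥0∞) / 2 < β) (hρ : MemLp ρ β μ) :
    ∃ b : ℝ, 1 < b ∧ b ≤ 2 ∧ n * (1 / b - 1 / 2) < 1 ∧ ∫⁻ x, ‖ρ x‖ₑ ^ b ∂μ ≠ ⊤ := by
  have key : ∀ b : ℝ, 1 < b → ENNReal.ofReal b ≤ β → ∫⁻ x, ‖ρ x‖ₑ ^ b ∂μ ≠ ⊤ := by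
    intro b hb hbβ
    have hb0 : 0 < b := by linarith
    have h := lintegral_rpow_enorm_lt_top_of_eLpNorm_lt_top (by simpa using hb0)
      ENNReal.ofReal_ne_top (hρ.mono_exponent hbβ).2
    rw [ENNReal.toReal_ofReal hb0.le] at h
    exact h.ne
  have hn' : (2 : ℝ) ≤ n := by exact_mod_cast hn
  rcases le_or_gt 2 β with h2 | h2
  · exact ⟨2, by norm_num, le_rfl, by norm_num, key 2 (by norm_num) (by simpa using h2)⟩
  · have hβt : β ≠ ⊤ := ne_top_of_lt h2
    have hr : (n : ℝ) / 2 < β.toReal := by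
      have := (ENNReal.toReal_lt_toReal (ENNReal.div_ne_top (by simp) (by simp)) hβt).2 hβ
      simpa using this
    have hr2 : β.toReal < 2 := by
      simpa using (ENNReal.toReal_lt_toReal hβt (by simp)).2 h2
    have hr1 : 1 < β.toReal := by linarith
    refine ⟨β.toReal, hr1, hr2.le, ?_, key _ hr1 (by rw [ENNReal.ofReal_toReal hβt])⟩
    -- With `b = β < 2`, this and `n ≥ 2` give `n (1/b - 1/2) < 2 - n/2 ≤ 1`.
    have h3 : (n : ℝ) * (1 / β.toReal) < 2 := by
      rw [mul_one_div, div_lt_iff₀ (by linarith)]; linarith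
    linarith [mul_sub (n : ℝ) (1 / β.toReal) (1 / 2)]

end Exponents

/-- The triangle inequality of the seminorm of a semidefinite inner product. The arguments are
swapped because Mathlib's inner products are linear in the second variable and `B` is linear in the
first. -/
theorem sqrt_re_form_add_le {V : Type*} [AddCommGroup V] [Module ℂ V] (B : V → V → ℂ)
    (hadd : ∀ u v w, B (u + v) w = B u w + B v w) (hsmul : ∀ (r : ℂ) u v, B (r • u) v = r * B u v)
    (hconj : ∀ u v, conj (B u v) = B v u) (hnonneg : ∀ u, 0 ≤ (B u u).re) (u v : V) :
    √(B (u + v) (u + v)).re ≤ √(B u u).re + √(B v v).re := by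
  let c : PreInnerProductSpace.Core ℂ V :=
    { inner := fun x y => B y x
      conj_inner_symm := fun x y => hconj x y
      re_inner_nonneg := fun x => hnonneg x
      add_left := fun x y z => by
        show B z (x + y) = B z x + B z y
        rw [← hconj (x + y) z, hadd, map_add, hconj, hconj]
      smul_left := fun x y r => by
        show B y (r • x) = conj r * B y x
        rw [← hconj (r • x) y, hsmul, map_mul, hconj] }
  let _ := @InnerProductSpace.Core.toSeminormedAddCommGroup ℂ V _ _ _ c
  exact norm_add_le u v

/-! ### Hilbert space structure of `H¹`, closed subspaces and orthogonal complements. -/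

section SobolevSpace

variable {n : ℕ} [NeZero n] {M : Type*} [TopologicalSpace M]
  [ChartedSpace (EuclideanHalfSpace n) M] [MeasurableSpace M] [BorelSpace M] [CompactSpace M]
  {g : RoughMetric n M} {u v w : L2 g}

theorem graphLimit_grad (hu : u ∈ H1 g) : g.GraphLimit u (grad g u) := by
  have h : ∃ α, InGraphClosure g (smoothFunctions n M) u α := hu
  rw [grad, dif_pos h]
  exact h.choose_spec

theorem graphLimit_add (hu : u ∈ H1 g) (hv : v ∈ H1 g) :
    g.GraphLimit (u + v : L2 g) (grad g u + grad g v) :=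
  ((graphLimit_grad hu).add (Lp.aestronglyMeasurable u) (Lp.aestronglyMeasurable v)
    (graphLimit_grad hv)).congr (Lp.coeFn_add u v).symm

theorem graphLimit_const_smul (hu : u ∈ H1 g) (r : ℂ) :
    g.GraphLimit (r • u : L2 g) (r • grad g u) :=
  ((graphLimit_grad hu).smul r).congr (Lp.coeFn_smul r u).symm

/-- The Sobolev space as a linear subspace of `L²`. -/
def h1Submodule (g : RoughMetric n M) : Submodule ℂ (L2 g) where
  carrier := H1 g
  add_mem' hu hv := ⟨_, graphLimit_add hu hv⟩
  zero_mem' := ⟨_, (graphLimit_smooth (φ := 0) contMDiff_const).congr (Lp.coeFn_zero ℂ 2 g.vol).symm⟩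
  smul_mem' r _ hu := ⟨_, graphLimit_const_smul hu r⟩

/-- `grad` is a chosen limit, so its additivity holds only almost everywhere, by uniqueness of the
limit in the graph closure. -/
theorem grad_add (hu : u ∈ H1 g) (hv : v ∈ H1 g) :
    ∀ᵐ x ∂g.vol, grad g (u + v) x = grad g u x + grad g v x :=
  (graphLimit_grad ((h1Submodule g).add_mem hu hv)).unique (Lp.aestronglyMeasurable _)
    (graphLimit_add hu hv)

theorem grad_smul (hu : u ∈ H1 g) (r : ℂ) : ∀ᵐ x ∂g.vol, grad g (r • u) x = r • grad g u x :=
  (graphLimit_grad ((h1Submodule g).smul_mem r hu)).unique (Lp.aestronglyMeasurable _)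
    (graphLimit_const_smul hu r)

theorem integrable_coInner_grad (hu : u ∈ H1 g) (hv : v ∈ H1 g) :
    Integrable (fun x => g.coInner x (grad g u x) (grad g v x)) g.vol :=
  integrable_coInner g (graphLimit_grad hu).1 (graphLimit_grad hv).1
    (graphLimit_grad hu).energy_lt_top (graphLimit_grad hv).energy_lt_top

theorem dirichletForm_add_left (hu : u ∈ H1 g) (hv : v ∈ H1 g) (hw : w ∈ H1 g) :
    dirichletForm g (u + v) w = dirichletForm g u w + dirichletForm g v w := by
  rw [dirichletForm, dirichletForm, dirichletForm,
    ← integral_add (integrable_coInner_grad hu hw) (integrable_coInner_grad hv hw)]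
  refine integral_congr_ae ?_
  filter_upwards [grad_add hu hv] with x hx
  rw [hx, coInner_add_left]

theorem dirichletForm_smul_left (hu : u ∈ H1 g) (r : ℂ) :
    dirichletForm g (r • u) v = r * dirichletForm g u v := by
  rw [dirichletForm, dirichletForm, ← integral_const_mul]
  refine integral_congr_ae ?_
  filter_upwards [grad_smul hu r] with x hx
  rw [hx, coInner_smul_left]

theorem conj_dirichletForm : conj (dirichletForm g u v) = dirichletForm g v u := by
  rw [dirichletForm, dirichletForm, ← integral_conj]
  exact integral_congr_ae (ae_of_all _ fun x => conj_coInner g x _ _)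

theorem dirichletForm_self (hu : u ∈ H1 g) :
    dirichletForm g u u = ((g.energy (grad g u)).toReal : ℂ) := by
  have h : ∀ x, g.coInner x (grad g u x) (grad g u x) =
      ((g.coInner x (grad g u x) (grad g u x)).re : ℂ) := fun x =>
    (Complex.conj_eq_iff_re.1 (conj_coInner g x _ _)).symm
  have hm := aemeasurable_coInner g (graphLimit_grad hu).1 (graphLimit_grad hu).1
  rw [dirichletForm, integral_congr_ae (ae_of_all _ h), integral_complex_ofReal,
    integral_eq_lintegral_of_nonneg_ae (ae_coInner_self_nonneg g _)
      (Complex.measurable_re.comp_aemeasurable hm).aestronglyMeasurable]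
  rfl

theorem energyNorm_sq (hu : u ∈ H1 g) : energyNorm g u ^ 2 = (g.energy (grad g u)).toReal := by
  rw [energyNorm, dirichletForm_self hu, Complex.ofReal_re, Real.sq_sqrt ENNReal.toReal_nonneg]

theorem energyNorm_nonneg (u : L2 g) : 0 ≤ energyNorm g u := Real.sqrt_nonneg _

theorem energy_grad_eq (hu : u ∈ H1 g) :
    g.energy (grad g u) = ENNReal.ofReal (energyNorm g u ^ 2) := by
  rw [energyNorm_sq hu, ENNReal.ofReal_toReal (graphLimit_grad hu).energy_lt_top.ne]

theorem sqrt_two_energy_le (hu : u ∈ H1 g) :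
    (2 * g.energy (grad g u)) ^ (1 / 2 : ℝ) ≤ ENNReal.ofReal (2 * energyNorm g u) := by
  have h0 := energyNorm_nonneg u
  rw [energy_grad_eq hu, ← ENNReal.ofReal_ofNat 2, ← ENNReal.ofReal_mul (by norm_num),
    ENNReal.ofReal_rpow_of_nonneg (by positivity) (by norm_num), ← Real.sqrt_eq_rpow]
  refine ENNReal.ofReal_le_ofReal (Real.sqrt_le_iff.2 ⟨by positivity, ?_⟩)
  nlinarith [sq_nonneg (energyNorm g u)]

theorem energyNorm_add_le (hu : u ∈ H1 g) (hv : v ∈ H1 g) :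
    energyNorm g (u + v) ≤ energyNorm g u + energyNorm g v :=
  sqrt_re_form_add_le (V := h1Submodule g) (fun a b => dirichletForm g (a : L2 g) b)
    (fun a b c => dirichletForm_add_left a.2 b.2 c.2) (fun r a _ => dirichletForm_smul_left a.2 r)
    (fun _ _ => conj_dirichletForm)
    (fun a => by rw [dirichletForm_self a.2]; exact ENNReal.toReal_nonneg) ⟨u, hu⟩ ⟨v, hv⟩

theorem energyNorm_smul (hu : u ∈ H1 g) (r : ℂ) :
    energyNorm g (r • u) = ‖r‖ * energyNorm g u := by
  have hr := (h1Submodule g).smul_mem r hu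
  refine (sq_eq_sq₀ (energyNorm_nonneg _)
    (mul_nonneg (norm_nonneg r) (energyNorm_nonneg u))).1 ?_
  have h : g.energy (grad g (r • u)) = ENNReal.ofReal (‖r‖ ^ 2) * g.energy (grad g u) := by
    rw [energy_congr g (grad_smul hu r)]
    exact energy_smul g _ r
  rw [mul_pow, energyNorm_sq hr, energyNorm_sq hu, h, ENNReal.toReal_mul,
    ENNReal.toReal_ofReal (by positivity)]

theorem integral_mul_conj (u v : L2 g) :
    ∫ x, u x * conj (v x) ∂g.vol = inner ℂ v u := by
  rw [L2.inner_def]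
  rfl

theorem h1Inner_add_left (hu : u ∈ H1 g) (hv : v ∈ H1 g) (hw : w ∈ H1 g) :
    h1Inner g (u + v) w = h1Inner g u w + h1Inner g v w := by
  simp only [h1Inner, integral_mul_conj, inner_add_right, dirichletForm_add_left hu hv hw]
  ring

theorem h1Inner_smul_left (hu : u ∈ H1 g) (r : ℂ) :
    h1Inner g (r • u) v = r * h1Inner g u v := by
  simp only [h1Inner, integral_mul_conj, inner_smul_right, dirichletForm_smul_left hu r]
  ring

theorem h1Inner_self (hu : u ∈ H1 g) :
    h1Inner g u u = ((‖u‖ ^ 2 + energyNorm g u ^ 2 : ℝ) : ℂ) := by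
  rw [h1Inner, integral_mul_conj, inner_self_eq_norm_sq_to_K, dirichletForm_self hu,
    energyNorm_sq hu]
  push_cast
  rfl

theorem eq_zero_of_h1Inner_self (hu : u ∈ H1 g) (h : h1Inner g u u = 0) : u = 0 := by
  rw [h1Inner_self hu, Complex.ofReal_eq_zero] at h
  have : ‖u‖ ^ 2 = 0 := by nlinarith [sq_nonneg ‖u‖, sq_nonneg (energyNorm g u)]
  exact norm_eq_zero.1 (pow_eq_zero_iff (two_ne_zero) |>.1 this)

theorem h1Norm_eq (hu : u ∈ H1 g) : h1Norm g u = √(‖u‖ ^ 2 + energyNorm g u ^ 2) := by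
  rw [h1Norm, h1Inner_self hu, Complex.ofReal_re]

theorem norm_le_h1Norm (hu : u ∈ H1 g) : ‖u‖ ≤ h1Norm g u := by
  rw [h1Norm_eq hu]
  exact Real.le_sqrt_of_sq_le (by nlinarith [sq_nonneg (energyNorm g u)])

theorem energyNorm_le_h1Norm (hu : u ∈ H1 g) : energyNorm g u ≤ h1Norm g u := by
  rw [h1Norm_eq hu]
  exact Real.le_sqrt_of_sq_le (by nlinarith [sq_nonneg ‖u‖])

theorem h1Norm_le_add (hu : u ∈ H1 g) : h1Norm g u ≤ ‖u‖ + energyNorm g u := by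
  rw [h1Norm_eq hu]
  refine Real.sqrt_le_iff.2 ⟨add_nonneg (norm_nonneg u) (energyNorm_nonneg u), ?_⟩
  nlinarith [mul_nonneg (norm_nonneg u) (energyNorm_nonneg u)]

theorem eLpNorm_eq_ofReal_norm (u : L2 g) : eLpNorm u 2 g.vol = ENNReal.ofReal ‖u‖ := by
  rw [Lp.norm_def, ENNReal.ofReal_toReal (Lp.eLpNorm_ne_top u)]

/-- A Poincaré inequality on `V` makes the Dirichlet form generate a norm equivalent to the norm
of `H¹`. -/
theorem generatesH1Norm_of_norm_le {V : Submodule ℂ (L2 g)} (hV : (V : Set (L2 g)) ⊆ H1 g) {C : ℝ}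
    (hC : 0 < C) (h : ∀ u ∈ V, ‖u‖ ≤ C * energyNorm g u) : GeneratesH1Norm g V where
  form_nonneg u hu := by
    rw [dirichletForm_self (hV hu)]
    exact ⟨ENNReal.toReal_nonneg, Complex.ofReal_im _⟩
  add_le u hu v hv := energyNorm_add_le (hV hu) (hV hv)
  smul_eq c u hu := energyNorm_smul (hV hu) c
  eq_zero u hu h0 := by
    have := h u hu
    rw [h0, mul_zero] at this
    exact norm_le_zero_iff.1 this
  equivalent := by
    -- The `H¹` norm is at most `‖u‖ + energyNorm g u`, hence at most `C + 1` times the energy norm.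
    refine ⟨(C + 1)⁻¹, 1, by positivity, one_pos, fun u hu => ⟨?_, ?_⟩⟩
    · rw [inv_mul_le_iff₀ (by positivity)]
      linarith [h1Norm_le_add (hV hu), h u hu]
    · rw [one_mul]
      exact energyNorm_le_h1Norm (hV hu)

/-- If `ℓ (u k) = 0`, then `|ℓ v| = |ℓ (u k - v)|`, which tends to zero by boundedness of `ℓ`. -/
theorem IsH1Closed.inter_ker {W : Submodule ℂ (L2 g)} (hW : (W : Set (L2 g)) ⊆ H1 g)
    (hWc : IsH1Closed g (W : Set (L2 g))) {ℓ : L2 g → ℂ}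
    (hsub : ∀ u ∈ H1 g, ∀ v ∈ H1 g, ℓ (u - v) = ℓ u - ℓ v) {C : ℝ}
    (hC : ∀ u ∈ H1 g, ‖ℓ u‖ ≤ C * h1Norm g u) : IsH1Closed g {u | u ∈ W ∧ ℓ u = 0} := by
  intro u v hu hv h
  refine ⟨hWc u v (fun k => (hu k).1) hv h, ?_⟩
  have hle : ∀ k, ‖ℓ v‖ ≤ C * h1Norm g (u k - v) := fun k => by
    have h1 := hC _ ((h1Submodule g).sub_mem (hW (hu k).1) hv)
    rwa [hsub _ (hW (hu k).1) _ hv, (hu k).2, zero_sub, norm_neg] at h1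
  have hlim := h.const_mul C
  rw [mul_zero] at hlim
  exact norm_le_zero_iff.1 (ge_of_tendsto' hlim hle)

/-- The orthogonal complement in `W` with respect to the inner product of `H¹`. -/
def orthSubmodule {W : Submodule ℂ (L2 g)} (hW : (W : Set (L2 g)) ⊆ H1 g) {S : Set (L2 g)}
    (hS : S ⊆ H1 g) : Submodule ℂ (L2 g) where
  carrier := orthIn g W S
  add_mem' hu hv := ⟨W.add_mem hu.1 hv.1, fun z hz => by
    rw [h1Inner_add_left (hW hu.1) (hW hv.1) (hS hz), hu.2 z hz, hv.2 z hz, add_zero]⟩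
  zero_mem' := ⟨W.zero_mem, fun z _ => by
    rw [← zero_smul ℂ (0 : L2 g), h1Inner_smul_left (hW W.zero_mem), zero_mul]⟩
  smul_mem' r u hu := ⟨W.smul_mem r hu.1, fun z hz => by
    rw [h1Inner_smul_left (hW hu.1), hu.2 z hz, mul_zero]⟩

/-- The projection of the complement to `W / Z` is injective, since an element of `Z` orthogonal to
`Z` is orthogonal to itself. No completeness or orthogonal projection is involved. -/
theorem rank_orthSubmodule_le {W Z : Submodule ℂ (L2 g)} (hW : (W : Set (L2 g)) ⊆ H1 g)
    (hZ : (Z : Set (L2 g)) ⊆ H1 g) :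
    Module.rank ℂ (orthSubmodule hW hZ) ≤ Module.rank ℂ (W ⧸ Z.submoduleOf W) := by
  have hle : orthSubmodule hW hZ ≤ W := fun u hu => hu.1
  refine LinearMap.rank_le_of_injective
    ((Z.submoduleOf W).mkQ ∘ₗ Submodule.inclusion hle) ?_
  rw [← LinearMap.ker_eq_bot, LinearMap.ker_eq_bot']
  intro u hu
  have hz : (u : L2 g) ∈ Z := by
    rw [LinearMap.comp_apply, Submodule.mkQ_apply, Submodule.Quotient.mk_eq_zero] at hu
    exact hu
  exact Subtype.ext (eq_zero_of_h1Inner_self (hZ hz) (u.2.2 _ hz))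

/-- `W / Z` is a quotient of `W / ker ℓ`, which is isomorphic to the range of `ℓ` in `ℂ`. -/
theorem rank_quotient_submoduleOf_le_one {V : Type*} [AddCommGroup V] [Module ℂ V]
    {W Z : Submodule ℂ V} (ℓ : W →ₗ[ℂ] ℂ) (h : ∀ u : W, ℓ u = 0 → (u : V) ∈ Z) :
    Module.rank ℂ (W ⧸ Z.submoduleOf W) ≤ 1 := by
  have hle : LinearMap.ker ℓ ≤ Z.submoduleOf W := fun u hu => h u hu
  refine (LinearMap.rank_le_of_surjective _ (Submodule.factor_surjective hle)).trans ?_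
  have h1 := ℓ.quotKerEquivRange.lift_rank_eq
  rw [Cardinal.lift_uzero] at h1
  rw [h1]
  exact Cardinal.lift_le_one_iff.2 ((Submodule.rank_le _).trans (Module.rank_self ℂ).le)

end SobolevSpace

/-! ### The weight functional and the Poincaré inequality on `H¹`. -/

section WeightFunctional

variable {n : ℕ} [NeZero n] {M : Type*} [TopologicalSpace M]
  [ChartedSpace (EuclideanHalfSpace n) M] [MeasurableSpace M] [BorelSpace M] [CompactSpace M]
  {g : RoughMetric n M} {ρ : M → ℝ} {u v : L2 g}

theorem exists_weighted_poincare [ConnectedSpace M] [IsManifold (𝓡∂ n) ∞ M] (hn : 2 ≤ n)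
    {β : ℝ≥0∞} (hβ : (n : ℝ≥0∞) / 2 < β) (hρ : MemLp ρ β g.vol) (hρ0 : ∫ x, ρ x ∂g.vol ≠ 0) :
    ∃ C : ℝ, 0 < C ∧ ∀ u ∈ H1 g, Integrable (fun x => (ρ x : ℂ) * u x) g.vol ∧
      ‖∫ x, (ρ x : ℂ) * u x ∂g.vol‖ ≤ C * h1Norm g u ∧
      eLpNorm (fun x => u x - ((∫ z, ρ z ∂g.vol : ℝ) : ℂ)⁻¹ * ∫ z, (ρ z : ℂ) * u z ∂g.vol) 2 g.vol
        ≤ ENNReal.ofReal (C * energyNorm g u) := by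
  obtain ⟨b, hb1, hb2, hb, hρb⟩ := exists_subcritical_exponent hn hβ hρ
  have hP := hasPoincare_univ g hb1 hb2 hb
  obtain ⟨C, hC, hI⟩ := exists_integrable_weight_mul hP hb1 hb2 hρ.1 hρb
  obtain ⟨D, hD, hdev⟩ := exists_deviation_le hP hb1 hb2 hρ.1 hρb hρ0
  have hC0 : 0 ≤ C.toReal := ENNReal.toReal_nonneg
  have hD0 : 0 ≤ D.toReal := ENNReal.toReal_nonneg
  -- One constant for both bounds: `‖u‖ + 2 energyNorm g u` is at most three `H¹` norms, `2 *
  -- D.toReal` covers the deviation since `√2 ≤ 2`, and `1` ensures positivity.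
  refine ⟨3 * C.toReal + 2 * D.toReal + 1, by positivity, fun u hu => ?_⟩
  have hE0 := energyNorm_nonneg u
  obtain ⟨h1, h2⟩ := hI u _ (Lp.memLp u) (graphLimit_grad hu)
  have hE := sqrt_two_energy_le hu
  refine ⟨h1, ?_, (hdev u _ (Lp.memLp u) (graphLimit_grad hu)).trans ?_⟩
  · have h3 : ‖∫ x, (ρ x : ℂ) * u x ∂g.vol‖ₑ ≤
        ENNReal.ofReal (C.toReal * (‖u‖ + 2 * energyNorm g u)) := by
      rw [ENNReal.ofReal_mul hC0, ENNReal.ofReal_toReal hC,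
        ENNReal.ofReal_add (norm_nonneg u) (by positivity), ← eLpNorm_eq_ofReal_norm]
      exact h2.trans (by gcongr)
    rw [← ofReal_norm, ENNReal.ofReal_le_ofReal_iff (by positivity)] at h3
    have hH0 : 0 ≤ h1Norm g u := hE0.trans (energyNorm_le_h1Norm hu)
    calc _ ≤ C.toReal * (‖u‖ + 2 * energyNorm g u) := h3
      _ ≤ C.toReal * (3 * h1Norm g u) := by
        gcongr
        linarith [norm_le_h1Norm hu, energyNorm_le_h1Norm hu]
      _ ≤ _ := by nlinarith [mul_nonneg hD0 hH0]
  · calc D * (2 * g.energy (grad g u)) ^ (1 / 2 : ℝ)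
        ≤ ENNReal.ofReal D.toReal * ENNReal.ofReal (2 * energyNorm g u) := by
          rw [ENNReal.ofReal_toReal hD]
          gcongr
      _ = ENNReal.ofReal (D.toReal * (2 * energyNorm g u)) := (ENNReal.ofReal_mul hD0).symm
      _ ≤ _ := ENNReal.ofReal_le_ofReal (by nlinarith [mul_nonneg hC0 hE0])

theorem integral_weight_mul_add (hu : Integrable (fun x => (ρ x : ℂ) * u x) g.vol)
    (hv : Integrable (fun x => (ρ x : ℂ) * v x) g.vol) :
    ∫ x, (ρ x : ℂ) * (u + v : L2 g) x ∂g.vol =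
      ∫ x, (ρ x : ℂ) * u x ∂g.vol + ∫ x, (ρ x : ℂ) * v x ∂g.vol := by
  rw [← integral_add hu hv]
  refine integral_congr_ae ?_
  filter_upwards [Lp.coeFn_add u v] with x hx
  rw [hx, Pi.add_apply, mul_add]

theorem integral_weight_mul_smul (r : ℂ) :
    ∫ x, (ρ x : ℂ) * (r • u : L2 g) x ∂g.vol = r * ∫ x, (ρ x : ℂ) * u x ∂g.vol := by
  rw [← integral_const_mul]
  refine integral_congr_ae ?_
  filter_upwards [Lp.coeFn_smul r u] with x hx
  rw [hx, Pi.smul_apply, smul_eq_mul]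
  ring

/-- The functional `u ↦ ∫ ρ u` on `H¹`. -/
def weightFunctional (g : RoughMetric n M) (ρ : M → ℝ)
    (hint : ∀ u ∈ H1 g, Integrable (fun x => (ρ x : ℂ) * u x) g.vol) :
    h1Submodule g →ₗ[ℂ] ℂ where
  toFun u := ∫ x, (ρ x : ℂ) * (u : L2 g) x ∂g.vol
  map_add' u v := integral_weight_mul_add (hint u u.2) (hint v v.2)
  map_smul' r _ := integral_weight_mul_smul r

end WeightFunctional

end RoughRiemannian

end

/-! ### The main theorem. -/

theorem mainTheorem7 {n : ℕ} [NeZero n] (hn : 2 ≤ n) {M : Type*} [TopologicalSpace M]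
    [T2Space M] [CompactSpace M] [ConnectedSpace M]
    [ChartedSpace (EuclideanHalfSpace n) M] [IsManifold (𝓡∂ n) ∞ M]
    [MeasurableSpace M] [BorelSpace M]
    (g : RoughRiemannian.RoughMetric n M)
    (β : ℝ≥0∞) (hβ : (n : ℝ≥0∞) / 2 < β)
    (ρ : M → ℝ) (hρ : MemLp ρ β g.vol) (hρ0 : ∫ x, ρ x ∂g.vol ≠ 0) :
    -- the Poincare inequality
    ((∀ u ∈ RoughRiemannian.H1 g, Integrable (fun x => (ρ x : ℂ) * u x) g.vol) ∧
      ∃ C : ℝ, 0 < C ∧ ∀ u ∈ RoughRiemannian.H1 g,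
        eLpNorm (fun x => u x - ((∫ z, ρ z ∂g.vol : ℝ) : ℂ)⁻¹ *
            ∫ z, (ρ z : ℂ) * u z ∂g.vol) 2 g.vol
          ≤ ENNReal.ofReal (C * RoughRiemannian.energyNorm g u)) ∧
    -- `Z(ρ)` is a closed subspace of codimension at most one with the asserted energy norm
    ∀ W : Submodule ℂ (RoughRiemannian.L2 g), RoughRiemannian.IsAdmissible g W →
      ∃ Z : Submodule ℂ (RoughRiemannian.L2 g),
        (Z : Set (RoughRiemannian.L2 g)) = RoughRiemannian.Z g W ρ ∧
        RoughRiemannian.IsH1Closed g (Z : Set (RoughRiemannian.L2 g)) ∧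
        Module.rank ℂ (W ⧸ Z.submoduleOf W) ≤ 1 ∧
        (∃ P : Submodule ℂ (RoughRiemannian.L2 g),
          (P : Set (RoughRiemannian.L2 g)) = RoughRiemannian.orthIn g W (Z : Set _) ∧
          Module.rank ℂ P ≤ 1) ∧
        RoughRiemannian.GeneratesH1Norm g Z := by
  obtain ⟨C, hC, hCu⟩ := RoughRiemannian.exists_weighted_poincare hn hβ hρ hρ0
  have hint := fun u hu => (hCu u hu).1
  refine ⟨⟨hint, C, hC, fun u hu => (hCu u hu).2.2⟩, fun W hW => ?_⟩
  by_cases hgen : RoughRiemannian.GeneratesH1Norm g W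
  -- Here `Z(ρ)` is all of `W`, so the zero functional serves to bound the codimension.
  · have hrank : Module.rank ℂ (W ⧸ W.submoduleOf W) ≤ 1 :=
      RoughRiemannian.rank_quotient_submoduleOf_le_one 0 fun u _ => u.2
    exact ⟨W, by rw [RoughRiemannian.Z, if_pos hgen], hW.closed, hrank,
      ⟨RoughRiemannian.orthSubmodule hW.le_H1 hW.le_H1, rfl,
        (RoughRiemannian.rank_orthSubmodule_le hW.le_H1 hW.le_H1).trans hrank⟩, hgen⟩
  · have hle : W ≤ RoughRiemannian.h1Submodule g := hW.le_H1
    set ℓ := RoughRiemannian.weightFunctional g ρ hint ∘ₗ Submodule.inclusion hle with hℓ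
    have hmem : ∀ u, u ∈ (LinearMap.ker ℓ).map W.subtype ↔
        u ∈ W ∧ ∫ x, (ρ x : ℂ) * u x ∂g.vol = 0 := by
      intro u
      constructor
      · rintro ⟨v, hv, rfl⟩
        exact ⟨v.2, hv⟩
      · rintro ⟨hu, h0⟩
        exact ⟨⟨u, hu⟩, h0, rfl⟩
    have hZ : (((LinearMap.ker ℓ).map W.subtype : Submodule ℂ (RoughRiemannian.L2 g)) :
        Set (RoughRiemannian.L2 g)) = {u | u ∈ W ∧ ∫ x, (ρ x : ℂ) * u x ∂g.vol = 0} :=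
      Set.ext hmem
    have hZH : (((LinearMap.ker ℓ).map W.subtype : Submodule ℂ (RoughRiemannian.L2 g)) :
        Set (RoughRiemannian.L2 g)) ⊆ RoughRiemannian.H1 g :=
      fun u hu => hW.le_H1 ((hmem u).1 hu).1
    have hrank : Module.rank ℂ (W ⧸ ((LinearMap.ker ℓ).map W.subtype).submoduleOf W) ≤ 1 :=
      RoughRiemannian.rank_quotient_submoduleOf_le_one ℓ fun u hu => ⟨u, hu, rfl⟩
    refine ⟨(LinearMap.ker ℓ).map W.subtype, by rw [hZ, RoughRiemannian.Z, if_neg hgen], ?_, hrank,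
      ⟨RoughRiemannian.orthSubmodule hW.le_H1 hZH, rfl,
        (RoughRiemannian.rank_orthSubmodule_le hW.le_H1 hZH).trans hrank⟩,
      RoughRiemannian.generatesH1Norm_of_norm_le hZH hC fun u hu => ?_⟩
    · rw [hZ]
      exact RoughRiemannian.IsH1Closed.inter_ker hW.le_H1 hW.closed
        (fun u hu v hv => (RoughRiemannian.weightFunctional g ρ hint).map_sub ⟨u, hu⟩ ⟨v, hv⟩)
        fun u hu => (hCu u hu).2.1
    -- On `Z(ρ)` the weighted mean vanishes, so the deviation of `u` is `u` itself and Poincaré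
    -- bounds its `L²` norm by the energy norm.
    · have h := (hCu u (hZH hu)).2.2
      rw [((hmem u).1 hu).2] at h
      simp only [mul_zero, sub_zero] at h
      rw [RoughRiemannian.eLpNorm_eq_ofReal_norm, ENNReal.ofReal_le_ofReal_iff
        (mul_nonneg hC.le (RoughRiemannian.energyNorm_nonneg u))] at h
      exact h
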